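/- **Setting.** *Plant.* Let $Z,P$ be monic real polynomials with $\deg P=n\ge 1$, $\deg Z=n-1$, all roots of $Z$ in the open left half plane (relative degree one, minimum phase; $P$ is arbitrary), and let $k_p\neq 0$. The plant $y=k_p\frac{Z(s)}{P(s)}u$ is realized as $\dot x_p=A_px_p+b_pu$, $y=k_pc_p^Tx_p$ with $\det(sI-A_p)=P(s)$ and $c_p^T\mathrm{adj}(sI-A_p)b_p=Z(s)$. Only the sign of $k_p$ is used by the controller. *Closed-loop reference model.* Let $Z_m,P_m$ be monic with $\deg P_m=m$, $\deg Z_m=m-1$, all roots of $P_m$ in the open left half plane, let $k_m\in\mathbb R$, and let $(A_m,b_m,c_m)$ be an $m$-dimensional realization (for instance the observer canonical form): $\det(sI-A_m)=P_m(s)$ and $c_m^T\mathrm{adj}(sI-A_m)b_m=Z_m(s)$. With a gain $\ell\in\mathbb R^m$ and $e_y=y-y_m$, $$\dot x_m=A_mx_m+b_mk_mr+\ell e_y,\qquad y_m=c_m^Tx_m .$$ Write $k_\ell Z_\ell(s)=c_m^T\mathrm{adj}(sI-A_m)\ell$, so that $k_\ell Z_\ell/P_m$ is the transfer function from $e_y$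 to $y_m$. Assume that $\ell$ is chosen so that $$W_e'(s)=\frac{Z_m(s)}{P_m(s)+k_\ell Z_\ell(s)}$$ is strictly positive real, i.e. for some $\varepsilon>0$ the function $W_e'(s-\varepsilon)$ has no pole and has nonnegative real part in $\mathrm{Re}\,s>0$. *Controller.* Let $\Lambda\in\mathbb R^{(n-1)\times(n-1)}$ be Hurwitz, let $(\Lambda,b_\lambda)$ be controllable, let $Z_m(s)$ divide $\lambda(s)=\det(sI-\Lambda)$ (for example $\lambda=Z_m$), and let $\gamma>0$. Put $$\dot\omega_1=\Lambda\omega_1+b_\lambda u,\quad \dot\omega_2=\Lambda\omega_2+b_\lambda y,\quad \omega=[r,\omega_1^T,y,\omega_2^T]^T,\quad u=\theta^T\omega,\quad \dot\theta=-\gamma\,\mathrm{sign}(k_p)\,e_y\,\omega,\qquad \theta(t)\in\mathbb R^{2n}.$$ A solution on $[0,\infty)$ consists of continuous functions $x_p,\omega_1,\omega_2,\theta,x_m$ that satisfy the differential equations at every $t>0$ at which $r$ is continuous. **Theorem.** The closed loop is globally stable and $e_y$ converges to zero: 1. for every bounded piecewise continuous $r:[0,\infty)\to\mathbb R$ and every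 initial state $(x_p,\omega_1,\omega_2,\theta,x_m)(0)$ a solution exists on $[0,\infty)$; 2. for all $M,R$ there is a $B$ such that for every piecewise continuous $r$ with $|r|\le M$ and every solution for which each of $x_p,\omega_1,\omega_2,\theta,x_m$ has initial norm at most $R$, all the signals $x_p,\omega_1,\omega_2,\theta,x_m,\omega,u,y,y_m,e_y$ are bounded by $B$ on $[0,\infty)$; 3. for every bounded piecewise continuous $r$ and every solution, $\lim_{t\to\infty}e_y(t)=0$. -/

import Mathlib

open Polynomial Matrix Set Filter Topology

noncomputable section

/-- All complex roots of the real polynomial `p` lie in the open left half plane. -/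
def IsHurwitzPoly (p : ℝ[X]) : Prop :=
  ∀ s : ℂ, aeval s p = 0 → s.re < 0

/-- The rational function `N / D` is strictly positive real: for some `ε > 0` the shifted function
`s ↦ (N / D) (s - ε)` is positive real, i.e. it has no pole and has nonnegative real part in the
open right half plane. Roots shared by `N` and `D` are not cancelled; when `N` has all its roots in
the open left half plane this makes no difference, as `ε` can be decreased. -/
def IsSPR (N D : ℝ[X]) : Prop :=
  ∃ ε : ℝ, 0 < ε ∧ ∀ s : ℂ, -ε < s.re → aeval s D ≠ 0 ∧ 0 ≤ (aeval s N / aeval s D).re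

/-- The polynomial `cᵀ adj(s I - A) b`, i.e. the numerator of the transfer function
`cᵀ (s I - A)⁻¹ b` over the denominator `det (s I - A) = A.charpoly`. -/
def tfNum {d : ℕ} (A : Matrix (Fin d) (Fin d) ℝ) (b c : Fin d → ℝ) : ℝ[X] :=
  (fun i => C (c i)) ⬝ᵥ (A.charmatrix.adjugate *ᵥ fun i => C (b i))

/-- `(A, b, c)` is a realization, of order `d = deg D`, of the transfer function `N / D`. -/
def IsRealization {d : ℕ} (A : Matrix (Fin d) (Fin d) ℝ) (b c : Fin d → ℝ) (N D : ℝ[X]) : Prop :=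
  A.charpoly = D ∧ tfNum A b c = N

/-- The single-input pair `(A, b)` is controllable: `b, A b, …, A ^ (d - 1) b` span the state
space. -/
def IsControllablePair {d : ℕ} (A : Matrix (Fin d) (Fin d) ℝ) (b : Fin d → ℝ) : Prop :=
  Submodule.span ℝ (range fun j : Fin d => (A ^ (j : ℕ)) *ᵥ b) = ⊤

/-- `r` is piecewise continuous on `[0, ∞)`: it has finitely many discontinuities in every bounded
interval, and it has finite one-sided limits everywhere. -/
def IsPiecewiseContinuous (r : ℝ → ℝ) : Prop :=
  (∀ T : ℝ, {t : ℝ | 0 < t ∧ t ≤ T ∧ ¬ ContinuousAt r t}.Finite) ∧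
  (∀ t : ℝ, 0 ≤ t → ∃ L : ℝ, Tendsto r (𝓝[>] t) (𝓝 L)) ∧
  (∀ t : ℝ, 0 < t → ∃ L : ℝ, Tendsto r (𝓝[<] t) (𝓝 L))

/-- The constants of the adaptive loop: plant `(Ap, bp, cp, kp)` of order `n`, filter pair
`(Lam, blam)` of order `n - 1`, reference model `(Am, bm, cm, km)` of order `m`, Luenberger gain
`ell`, adaptation gain `gam`. -/
structure LoopData (n m : ℕ) where
  Ap : Matrix (Fin n) (Fin n) ℝ
  bp : Fin n → ℝ
  cp : Fin n → ℝ
  kp : ℝ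
  Lam : Matrix (Fin (n - 1)) (Fin (n - 1)) ℝ
  blam : Fin (n - 1) → ℝ
  Am : Matrix (Fin m) (Fin m) ℝ
  bm : Fin m → ℝ
  cm : Fin m → ℝ
  km : ℝ
  ell : Fin m → ℝ
  gam : ℝ

/-- Index set of the regressor and of the adaptive gain, of size `2 n` when `1 ≤ n`. -/
abbrev GainIdx (n : ℕ) : Type := Unit ⊕ Fin (n - 1) ⊕ Unit ⊕ Fin (n - 1)

/-- The time functions that make up a trajectory of the closed loop: plant state, the two filter
states, the adaptive gain `θ = (k, θ₁, θ₀, θ₂)`, and the state of the reference model. -/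
structure Signals (n m : ℕ) where
  xp : ℝ → Fin n → ℝ
  w1 : ℝ → Fin (n - 1) → ℝ
  w2 : ℝ → Fin (n - 1) → ℝ
  th : ℝ → GainIdx n → ℝ
  xm : ℝ → Fin m → ℝ

namespace Signals

variable {n m : ℕ}

/-- Plant output `y = k_p c_pᵀ x_p`. -/
def y (σ : Signals n m) (S : LoopData n m) (t : ℝ) : ℝ := S.kp * (S.cp ⬝ᵥ σ.xp t)

/-- Reference model output `y_m = c_mᵀ x_m`. -/
def ym (σ : Signals n m) (S : LoopData n m) (t : ℝ) : ℝ := S.cm ⬝ᵥ σ.xm t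

/-- Model following error `e_y = y - y_m`. -/
def ey (σ : Signals n m) (S : LoopData n m) (t : ℝ) : ℝ := σ.y S t - σ.ym S t

/-- Regressor `ω = (r, ω₁, y, ω₂)`. -/
def reg (σ : Signals n m) (S : LoopData n m) (r : ℝ → ℝ) (t : ℝ) : GainIdx n → ℝ :=
  Sum.elim (fun _ => r t) (Sum.elim (σ.w1 t) (Sum.elim (fun _ => σ.y S t) (σ.w2 t)))

/-- Control input `u = θᵀ ω`. -/
def u (σ : Signals n m) (S : LoopData n m) (r : ℝ → ℝ) (t : ℝ) : ℝ := σ.th t ⬝ᵥ σ.reg S r t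

end Signals

/-- `σ` is a solution on `[0, ∞)` of the closed loop driven by `r`: all states are continuous, and
the differential equations hold at every time at which `r` is continuous. -/
structure IsLoopSolution {n m : ℕ} (S : LoopData n m) (r : ℝ → ℝ) (σ : Signals n m) : Prop where
  cont_xp : ContinuousOn σ.xp (Ici 0)
  cont_w1 : ContinuousOn σ.w1 (Ici 0)
  cont_w2 : ContinuousOn σ.w2 (Ici 0)
  cont_th : ContinuousOn σ.th (Ici 0)
  cont_xm : ContinuousOn σ.xm (Ici 0)
  plant : ∀ t, 0 < t → ContinuousAt r t →
    HasDerivAt σ.xp (S.Ap *ᵥ σ.xp t + σ.u S r t • S.bp) t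
  filter1 : ∀ t, 0 < t → ContinuousAt r t →
    HasDerivAt σ.w1 (S.Lam *ᵥ σ.w1 t + σ.u S r t • S.blam) t
  filter2 : ∀ t, 0 < t → ContinuousAt r t →
    HasDerivAt σ.w2 (S.Lam *ᵥ σ.w2 t + σ.y S t • S.blam) t
  adapt : ∀ t, 0 < t → ContinuousAt r t →
    HasDerivAt σ.th (-(S.gam * Real.sign S.kp * σ.ey S t) • σ.reg S r t) t
  refModel : ∀ t, 0 < t → ContinuousAt r t →
    HasDerivAt σ.xm (S.Am *ᵥ σ.xm t + (S.km * r t) • S.bm + σ.ey S t • S.ell) t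

end

/-! Write `λ = det(sI - Λ) = κ Z_m` and `D = κ (P_m + k_ℓ Z_ℓ)`, so that `W_e' = λ / D`. For the
gain `θ*` that matches the plant to the reference model, `e_y = (λ / D)(k_p (θ - θ*)ᵀ ω + ε)`, where
`ε` is a decaying transient of the filters; the feedback `ℓ` changes `D` but not `θ*`. This is
derived in the time domain. A Bezout matrix `T` with `T A - Λ T = b cᵀ Q(A) - Q(Λ) b cᵀ` carries
plant and model states into filter coordinates, where each input-output relation holds up to a free
motion of `Λ` (`HasDerivOff.bezout`, `IsAdmissibleLoop.exists_error_model`).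

Strict positive realness gives `Re (D / λ) ≥ δ > 0` on the imaginary axis
(`IsSPR.exists_re_mul_conj_ge`). Spectral factorization turns this into a positive semidefinite
storage form `wᵀ K w` of the filtered error (`IsFlatOutput.exists_storage`). The sum of `e_y² / 2`,
`wᵀ K w`, a multiple of `|θ - θ*|²` and a decaying exponential that pays for `ε` then has derivative
at most `-(δ / 2) e_y²` (`IsAdmissibleLoop.exists_lyapunov`). This bounds `e_y` and `θ`, but no
other signal directly.

The remaining bounds must not be circular, because `u` contains the filter states. The model state
is bounded by stability of `P_m`, hence `y` is bounded, and so is `ω₂`. The vectors `x_p - (c_pᵀ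
x_p) b_p` and `ω₁ - (c_pᵀ x_p) b_λ` obey stable equations free of `u`; for the first this is the
minimum phase property. Only afterwards are `ω` and `u` bounded
(`IsAdmissibleLoop.exists_bound_of_error_bound`).

The bounds do not depend on the length of the time interval. A solution of the equation with clipped
state therefore never reaches the clipping level, which gives global existence. Finally `e_y` and
its derivative are bounded and `e_y²` is dominated by the decrease of a nonnegative function, so
`e_y → 0` (`tendsto_zero_of_dissipation`). -/

/-! ### Calculus for functions differentiable off an exceptional set. -/

/-- `f` is continuous on `[0, T]` with derivative `f'` on `(0, T)` off the set `s`. -/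
structure HasDerivOff {E : Type*} [NormedAddCommGroup E] [NormedSpace ℝ E] (s : Set ℝ) (T : ℝ)
    (f f' : ℝ → E) : Prop where
  cont : ContinuousOn f (Icc 0 T)
  deriv : ∀ t ∈ Ioo 0 T, t ∉ s → HasDerivAt f (f' t) t

namespace HasDerivOff

variable {E F : Type*} [NormedAddCommGroup E] [NormedSpace ℝ E] [NormedAddCommGroup F]
  [NormedSpace ℝ F] {s : Set ℝ} {T : ℝ} {f f' g g' : ℝ → E}

theorem congr (h : HasDerivOff s T f f') (hg : ∀ t ∈ Ioo 0 T, t ∉ s → f' t = g' t) :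
    HasDerivOff s T f g' :=
  ⟨h.cont, fun t ht hs => hg t ht hs ▸ h.deriv t ht hs⟩

theorem add (hf : HasDerivOff s T f f') (hg : HasDerivOff s T g g') :
    HasDerivOff s T (fun t => f t + g t) (fun t => f' t + g' t) :=
  ⟨hf.cont.add hg.cont, fun t ht hs => (hf.deriv t ht hs).add (hg.deriv t ht hs)⟩

theorem sub (hf : HasDerivOff s T f f') (hg : HasDerivOff s T g g') :
    HasDerivOff s T (fun t => f t - g t) (fun t => f' t - g' t) :=
  ⟨hf.cont.sub hg.cont, fun t ht hs => (hf.deriv t ht hs).sub (hg.deriv t ht hs)⟩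

theorem clm (hf : HasDerivOff s T f f') (L : E →L[ℝ] F) :
    HasDerivOff s T (fun t => L (f t)) (fun t => L (f' t)) :=
  ⟨L.continuous.comp_continuousOn hf.cont,
    fun t ht hs => L.hasFDerivAt.comp_hasDerivAt t (hf.deriv t ht hs)⟩

theorem lin [FiniteDimensional ℝ E] (hf : HasDerivOff s T f f') (L : E →ₗ[ℝ] F) :
    HasDerivOff s T (fun t => L (f t)) (fun t => L (f' t)) :=
  hf.clm (LinearMap.toContinuousLinearMap L)

theorem mulVec {d e : ℕ} {x x' : ℝ → Fin d → ℝ} (hx : HasDerivOff s T x x')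
    (A : Matrix (Fin e) (Fin d) ℝ) :
    HasDerivOff s T (fun t => A *ᵥ x t) (fun t => A *ᵥ x' t) :=
  hx.lin (Matrix.mulVecLin A)

theorem dotProduct {ι : Type*} [Fintype ι] {x x' y y' : ℝ → ι → ℝ} (hx : HasDerivOff s T x x')
    (hy : HasDerivOff s T y y') :
    HasDerivOff s T (fun t => x t ⬝ᵥ y t) (fun t => x' t ⬝ᵥ y t + x t ⬝ᵥ y' t) := by
  constructor
  · have h1 := continuousOn_pi.1 hx.cont
    have h2 := continuousOn_pi.1 hy.cont
    exact continuousOn_finsetSum _ fun i _ => (h1 i).mul (h2 i)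
  · intro t ht hs
    have h1 := hasDerivAt_pi.1 (hx.deriv t ht hs)
    have h2 := hasDerivAt_pi.1 (hy.deriv t ht hs)
    have := HasDerivAt.fun_sum (u := Finset.univ) fun i _ => (h1 i).mul (h2 i)
    simpa [_root_.dotProduct, Finset.sum_add_distrib] using this

theorem const_dotProduct {ι : Type*} [Fintype ι] {x x' : ℝ → ι → ℝ} (hx : HasDerivOff s T x x')
    (c : ι → ℝ) : HasDerivOff s T (fun t => c ⬝ᵥ x t) (fun t => c ⬝ᵥ x' t) := by
  have hc : HasDerivOff s T (fun _ => c) (fun _ => 0) :=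
    ⟨continuousOn_const, fun t _ _ => hasDerivAt_const t c⟩
  exact (hc.dotProduct hx).congr fun t _ _ => by simp

theorem mul {f f' g g' : ℝ → ℝ} (hf : HasDerivOff s T f f') (hg : HasDerivOff s T g g') :
    HasDerivOff s T (fun t => f t * g t) (fun t => f' t * g t + f t * g' t) :=
  ⟨hf.cont.mul hg.cont, fun t ht hs => (hf.deriv t ht hs).mul (hg.deriv t ht hs)⟩

theorem const_mul {f f' : ℝ → ℝ} (hf : HasDerivOff s T f f') (c : ℝ) :
    HasDerivOff s T (fun t => c * f t) (fun t => c * f' t) :=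
  ⟨hf.cont.const_smul c, fun t ht hs => (hf.deriv t ht hs).const_mul c⟩

theorem smul_const {f f' : ℝ → ℝ} (hf : HasDerivOff s T f f') (v : E) :
    HasDerivOff s T (fun t => f t • v) (fun t => f' t • v) :=
  ⟨hf.cont.smul continuousOn_const, fun t ht hs => (hf.deriv t ht hs).smul_const v⟩

theorem of_hasDerivAt (h : ∀ t, HasDerivAt f (f' t) t) : HasDerivOff s T f f' :=
  ⟨fun t _ => (h t).continuousAt.continuousWithinAt, fun t _ _ => h t⟩

end HasDerivOff

/-- Induction on the exceptional set: an exceptional point splits the interval into two on which it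
no longer matters, and continuity joins them. -/
theorem le_of_hasDerivAt_nonpos_off_finite {s : Set ℝ} (hs : s.Finite) {f f' : ℝ → ℝ} :
    ∀ {a b : ℝ}, a ≤ b → ContinuousOn f (Icc a b) →
      (∀ t ∈ Ioo a b, t ∉ s → HasDerivAt f (f' t) t) → (∀ t ∈ Ioo a b, t ∉ s → f' t ≤ 0) →
      f b ≤ f a := by
  induction s, hs using Set.Finite.induction_on with
  | empty =>
    intro a b hab hc hd hn
    have : AntitoneOn f (Icc a b) := by
      refine antitoneOn_of_deriv_nonpos (convex_Icc a b) hc ?_ ?_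
      · intro t ht
        rw [interior_Icc] at ht
        exact (hd t ht (by simp)).differentiableAt.differentiableWithinAt
      · intro t ht
        rw [interior_Icc] at ht
        rw [(hd t ht (by simp)).deriv]
        exact hn t ht (by simp)
    exact this (left_mem_Icc.2 hab) (right_mem_Icc.2 hab) hab
  | @insert c s hcs hs ih =>
    intro a b hab hc hd hn
    by_cases hcab : c ∈ Ioo a b
    · have h1 : f c ≤ f a := by
        refine ih hcab.1.le (hc.mono (Icc_subset_Icc_right hcab.2.le)) ?_ ?_
        · intro t ht hts
          exact hd t ⟨ht.1, ht.2.trans hcab.2⟩ (by simp [hts, ht.2.ne])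
        · intro t ht hts
          exact hn t ⟨ht.1, ht.2.trans hcab.2⟩ (by simp [hts, ht.2.ne])
      have h2 : f b ≤ f c := by
        refine ih hcab.2.le (hc.mono (Icc_subset_Icc_left hcab.1.le)) ?_ ?_
        · intro t ht hts
          exact hd t ⟨hcab.1.trans ht.1, ht.2⟩ (by simp [hts, ht.1.ne'])
        · intro t ht hts
          exact hn t ⟨hcab.1.trans ht.1, ht.2⟩ (by simp [hts, ht.1.ne'])
      exact h2.trans h1
    · have hne : ∀ t ∈ Ioo a b, t ∉ s → t ∉ insert c s := by
        intro t ht hts h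
        rcases h with rfl | h
        · exact hcab ht
        · exact hts h
      exact ih hab hc (fun t ht hts => hd t ht (hne t ht hts))
        (fun t ht hts => hn t ht (hne t ht hts))

theorem HasDerivOff.antitoneOn {s : Set ℝ} (hs : s.Finite) {T : ℝ} {f f' : ℝ → ℝ}
    (h : HasDerivOff s T f f') (hn : ∀ t ∈ Ioo 0 T, t ∉ s → f' t ≤ 0) :
    AntitoneOn f (Icc 0 T) := by
  intro a ha b hb hab
  refine le_of_hasDerivAt_nonpos_off_finite (f' := f') hs hab (h.cont.mono (Icc_subset_Icc ha.1 hb.2)) ?_ ?_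
  · exact fun t ht => h.deriv t ⟨ha.1.trans_lt ht.1, ht.2.trans_le hb.2⟩
  · exact fun t ht => hn t ⟨ha.1.trans_lt ht.1, ht.2.trans_le hb.2⟩

/-- The function `exp (a t) (p t - k / a)` is nonincreasing. -/
theorem HasDerivOff.le_of_le_neg_mul_add {s : Set ℝ} (hs : s.Finite) {T : ℝ} {p p' : ℝ → ℝ}
    {a k : ℝ} (ha : 0 < a) (hk : 0 ≤ k) (h : HasDerivOff s T p p')
    (hp : ∀ t ∈ Ioo 0 T, t ∉ s → p' t ≤ -a * p t + k) (hp0 : 0 ≤ p 0) {t : ℝ} (ht : t ∈ Icc 0 T) :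
    p t ≤ p 0 + k / a := by
  have he : HasDerivOff s T (fun t => Real.exp (a * t)) (fun t => Real.exp (a * t) * a) :=
    HasDerivOff.of_hasDerivAt fun t => by
      simpa using ((hasDerivAt_id t).const_mul a).exp
  have hq : HasDerivOff s T (fun t => p t - k / a) p' :=
    ⟨h.cont.sub continuousOn_const, fun t ht hs => (h.deriv t ht hs).sub_const _⟩
  have hanti := (he.mul hq).antitoneOn hs (by
    intro t ht hts
    have h1 := hp t ht hts
    have h2 : Real.exp (a * t) * a * (p t - k / a) + Real.exp (a * t) * p' t
        = Real.exp (a * t) * (p' t + a * p t - k) := by field_simp; ring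
    rw [h2]
    exact mul_nonpos_of_nonneg_of_nonpos (Real.exp_pos _).le (by linarith))
  have h3 := hanti (left_mem_Icc.2 (ht.1.trans ht.2)) ht ht.1
  simp only [mul_zero, Real.exp_zero, one_mul] at h3
  have hka : 0 ≤ k / a := div_nonneg hk ha.le
  have h4 : 1 ≤ Real.exp (a * t) := Real.one_le_exp (mul_nonneg ha.le ht.1)
  by_contra hcon
  push Not at hcon
  nlinarith

/-! ### Linear systems with a Hurwitz matrix. -/

theorem exists_norm_mulVec_le {𝕜 : Type*} [RCLike 𝕜] {d e : ℕ} (A : Matrix (Fin e) (Fin d) 𝕜) :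
    ∃ c : ℝ, 0 ≤ c ∧ ∀ v, ‖A *ᵥ v‖ ≤ c * ‖v‖ :=
  ⟨‖LinearMap.toContinuousLinearMap (Matrix.mulVecLin A)‖, norm_nonneg _,
    (LinearMap.toContinuousLinearMap (Matrix.mulVecLin A)).le_opNorm⟩

theorem exists_norm_dotProduct_le {ι : Type*} [Fintype ι] (c : ι → ℝ) :
    ∃ k : ℝ, 0 ≤ k ∧ ∀ v : ι → ℝ, |c ⬝ᵥ v| ≤ k * ‖v‖ := by
  refine ⟨∑ i, |c i|, Finset.sum_nonneg fun i _ => abs_nonneg _, fun v => ?_⟩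
  rw [dotProduct, Finset.sum_mul]
  refine (Finset.abs_sum_le_sum_abs _ _).trans (Finset.sum_le_sum fun i _ => ?_)
  rw [abs_mul]
  exact mul_le_mul_of_nonneg_left (norm_le_pi_norm v i) (abs_nonneg _)

/-- The comparison lemma is applied to `‖x‖²`, with the forcing term absorbed by Young's inequality.
-/
theorem norm_le_of_hasDerivOff_scalar {s : Set ℝ} (hs : s.Finite) {T : ℝ} {x g : ℝ → ℂ} {z : ℂ}
    (hz : z.re < 0) {G : ℝ} (hG : 0 ≤ G) (h : HasDerivOff s T x (fun t => z * x t + g t))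
    (hg : ∀ t ∈ Ioo 0 T, t ∉ s → ‖g t‖ ≤ G) {t : ℝ} (ht : t ∈ Icc 0 T) :
    ‖x t‖ ≤ ‖x 0‖ + G / (-z.re) := by
  have ha : 0 < -z.re := by linarith
  have hsq : HasDerivOff s T (fun t => ‖x t‖ ^ 2)
      (fun t => 2 * inner ℝ (x t) (z * x t + g t)) :=
    ⟨h.cont.norm.pow 2, fun t ht hts => (h.deriv t ht hts).norm_sq⟩
  have hle := hsq.le_of_le_neg_mul_add hs (a := -z.re) (k := G ^ 2 / (-z.re)) ha (by positivity)
    (by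
      intro t ht hts
      have h1 : inner ℝ (x t) (z * x t) = z.re * ‖x t‖ ^ 2 := by
        rw [Complex.inner, ← Complex.normSq_eq_norm_sq, Complex.normSq_apply]
        simp
        ring
      have h2 : inner ℝ (x t) (g t) ≤ ‖x t‖ * G :=
        (real_inner_le_norm _ _).trans (mul_le_mul_of_nonneg_left (hg t ht hts) (norm_nonneg _))
      rw [inner_add_right, h1]
      have h3 : 2 * (‖x t‖ * G) ≤ -z.re * ‖x t‖ ^ 2 + G ^ 2 / (-z.re) := by
        have : -z.re * ‖x t‖ ^ 2 + G ^ 2 / (-z.re) - 2 * (‖x t‖ * G)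
            = (-z.re * ‖x t‖ - G) ^ 2 / (-z.re) := by
          generalize -z.re = a at ha
          field_simp
          ring
        have h5 : 0 ≤ (-z.re * ‖x t‖ - G) ^ 2 / (-z.re) := by positivity
        linarith
      nlinarith) (by positivity) ht
  have h0 : 0 ≤ G / (-z.re) := by positivity
  refine abs_le_of_sq_le_sq' ?_ (by positivity) |>.2
  have : G ^ 2 / (-z.re) / (-z.re) = (G / (-z.re)) ^ 2 := by field_simp
  rw [this] at hle
  nlinarith [norm_nonneg (x 0)]

/-- Peeling off one root `z` replaces a Jordan form. The vector `(A - z) x` solves the same equation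
with forcing `(A - z) g` and one factor fewer, so it is bounded by induction. Then each coordinate
of `x` solves a scalar equation with rate `z` and bounded forcing. `K` is chosen before `T`, `x` and
`g`. -/
theorem exists_bound_of_factors {d : ℕ} (A : Matrix (Fin d) (Fin d) ℂ) (l : List ℂ)
    (hl : ∀ z ∈ l, z.re < 0) :
    ∃ K : ℝ, 0 ≤ K ∧ ∀ (s : Set ℝ) (T : ℝ) (x g : ℝ → Fin d → ℂ) (G Y : ℝ), s.Finite → 0 ≤ G →
      0 ≤ Y → HasDerivOff s T x (fun t => A *ᵥ x t + g t) →
      (∀ t ∈ Ioo 0 T, t ∉ s → ‖g t‖ ≤ G) →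
      (∀ t ∈ Icc 0 T, ‖aeval A (l.map fun z => X - C z).prod *ᵥ x t‖ ≤ Y) →
      ∀ t ∈ Icc 0 T, ‖x t‖ ≤ K * (‖x 0‖ + G + Y) := by
  induction l with
  | nil =>
    refine ⟨1, zero_le_one, fun s T x g G Y _ hG hY _ _ h t ht => ?_⟩
    have := h t ht
    simp only [List.map_nil, List.prod_nil, map_one, one_mulVec] at this
    linarith [norm_nonneg (x 0)]
  | cons z l ih =>
    obtain ⟨K, hK, ih⟩ := ih fun w hw => hl w (List.mem_cons_of_mem _ hw)
    have hz : z.re < 0 := hl z List.mem_cons_self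
    obtain ⟨c, hc, hcA⟩ := exists_norm_mulVec_le (aeval A (X - C z))
    have hnz : 0 < -z.re := by linarith
    refine ⟨1 + (K * (c + 1) + 1) / (-z.re), by positivity, ?_⟩
    intro s T x g G Y hs hG hY hx hg hY' t ht
    have hAz : ∀ v, A *ᵥ v = z • v + aeval A (X - C z) *ᵥ v := by
      intro v
      simp [sub_mulVec, Algebra.algebraMap_eq_smul_one, smul_mulVec]
    set B := aeval A (X - C z) with hB
    have hcomm : A * B = B * A := by
      rw [hB]; simp [mul_sub, sub_mul, Algebra.commutes]
    have hw : HasDerivOff s T (fun t => B *ᵥ x t) (fun t => A *ᵥ (B *ᵥ x t) + B *ᵥ g t) := by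
      have := hx.lin ((Matrix.mulVecLin B).restrictScalars ℝ)
      refine HasDerivOff.congr this fun t _ _ => ?_
      simp [mulVec_add, mulVec_mulVec, hcomm]
    have h1 := ih s T (fun t => B *ᵥ x t) (fun t => B *ᵥ g t) (c * G) Y hs (by positivity) hY hw
      (fun t ht hts => (hcA _).trans (mul_le_mul_of_nonneg_left (hg t ht hts) hc))
      (fun t ht => by
        have := hY' t ht
        rw [List.map_cons, List.prod_cons, mul_comm, map_mul, ← mulVec_mulVec] at this
        exact this)
    have h2 : ∀ t ∈ Icc 0 T, ‖B *ᵥ x t‖ ≤ K * (c + 1) * (‖x 0‖ + G + Y) := by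
      intro t ht
      refine (h1 t ht).trans ?_
      have h3 := hcA (x 0)
      have h4 : ‖B *ᵥ x 0‖ + c * G + Y ≤ (c + 1) * (‖x 0‖ + G + Y) := by
        nlinarith [norm_nonneg (x 0), mul_nonneg hc hY]
      calc _ ≤ K * ((c + 1) * (‖x 0‖ + G + Y)) := mul_le_mul_of_nonneg_left h4 hK
        _ = _ := by ring
    have hS : 0 ≤ ‖x 0‖ + G + Y := by positivity
    rw [pi_norm_le_iff_of_nonneg (by positivity)]
    intro i
    have hxi : HasDerivOff s T (fun t => x t i)
        (fun t => z * x t i + ((B *ᵥ x t) i + g t i)) := by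
      have := hx.clm (ContinuousLinearMap.proj (R := ℝ) i)
      refine HasDerivOff.congr this fun t _ _ => ?_
      simp [hAz (x t), add_assoc]
    have h5 := norm_le_of_hasDerivOff_scalar hs hz
      (G := (K * (c + 1) + 1) * (‖x 0‖ + G + Y)) (by positivity) hxi (by
        intro t ht hts
        refine (norm_add_le _ _).trans ?_
        have h6 := (norm_le_pi_norm (B *ᵥ x t) i).trans (h2 t (Ioo_subset_Icc_self ht))
        have h7 := (norm_le_pi_norm (g t) i).trans (hg t ht hts)
        nlinarith [norm_nonneg (x 0)]) ht
    have h8 := norm_le_pi_norm (x 0) i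
    refine h5.trans ?_
    have h9 : (K * (c + 1) + 1) * (‖x 0‖ + G + Y) / (-z.re)
      = (K * (c + 1) + 1) / (-z.re) * (‖x 0‖ + G + Y) := by ring
    rw [h9]
    linarith

/-- Bounded-input bounded-state stability of `x' = A x + g` when a polynomial with all roots in the
open left half plane annihilates `A`. -/
theorem exists_bound_of_isHurwitzPoly {d : ℕ} (A : Matrix (Fin d) (Fin d) ℝ) {p : ℝ[X]}
    (hp : p.Monic) (hH : IsHurwitzPoly p) (hpA : aeval A p = 0) :
    ∃ K : ℝ, 0 ≤ K ∧ ∀ (s : Set ℝ) (T : ℝ) (x g : ℝ → Fin d → ℝ) (G : ℝ), s.Finite → 0 ≤ G →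
      HasDerivOff s T x (fun t => A *ᵥ x t + g t) →
      (∀ t ∈ Ioo 0 T, t ∉ s → ‖g t‖ ≤ G) →
      ∀ t ∈ Icc 0 T, ‖x t‖ ≤ K * (‖x 0‖ + G) := by
  let pc := p.map (algebraMap ℝ ℂ)
  have hroots : ∀ z ∈ pc.roots.toList, z.re < 0 := by
    intro z hz
    refine hH z ?_
    have := isRoot_of_mem_roots (Multiset.mem_toList.1 hz)
    rwa [IsRoot, eval_map_algebraMap] at this
  obtain ⟨K, hK, h⟩ := exists_bound_of_factors (A.map (algebraMap ℝ ℂ)) pc.roots.toList hroots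
  refine ⟨K, hK, fun s T x g G hs hG hx hg t ht => ?_⟩
  have hprod : (pc.roots.toList.map fun z => X - C z).prod = pc := by
    have h1 := (IsAlgClosed.splits pc).eq_prod_roots_of_monic (hp.map _)
    conv_rhs => rw [h1]
    rw [← Multiset.prod_coe, ← Multiset.map_coe, Multiset.coe_toList]
  have hzero : aeval (A.map (algebraMap ℝ ℂ)) pc = 0 := by
    have h1 : aeval (A.map (algebraMap ℝ ℂ)) pc
        = (Algebra.ofId ℝ ℂ).mapMatrix (aeval A p) := by
      rw [← Polynomial.aeval_algHom_apply]
      simp [pc, Polynomial.aeval_map_algebraMap]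
      rfl
    rw [h1, hpA, map_zero]
  let J : (Fin d → ℝ) →L[ℝ] (Fin d → ℂ) :=
    ContinuousLinearMap.pi fun i => Complex.ofRealCLM.comp (ContinuousLinearMap.proj i)
  have hJ : ∀ v, ‖J v‖ = ‖v‖ := by
    intro v
    simp [J, Pi.norm_def]
  have := h s T (fun t => J (x t)) (fun t => J (g t)) G 0 hs hG le_rfl
    ((hx.clm J).congr fun t _ _ => by
      ext i
      simp [J, Matrix.mulVec, dotProduct])
    (fun t ht hts => by rw [hJ]; exact hg t ht hts)
    (fun t _ => by rw [hprod, hzero]; simp) t ht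
  simpa [hJ] using this

theorem IsHurwitzPoly.exists_margin {p : ℝ[X]} (hp : p.Monic) (hH : IsHurwitzPoly p) :
    ∃ α : ℝ, 0 < α ∧ ∀ z : ℂ, aeval z p = 0 → z.re < -α := by
  classical
  have hfin : ((p.map (algebraMap ℝ ℂ)).roots.toFinset.image Complex.re : Set ℝ).Finite :=
    Finset.finite_toSet _
  have hmem : ∀ z : ℂ, aeval z p = 0 →
      z.re ∈ (p.map (algebraMap ℝ ℂ)).roots.toFinset.image Complex.re := by
    intro z hz
    refine Finset.mem_image_of_mem _ ?_
    rw [Multiset.mem_toFinset, mem_roots (hp.map _).ne_zero, IsRoot, eval_map_algebraMap, hz]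
  have hneg : ∀ x ∈ (p.map (algebraMap ℝ ℂ)).roots.toFinset.image Complex.re, x < 0 := by
    intro x hx
    obtain ⟨z, hz, rfl⟩ := Finset.mem_image.1 hx
    refine hH z ?_
    have := isRoot_of_mem_roots (Multiset.mem_toFinset.1 hz)
    rwa [IsRoot, eval_map_algebraMap] at this
  by_cases hne : ((p.map (algebraMap ℝ ℂ)).roots.toFinset.image Complex.re).Nonempty
  · have hM := hneg _ (Finset.max'_mem _ hne)
    refine ⟨-(Finset.max' _ hne) / 2, by linarith, fun z hz => ?_⟩
    have := Finset.le_max' _ _ (hmem z hz)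
    linarith
  · rw [Finset.not_nonempty_iff_eq_empty] at hne
    exact ⟨1, one_pos, fun z hz => by have := hmem z hz; rw [hne] at this; simp at this⟩

/-- All roots lie left of some `-α`, so `A + α` is still Hurwitz and `exp (α t) x`, which it
governs, stays bounded. -/
theorem exists_exp_decay_of_isHurwitzPoly {d : ℕ} (A : Matrix (Fin d) (Fin d) ℝ) {p : ℝ[X]}
    (hp : p.Monic) (hH : IsHurwitzPoly p) (hpA : aeval A p = 0) :
    ∃ K α : ℝ, 0 ≤ K ∧ 0 < α ∧ ∀ (s : Set ℝ) (T : ℝ) (x : ℝ → Fin d → ℝ), s.Finite →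
      HasDerivOff s T x (fun t => A *ᵥ x t) →
      ∀ t ∈ Icc 0 T, ‖x t‖ ≤ K * Real.exp (-α * t) * ‖x 0‖ := by
  obtain ⟨α, hα, hroot⟩ := hH.exists_margin hp
  obtain ⟨K, hK, h⟩ := exists_bound_of_isHurwitzPoly (A + algebraMap ℝ _ α)
    (p := p.comp (X - C α)) (hp.comp_X_sub_C α)
    (by
      intro z hz
      rw [aeval_comp] at hz
      have := hroot _ hz
      simp at this
      linarith)
    (by rw [aeval_comp]; simpa using hpA)
  refine ⟨K, α, hK, hα, fun s T x hs hx t ht => ?_⟩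
  have he : HasDerivOff s T (fun t => Real.exp (α * t) • x t)
      (fun t => (A + algebraMap ℝ _ α) *ᵥ (Real.exp (α * t) • x t) + 0) := by
    refine ⟨(by fun_prop : Continuous fun t : ℝ => Real.exp (α * t)).continuousOn.smul hx.cont,
      fun t ht hts => ?_⟩
    have h1 : HasDerivAt (fun t => Real.exp (α * t)) (Real.exp (α * t) * α) t := by
      simpa using ((hasDerivAt_id t).const_mul α).exp
    have h2 := h1.smul (hx.deriv t ht hts)
    refine h2.congr_deriv ?_
    simp [add_mulVec, Algebra.algebraMap_eq_smul_one, smul_mulVec, mulVec_smul, smul_smul]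
  have h3 := h s T _ (fun _ => 0) 0 hs le_rfl he (by simp) t ht
  simp only [norm_smul, Real.norm_eq_abs, Real.abs_exp, mul_zero, Real.exp_zero, abs_one, one_mul,
    add_zero] at h3
  have h4 : Real.exp (-α * t) * Real.exp (α * t) = 1 := by rw [← Real.exp_add]; simp
  calc ‖x t‖ = Real.exp (-α * t) * (Real.exp (α * t) * ‖x t‖) := by rw [← mul_assoc, h4, one_mul]
    _ ≤ Real.exp (-α * t) * (K * ‖x 0‖) := mul_le_mul_of_nonneg_left h3 (Real.exp_pos _).le
    _ = _ := by ring

/-- Variation of constants. -/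
theorem exists_hasDerivAt_linear {d : ℕ} (A : Matrix (Fin d) (Fin d) ℝ) (b x₀ : Fin d → ℝ)
    {f : ℝ → ℝ} (hf : Continuous f) :
    ∃ x : ℝ → Fin d → ℝ, x 0 = x₀ ∧ ∀ t, HasDerivAt x (A *ᵥ x t + f t • b) t := by
  let L : (Fin d → ℝ) →L[ℝ] (Fin d → ℝ) := LinearMap.toContinuousLinearMap (Matrix.mulVecLin A)
  have hL : ∀ v, L v = A *ᵥ v := fun v => rfl
  have hexp : ∀ t : ℝ, HasDerivAt (fun t : ℝ => NormedSpace.exp (t • L))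
      (L * NormedSpace.exp (t • L)) t := fun t => hasDerivAt_exp_smul_const' L t
  have hinv : ∀ t : ℝ, NormedSpace.exp (t • L) * NormedSpace.exp ((-t) • L) = 1 := by
    intro t
    have hcomm : Commute (t • L) ((-t) • L) := ((Commute.refl L).smul_left t).smul_right (-t)
    let +nondep : NormedAlgebra ℚ ((Fin d → ℝ) →L[ℝ] (Fin d → ℝ)) := .restrictScalars ℚ ℝ _
    rw [← NormedSpace.exp_add_of_commute hcomm, ← add_smul]
    simp
  have hcont : Continuous fun s : ℝ => f s • (NormedSpace.exp ((-s) • L)) b := by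
    have h1 : Continuous fun s : ℝ => NormedSpace.exp (s • L) :=
      continuous_iff_continuousAt.2 fun t => (hexp t).continuousAt
    exact hf.smul ((h1.comp continuous_neg).clm_apply continuous_const)
  refine ⟨fun t => NormedSpace.exp (t • L) (x₀ + ∫ s in (0 : ℝ)..t,
    f s • (NormedSpace.exp ((-s) • L)) b), by simp, fun t => ?_⟩
  have h2 : HasDerivAt (fun t : ℝ => x₀ + ∫ s in (0 : ℝ)..t, f s • (NormedSpace.exp ((-s) • L)) b)
      (f t • (NormedSpace.exp ((-t) • L)) b) t :=
    (intervalIntegral.integral_hasDerivAt_right (hcont.intervalIntegrable _ _)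
      (hcont.stronglyMeasurableAtFilter _ _) hcont.continuousAt).const_add _
  refine ((hexp t).clm_apply h2).congr_deriv ?_
  have h3 : NormedSpace.exp (t • L) (NormedSpace.exp ((-t) • L) b) = b := by
    have := congrArg (fun M : (Fin d → ℝ) →L[ℝ] (Fin d → ℝ) => M b) (hinv t)
    simpa using this
  rw [map_smul, h3]
  rfl

/-! ### Strict positive realness on the imaginary axis. -/

theorem tendsto_aeval_div_pow_cobounded {p : ℝ[X]} {k : ℕ} (hp : p.natDegree ≤ k) :
    Tendsto (fun z : ℂ => aeval z p / z ^ k) (Bornology.cobounded ℂ) (𝓝 (p.coeff k : ℂ)) := by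
  have h1 : Tendsto (fun z : ℂ => ∑ i ∈ Finset.range (k + 1), (p.coeff i : ℂ) * z⁻¹ ^ (k - i))
      (Bornology.cobounded ℂ)
      (𝓝 (∑ i ∈ Finset.range (k + 1), (p.coeff i : ℂ) * 0 ^ (k - i))) :=
    tendsto_finsetSum _ fun i _ => (tendsto_inv₀_cobounded.pow _).const_mul _
  have h2 : ∑ i ∈ Finset.range (k + 1), (p.coeff i : ℂ) * 0 ^ (k - i) = (p.coeff k : ℂ) := by
    rw [Finset.sum_range_succ, Finset.sum_eq_zero]
    · simp
    · intro i hi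
      have : k - i ≠ 0 := by have := Finset.mem_range.1 hi; omega
      simp [this]
  rw [h2] at h1
  refine h1.congr' ?_
  filter_upwards [Bornology.eventually_ne_cobounded (0 : ℂ)] with z hz
  rw [aeval_eq_sum_range' (Nat.lt_succ_of_le hp), Finset.sum_div]
  refine Finset.sum_congr rfl fun i hi => ?_
  have hik : i ≤ k := Nat.lt_succ_iff.1 (Finset.mem_range.1 hi)
  have : z ^ k = z ^ i * z ^ (k - i) := by rw [← pow_add]; congr 1; omega
  rw [this]
  simp only [Complex.real_smul, inv_pow]
  field_simp

theorem natDegree_sub_le_of_monic {p r : ℝ[X]} {k : ℕ} (hp : p.Monic) (hr : r.Monic)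
    (hpk : p.natDegree = k + 1) (hrk : r.natDegree = k + 1) : (p - r).natDegree ≤ k := by
  rw [natDegree_le_iff_coeff_eq_zero]
  intro N hN
  rcases Nat.lt_or_ge (k + 1) N with h | h
  · rw [coeff_sub, coeff_eq_zero_of_natDegree_lt (by omega),
      coeff_eq_zero_of_natDegree_lt (by omega), sub_zero]
  · have : N = k + 1 := by omega
    subst this
    rw [coeff_sub, ← hpk, hp.coeff_natDegree, hpk, ← hrk, hr.coeff_natDegree, sub_self]

/-- Strict positive realness of `N / D` with relative degree one bounds the real part of `D / N`
from below by a positive constant on the imaginary axis. -/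
theorem IsSPR.exists_re_mul_conj_ge {N D : ℝ[X]} (hN : N.Monic) (hD : D.Monic)
    (hdeg : D.natDegree = N.natDegree + 1) (hNH : IsHurwitzPoly N) (h : IsSPR N D) :
    ∃ δ : ℝ, 0 < δ ∧ ∀ ω : ℝ, δ * ‖aeval (ω * Complex.I : ℂ) N‖ ^ 2 ≤
      ((starRingEnd ℂ) (aeval (ω * Complex.I : ℂ) N) * aeval (ω * Complex.I : ℂ) D).re := by
  obtain ⟨ε, hε, hpos⟩ := h
  obtain ⟨α, hα, hroot⟩ := hNH.exists_margin hN
  -- The shift stays below `ε`, so that positive realness holds on the shifted axis, and at most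
  -- `α`, so that the shifted numerator has no zero in the closed right half plane.
  set e := min (ε / 2) α with he
  have he0 : 0 < e := lt_min (by linarith) hα
  have heε : e < ε := (min_le_left _ _).trans_lt (by linarith)
  have heα : e ≤ α := min_le_right _ _
  set N₁ := N.comp (X - C e) with hN₁
  set D₁ := D.comp (X - C e) with hD₁
  have hN₁m : N₁.Monic := hN.comp_X_sub_C e
  have hD₁m : D₁.Monic := hD.comp_X_sub_C e
  have hN₁d : N₁.natDegree = N.natDegree := by simp [hN₁, natDegree_comp]
  have hD₁d : D₁.natDegree = N.natDegree + 1 := by simp [hD₁, natDegree_comp, hdeg]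
  have hevN : ∀ z : ℂ, aeval z N₁ = aeval (z - e) N := fun z => by simp [hN₁, aeval_comp]
  have hevD : ∀ z : ℂ, aeval z D₁ = aeval (z - e) D := fun z => by simp [hD₁, aeval_comp]
  have hne : ∀ z : ℂ, 0 ≤ z.re → aeval z N₁ ≠ 0 := by
    intro z hz h0
    rw [hevN] at h0
    have := hroot _ h0
    simp at this
    linarith
  set R := D₁ - X * N₁ with hR
  have hRd : R.natDegree ≤ N.natDegree :=
    natDegree_sub_le_of_monic hD₁m (monic_X.mul hN₁m) hD₁d
      (by rw [monic_X.natDegree_mul hN₁m, hN₁d, natDegree_X, add_comm])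
  have hquot : ∀ z : ℂ, 0 ≤ z.re → aeval z R / aeval z N₁ = aeval z D₁ / aeval z N₁ - z := by
    intro z hz
    have := hne z hz
    simp [hR]
    field_simp
  -- `D₁ / N₁ - z` is bounded at infinity because the relative degree is one. The modulus of `f` is
  -- `exp (-Re (D₁ / N₁ - z))`, at most one on the imaginary axis, where `Re z = 0`. By
  -- Phragmén-Lindelöf it is at most one on the right half plane.
  set f : ℂ → ℂ := fun z => Complex.exp (-(aeval z R / aeval z N₁)) with hf
  have hlim : ∃ w : ℂ, Tendsto f (Bornology.cobounded ℂ) (𝓝 w) := by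
    have h1 := tendsto_aeval_div_pow_cobounded hRd
    have h2 := tendsto_aeval_div_pow_cobounded hN₁d.le
    have h3 : N₁.coeff N.natDegree = 1 := by rw [← hN₁d]; exact hN₁m.coeff_natDegree
    rw [h3] at h2
    have h4 := h1.div h2 (by simp)
    refine ⟨_, (Complex.continuous_exp.tendsto _).comp (h4.neg.congr' ?_)⟩
    filter_upwards [Bornology.eventually_ne_cobounded (0 : ℂ)] with z hz
    have : z ^ N.natDegree ≠ 0 := pow_ne_zero _ hz
    simp only [Pi.div_apply]
    rw [div_div_div_cancel_right₀ this]
  obtain ⟨w, hw⟩ := hlim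
  have hbd : ∀ z : ℂ, 0 ≤ z.re → ‖f z‖ ≤ 1 := by
    intro z hz
    refine PhragmenLindelof.right_half_plane_of_bounded_on_real (f := f) ?_ ?_ ?_ ?_ hz
    · refine DifferentiableOn.diffContOnCl ?_
      rw [Complex.closure_setOfPred_lt_re]
      intro z hz
      have hz' : 0 ≤ z.re := hz
      have h1 : DifferentiableAt ℂ (fun z : ℂ => aeval z R) z := R.differentiableAt_aeval
      have h2 : DifferentiableAt ℂ (fun z : ℂ => aeval z N₁) z := N₁.differentiableAt_aeval
      exact ((h1.div h2 (hne z hz')).neg.cexp).differentiableWithinAt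
    · refine ⟨0, by norm_num, 0, ?_⟩
      simpa using (hw.isBigO_one ℝ).mono inf_le_left
    · have : Tendsto (fun x : ℝ => (x : ℂ)) atTop (Bornology.cobounded ℂ) := by
        rw [← tendsto_norm_atTop_iff_cobounded]
        simpa using tendsto_abs_atTop_atTop
      exact (hw.comp this).norm.isBoundedUnder_le
    · intro x
      have hx : (0 : ℝ) ≤ ((x : ℂ) * Complex.I).re := by simp
      simp only [hf, Complex.norm_exp, Complex.neg_re]
      rw [Real.exp_le_one_iff, hquot _ hx, hevN, hevD]
      have := (hpos ((x : ℂ) * Complex.I - e) (by simp; linarith)).2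
      have hflip : ∀ a b : ℂ, 0 ≤ (a / b).re → 0 ≤ (b / a).re := by
        intro a b hab
        rw [← inv_div, Complex.inv_re]
        exact div_nonneg hab (Complex.normSq_nonneg _)
      have h2 := hflip _ _ this
      simp only [Complex.sub_re, Complex.mul_re, Complex.ofReal_re, Complex.I_re, mul_zero,
        Complex.ofReal_im, Complex.I_im, mul_one, sub_zero]
      linarith
  -- At `z = e + iω` the shift is undone, and `Re (D₁ / N₁ - z) ≥ 0` reads `Re (D / N)(iω) ≥ e`.
  refine ⟨e, he0, fun ω => ?_⟩
  have h1 := hbd (e + ω * Complex.I) (by simp [he0.le])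
  have hre : (0 : ℝ) ≤ ((e : ℂ) + ω * Complex.I).re := by simp [he0.le]
  have h0 := hne _ hre
  simp only [hf, Complex.norm_exp, Complex.neg_re] at h1
  rw [Real.exp_le_one_iff, hquot _ hre] at h1
  rw [hevN] at h0
  rw [hevN, hevD] at h1
  simp only [add_sub_cancel_left] at h0 h1
  set a := aeval (ω * Complex.I : ℂ) N
  set b := aeval (ω * Complex.I : ℂ) D
  have h2 : e ≤ (b / a).re := by simp at h1; linarith
  have h3 : (starRingEnd ℂ) a * b = ((‖a‖ ^ 2 : ℝ) : ℂ) * (b / a) := by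
    rw [← Complex.normSq_eq_norm_sq, ← Complex.mul_conj]
    field_simp
  rw [h3, Complex.re_ofReal_mul, mul_comm]
  exact mul_le_mul_of_nonneg_left h2 (by positivity)

/-! ### Spectral factorization of even polynomials. -/

/-- `G` is a sum of polynomials `h(-X) h(X)` with `deg h ≤ d`. -/
def IsParaSquareSum (d : ℕ) (G : ℝ[X]) : Prop :=
  ∃ l : List ℝ[X], (∀ p ∈ l, p.natDegree ≤ d) ∧ G = (l.map fun p => p.comp (-X) * p).sum

namespace IsParaSquareSum

theorem mono {d e : ℕ} {G : ℝ[X]} (h : IsParaSquareSum d G) (hde : d ≤ e) :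
    IsParaSquareSum e G := by
  obtain ⟨l, hl, rfl⟩ := h
  exact ⟨l, fun p hp => (hl p hp).trans hde, rfl⟩

theorem add {d : ℕ} {G₁ G₂ : ℝ[X]} (h₁ : IsParaSquareSum d G₁) (h₂ : IsParaSquareSum d G₂) :
    IsParaSquareSum d (G₁ + G₂) := by
  obtain ⟨l₁, hl₁, rfl⟩ := h₁
  obtain ⟨l₂, hl₂, rfl⟩ := h₂
  refine ⟨l₁ ++ l₂, fun p hp => ?_, by simp⟩
  rcases List.mem_append.1 hp with h | h
  exacts [hl₁ p h, hl₂ p h]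

theorem mul_paraSquare {d e : ℕ} {G h : ℝ[X]} (hG : IsParaSquareSum d G) (hh : h.natDegree ≤ e) :
    IsParaSquareSum (d + e) (G * (h.comp (-X) * h)) := by
  obtain ⟨l, hl, rfl⟩ := hG
  refine ⟨l.map (· * h), fun p hp => ?_, ?_⟩
  · obtain ⟨p', hp', rfl⟩ := List.mem_map.1 hp
    exact natDegree_mul_le.trans (add_le_add (hl p' hp') hh)
  · rw [← List.sum_map_mul_right, List.map_map]
    congr 1
    refine List.map_congr_left fun p _ => ?_
    simp only [Function.comp, mul_comp]
    ring

end IsParaSquareSum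

/-- The point `a`, where `r` may vanish, is handled by continuity from the right. -/
theorem eval_nonneg_of_mul_nonneg {p r : ℝ[X]} {a x : ℝ} (hr : ∀ y, 0 ≤ y → y ≠ a → 0 < r.eval y)
    (h : ∀ y, 0 ≤ y → 0 ≤ (r * p).eval y) (hx : 0 ≤ x) : 0 ≤ p.eval x := by
  have h1 : ∀ y, 0 ≤ y → y ≠ a → 0 ≤ p.eval y := by
    intro y hy hya
    have := h y hy
    rw [eval_mul] at this
    exact nonneg_of_mul_nonneg_right this (hr y hy hya)
  have h2 : Tendsto (fun y => p.eval y) (𝓝[>] x) (𝓝 (p.eval x)) :=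
    p.continuous.continuousAt.tendsto.mono_left nhdsWithin_le_nhds
  refine ge_of_tendsto h2 ?_
  by_cases hxa : a ≤ x
  · filter_upwards [self_mem_nhdsWithin] with y hy
    have hy : x < y := hy
    exact h1 y (hx.trans hy.le) (hxa.trans_lt hy).ne'
  · push Not at hxa
    filter_upwards [Ioo_mem_nhdsGT hxa] with y hy
    exact h1 y (hx.trans hy.1.le) hy.2.ne

/-- Induction on the degree, splitting off a root of `H`: a real root `a ≤ 0` gives `-X² - a =
(√(-a) - X)(√(-a) + X)`, a positive root is at least double and gives `(X² + a)²`, and a pair of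
complex roots `z, z̄` gives `(X² + Re z)² + (Im z)²`. -/
theorem isParaSquareSum_comp_neg_X_sq (H : ℝ[X]) (hH : ∀ x, 0 ≤ x → 0 ≤ H.eval x) :
    IsParaSquareSum H.natDegree (H.comp (-X ^ 2)) := by
  induction hd : H.natDegree using Nat.strong_induction_on generalizing H with
  | _ d ih =>
  subst hd
  by_cases hconst : H.natDegree = 0
  · obtain ⟨c, rfl⟩ := natDegree_eq_zero.1 hconst
    have hc : 0 ≤ c := by simpa using hH 0 le_rfl
    refine ⟨[C (√c)], by simp, ?_⟩
    simp [← C_mul, Real.mul_self_sqrt hc]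
  have hne : H ≠ 0 := by rintro rfl; simp at hconst
  obtain ⟨z, hz⟩ : ∃ z : ℂ, aeval z H = 0 := by
    have := IsAlgClosed.exists_aeval_eq_zero ℂ H (by
      rw [degree_eq_natDegree hne]
      exact_mod_cast hconst)
    exact this
  -- The cofactor of a monic factor that is positive on `[0, ∞)` off one point inherits the
  -- nonnegativity, and the induction hypothesis applies to it.
  have key : ∀ r p : ℝ[X], ∀ a : ℝ, r.Monic → 0 < r.natDegree → H = r * p →
      (∀ y, 0 ≤ y → y ≠ a → 0 < r.eval y) →
      IsParaSquareSum p.natDegree (p.comp (-X ^ 2)) ∧ H.natDegree = p.natDegree + r.natDegree := by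
    intro r p a hr hr0 hrp hpos
    have hp0 : p ≠ 0 := by rintro rfl; simp [hrp] at hne
    have hdeg : H.natDegree = p.natDegree + r.natDegree := by
      rw [hrp, hr.natDegree_mul' hp0, add_comm]
    exact ⟨ih _ (by omega) p
      (fun x hx => eval_nonneg_of_mul_nonneg hpos (by rw [← hrp]; exact hH) hx) rfl, hdeg⟩
  by_cases him : z.im = 0
  · have hzr : (z.re : ℂ) = z := Complex.ext rfl (by simp [him])
    have hroot : H.IsRoot z.re := by
      rw [← hzr] at hz
      have : ((H.eval z.re : ℝ) : ℂ) = 0 := by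
        rw [← hz]
        simpa using (aeval_algebraMap_apply_eq_algebraMap_eval (A := ℂ) z.re H).symm
      exact_mod_cast this
    obtain ⟨p, hp⟩ := dvd_iff_isRoot.2 hroot
    rcases le_or_gt z.re 0 with hneg | hpos
    · obtain ⟨h1, h2⟩ := key _ p 0 (monic_X_sub_C z.re) (by simp) hp (by
        intro y hy hy0
        have := lt_of_le_of_ne hy (Ne.symm hy0)
        simp only [eval_sub, eval_X, eval_C]
        linarith)
      rw [natDegree_X_sub_C] at h2
      rw [h2]
      have h3 := h1.mul_paraSquare (h := C (√(-z.re)) + X) (e := 1) (by compute_degree)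
      convert! h3 using 1
      conv_lhs => rw [hp]
      have : (C (√(-z.re)) : ℝ[X]) * C (√(-z.re)) = -C z.re := by
        rw [← C_mul, Real.mul_self_sqrt (by linarith), C_neg]
      simp only [mul_comp, sub_comp, X_comp, C_comp, add_comp]
      linear_combination -p.comp (-X ^ 2) * this
    -- The cofactor vanishes at the positive root as well: otherwise `H` would change sign there.
    · have hp0 : p.eval z.re = 0 := by
        have hc : ContinuousAt (fun x => p.eval x) z.re := p.continuous.continuousAt
        apply le_antisymm
        · refine le_of_tendsto (f := fun y => p.eval y) (x := 𝓝[<] z.re)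
            (hc.tendsto.mono_left nhdsWithin_le_nhds) ?_
          filter_upwards [Ioo_mem_nhdsLT hpos] with y hy
          have := hH y hy.1.le
          rw [hp, eval_mul] at this
          simp only [eval_sub, eval_X, eval_C] at this
          by_contra hcon
          push Not at hcon
          nlinarith [hy.2]
        · refine ge_of_tendsto (f := fun y => p.eval y) (x := 𝓝[>] z.re)
            (hc.tendsto.mono_left nhdsWithin_le_nhds) ?_
          filter_upwards [self_mem_nhdsWithin] with y hy
          have hy : z.re < y := hy
          have := hH y (hpos.trans hy).le
          rw [hp, eval_mul] at this
          simp only [eval_sub, eval_X, eval_C] at this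
          exact nonneg_of_mul_nonneg_right this (by linarith)
      obtain ⟨p', hp'⟩ := dvd_iff_isRoot.2 hp0
      obtain ⟨h1, h2⟩ := key ((X - C z.re) ^ 2) p' z.re ((monic_X_sub_C _).pow 2)
        (by rw [natDegree_pow]; simp) (by rw [hp, hp']; ring) (by
          intro y hy hy0
          have : y - z.re ≠ 0 := sub_ne_zero.2 hy0
          simp only [eval_pow, eval_sub, eval_X, eval_C]
          positivity)
      rw [natDegree_pow, natDegree_X_sub_C] at h2
      rw [h2]
      have h3 := h1.mul_paraSquare (h := X ^ 2 + C z.re) (e := 2 * 1) (by compute_degree)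
      convert! h3 using 1
      conv_lhs => rw [hp, hp']
      simp only [mul_comp, sub_comp, X_comp, C_comp, add_comp, pow_comp]
      ring
  · obtain ⟨p, hp⟩ := quadratic_dvd_of_aeval_eq_zero_im_ne_zero H hz him
    have hmonic : (X ^ 2 - C (2 * z.re) * X + C (‖z‖ ^ 2) : ℝ[X]).Monic := by monicity!
    have hdeg2 : (X ^ 2 - C (2 * z.re) * X + C (‖z‖ ^ 2) : ℝ[X]).natDegree = 2 := by
      compute_degree!
    have hnz : ‖z‖ ^ 2 = z.re ^ 2 + z.im ^ 2 := by
      rw [← Complex.normSq_eq_norm_sq, Complex.normSq_apply]; ring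
    obtain ⟨h1, h2⟩ := key _ p 0 hmonic (by omega) hp (by
      intro y _ _
      have : 0 < z.im ^ 2 := by positivity
      simp only [eval_add, eval_sub, eval_mul, eval_pow, eval_X, eval_C, hnz]
      nlinarith [sq_nonneg (y - z.re)])
    rw [hdeg2] at h2
    rw [h2]
    have h3 := (h1.mul_paraSquare (h := X ^ 2 + C z.re) (e := 2) (by compute_degree)).add
      (h1.mul_paraSquare (h := C z.im) (e := 2) (by simp))
    convert! h3 using 1
    conv_lhs => rw [hp]
    simp only [mul_comp, sub_comp, X_comp, C_comp, add_comp, pow_comp, hnz, C_add, C_mul, C_pow]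
    simp only [map_ofNat]
    ring

/-- Odd coefficients vanish, so `G` is a polynomial in `X²`; the sign makes `H` at `x ≥ 0` the value
of `G` at `i √x`. -/
theorem exists_comp_neg_X_sq_of_even {G : ℝ[X]} (hG : G.comp (-X) = G) :
    ∃ H : ℝ[X], G = H.comp (-X ^ 2) ∧ H.natDegree * 2 = G.natDegree := by
  have hexp : expand ℝ 2 (contract 2 G) = G := by
    ext n
    rw [coeff_expand (by norm_num)]
    split_ifs with h
    · rw [coeff_contract (by norm_num), Nat.div_mul_cancel h]
    · have h1 : G.coeff n = (-1) ^ n * G.coeff n := by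
        conv_lhs => rw [← hG, show (-X : ℝ[X]) = C (-1) * X by simp, comp_C_mul_X_coeff, mul_comm]
      rw [(Nat.not_even_iff_odd.1 fun he => h he.two_dvd).neg_one_pow] at h1
      linarith
  refine ⟨(contract 2 G).comp (-X), ?_, ?_⟩
  · conv_lhs => rw [← hexp, expand_eq_comp_X_pow]
    rw [comp_assoc]
    simp
  · conv_rhs => rw [← hexp, natDegree_expand]
    simp [natDegree_comp]

/-! ### Quadratic storage functions and the Kalman-Yakubovich-Popov lemma. -/

/-- A pairing of monomials of degree at most `q` that changes sign under an index shift depends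
only on the polynomial `p(-X) r(X)`. -/
theorem exists_linearMap_of_shift {N : Type*} [AddCommGroup N] [Module ℝ N] {q : ℕ}
    (I : ℕ → ℕ → N) (hI : ∀ i j, i < q → j < q → I (i + 1) j = -I i (j + 1)) :
    ∃ L : ℝ[X] →ₗ[ℝ] N, ∀ p r : ℝ[X], p.natDegree ≤ q → r.natDegree ≤ q →
      ∑ i ∈ Finset.range (q + 1), ∑ j ∈ Finset.range (q + 1), (p.coeff i * r.coeff j) • I i j
        = L (p.comp (-X) * r) := by
  -- On the antidiagonal `i + j = k` the entries agree up to `(-1) ^ i`. Their common value is read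
  -- off at the first admissible index, `i = 0` or, when `k > q`, `i = k - q`.
  let c : ℕ → N := fun k => if k ≤ q then I 0 k else (-1 : ℝ) ^ (k - q) • I (k - q) q
  have hc : ∀ i ≤ q, ∀ j ≤ q, I i j = (-1 : ℝ) ^ i • c (i + j) := by
    intro i
    induction i with
    | zero => intro _ j hj; simp [c, hj]
    | succ i ih =>
      intro hi j hj
      rcases hj.lt_or_eq with hj | rfl
      · rw [hI i j (by omega) hj, ih (by omega) (j + 1) (by omega), pow_succ,
          show i + (j + 1) = i + 1 + j by omega]
        simp
      · have : ¬ (i + 1 + j ≤ j) := by omega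
        simp only [c, this, if_false, Nat.add_sub_cancel, smul_smul, ← mul_pow]
        simp
  let L : ℝ[X] →ₗ[ℝ] N := Polynomial.lsum fun k => LinearMap.toSpanSingleton ℝ N (c k)
  have hL : ∀ k a, L (C a * X ^ k) = a • c k := by
    intro k a
    rw [C_mul_X_pow_eq_monomial]
    simp [L]
  refine ⟨L, fun p r hp hr => ?_⟩
  have hp' : p.comp (-X) = ∑ i ∈ Finset.range (q + 1), C (p.coeff i * (-1) ^ i) * X ^ i := by
    conv_lhs => rw [p.as_sum_range_C_mul_X_pow' (Nat.lt_succ_of_le hp)]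
    rw [← coe_compRingHom_apply, map_sum]
    refine Finset.sum_congr rfl fun i _ => ?_
    simp [neg_pow (X : ℝ[X]) i, mul_assoc]
  rw [hp']
  conv_rhs => rw [r.as_sum_range_C_mul_X_pow' (Nat.lt_succ_of_le hr)]
  rw [Finset.sum_mul_sum, map_sum]
  refine Finset.sum_congr rfl fun i hi => ?_
  rw [map_sum]
  refine Finset.sum_congr rfl fun j hj => ?_
  rw [hc i (Nat.lt_succ_iff.1 (Finset.mem_range.1 hi)) j (Nat.lt_succ_iff.1 (Finset.mem_range.1 hj)),
    show C (p.coeff i * (-1) ^ i) * X ^ i * (C (r.coeff j) * X ^ j)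
      = C (p.coeff i * r.coeff j * (-1) ^ i) * X ^ (i + j) by simp only [C_mul, pow_add]; ring,
    hL, smul_smul]

theorem dotProduct_mulVec_eq_vecMul {d e : ℕ} (v : Fin d → ℝ) (A : Matrix (Fin d) (Fin e) ℝ)
    (w : Fin e → ℝ) : v ⬝ᵥ (A *ᵥ w) = (v ᵥ* A) ⬝ᵥ w :=
  dotProduct_mulVec _ _ _

/-- `ψ` reads off the first coordinate of the controller form of the pair `(Λ, b)`. -/
def IsFlatOutput {q : ℕ} (Λ : Matrix (Fin q) (Fin q) ℝ) (b ψ : Fin q → ℝ) : Prop :=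
  ∀ j < q, ψ ⬝ᵥ (Λ ^ j *ᵥ b) = if j + 1 = q then 1 else 0

/-- By controllability the vectors `Λ ^ j b` form a basis, and `ψ` is the coordinate along the last
one. -/
theorem IsControllablePair.exists_isFlatOutput {q : ℕ} {Λ : Matrix (Fin q) (Fin q) ℝ}
    {b : Fin q → ℝ} (h : IsControllablePair Λ b) : ∃ ψ, IsFlatOutput Λ b ψ := by
  have hli : LinearIndependent ℝ fun j : Fin q => (Λ ^ (j : ℕ)) *ᵥ b :=
    linearIndependent_of_top_le_span_of_card_eq_finrank h.ge (by simp)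
  let B := Module.Basis.mk hli h.ge
  let φ : (Fin q → ℝ) →ₗ[ℝ] ℝ := B.constr ℝ fun j : Fin q => if (j : ℕ) + 1 = q then (1 : ℝ) else 0
  refine ⟨fun i => φ (Pi.single i 1), fun j hj => ?_⟩
  have h1 : ∀ v, (fun i => φ (Pi.single i 1)) ⬝ᵥ v = φ v := by
    intro v
    conv_rhs => rw [← Finset.univ_sum_single v, map_sum]
    refine Finset.sum_congr rfl fun i _ => ?_
    rw [mul_comm, ← smul_eq_mul, ← map_smul]
    simp [← Pi.single_smul]
  rw [h1]
  have h2 : B ⟨j, hj⟩ = Λ ^ j *ᵥ b := by simp [B]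
  rw [← h2, B.constr_basis]

section Storage

variable {q : ℕ} (Λ : Matrix (Fin q) (Fin q) ℝ) (b ψ : Fin q → ℝ)

/-- The value of `R(d/dt) ξ`, where `λ(d/dt) ξ = f` has state `w`, for `deg R ≤ q`. -/
noncomputable def jetEval (R : ℝ[X]) (x : (Fin q → ℝ) × ℝ) : ℝ :=
  ψ ⬝ᵥ (aeval Λ R *ᵥ x.1) + R.coeff q * x.2

/-- The derivative of the form `w ↦ w ⬝ᵥ K w` in the direction `Λ w + f b`. -/
noncomputable def exactForm : Matrix (Fin q) (Fin q) ℝ →ₗ[ℝ] ((Fin q → ℝ) × ℝ → ℝ) where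
  toFun K x := (Λ *ᵥ x.1 + x.2 • b) ⬝ᵥ (K *ᵥ x.1) + x.1 ⬝ᵥ (K *ᵥ (Λ *ᵥ x.1 + x.2 • b))
  map_add' K K' := by
    ext x
    simp only [add_mulVec, dotProduct_add, Pi.add_apply]
    ring
  map_smul' c K := by
    ext x
    simp only [smul_mulVec, dotProduct_smul, Pi.smul_apply, smul_eq_mul, RingHom.id_apply]
    ring

variable {Λ b ψ}

theorem jetEval_eq_sum {R : ℝ[X]} (hR : R.natDegree ≤ q) (x : (Fin q → ℝ) × ℝ) :
    jetEval Λ ψ R x = ∑ i ∈ Finset.range (q + 1), R.coeff i * jetEval Λ ψ (X ^ i) x := by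
  unfold jetEval
  conv_lhs => rw [aeval_eq_sum_range' (Nat.lt_succ_of_le hR)]
  simp only [mul_add, Finset.sum_add_distrib, coeff_X_pow, map_pow, aeval_X]
  congr 1
  · rw [sum_mulVec, dotProduct_sum]
    simp [smul_mulVec]
  · simp

theorem IsFlatOutput.dotProduct_pow_mulVec (hψ : IsFlatOutput Λ b ψ) {i : ℕ} (hi : i < q)
    (x : (Fin q → ℝ) × ℝ) :
    ψ ⬝ᵥ (Λ ^ i *ᵥ (Λ *ᵥ x.1 + x.2 • b)) = jetEval Λ ψ (X ^ (i + 1)) x := by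
  rw [mulVec_add, dotProduct_add, mulVec_smul, dotProduct_smul, hψ i hi, mulVec_mulVec, ← pow_succ]
  simp [jetEval, coeff_X_pow, eq_comm, mul_comm]

theorem jetEval_X_pow_of_lt {i : ℕ} (hi : i < q) (x : (Fin q → ℝ) × ℝ) :
    jetEval Λ ψ (X ^ i) x = ψ ⬝ᵥ (Λ ^ i *ᵥ x.1) := by
  simp [jetEval, coeff_X_pow, hi.ne']

/-- Leibniz rule: the expression is the derivative of `ξ⁽ⁱ⁾ ξ⁽ʲ⁾`, a quadratic form in the state
because `i, j < q`. -/
theorem IsFlatOutput.shift_mem_range (hψ : IsFlatOutput Λ b ψ) {i j : ℕ} (hi : i < q)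
    (hj : j < q) :
    (fun x => jetEval Λ ψ (X ^ (i + 1)) x * jetEval Λ ψ (X ^ j) x
      + jetEval Λ ψ (X ^ i) x * jetEval Λ ψ (X ^ (j + 1)) x) ∈ LinearMap.range (exactForm Λ b) := by
  refine ⟨vecMulVec (ψ ᵥ* Λ ^ i) (ψ ᵥ* Λ ^ j), ?_⟩
  ext x
  have h : ∀ v w : Fin q → ℝ, v ⬝ᵥ (vecMulVec (ψ ᵥ* Λ ^ i) (ψ ᵥ* Λ ^ j) *ᵥ w)
      = (ψ ⬝ᵥ (Λ ^ i *ᵥ v)) * (ψ ⬝ᵥ (Λ ^ j *ᵥ w)) := by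
    intro v w
    rw [vecMulVec_mulVec, dotProduct_mulVec_eq_vecMul, dotProduct_mulVec_eq_vecMul,
      dotProduct_comm v]
    simp [mul_comm]
  simp only [exactForm, LinearMap.coe_mk, AddHom.coe_mk, h, hψ.dotProduct_pow_mulVec hi,
    hψ.dotProduct_pow_mulVec hj, ← jetEval_X_pow_of_lt hi, ← jetEval_X_pow_of_lt hj]

/-- Integration by parts: modulo exact derivatives a derivative moves from one factor to the other
with a sign, so only `p(-X) r(X)` matters. -/
theorem IsFlatOutput.exists_linearMap (hψ : IsFlatOutput Λ b ψ) :
    ∃ L : ℝ[X] →ₗ[ℝ] (((Fin q → ℝ) × ℝ → ℝ) ⧸ LinearMap.range (exactForm Λ b)),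
      ∀ p r : ℝ[X], p.natDegree ≤ q → r.natDegree ≤ q →
        (LinearMap.range (exactForm Λ b)).mkQ (fun x => jetEval Λ ψ p x * jetEval Λ ψ r x)
          = L (p.comp (-X) * r) := by
  obtain ⟨L, hL⟩ := exists_linearMap_of_shift (q := q)
    (fun i j => (LinearMap.range (exactForm Λ b)).mkQ
      (fun x => jetEval Λ ψ (X ^ i) x * jetEval Λ ψ (X ^ j) x)) (by
      intro i j hi hj
      rw [eq_neg_iff_add_eq_zero, ← map_add, Submodule.mkQ_apply, Submodule.Quotient.mk_eq_zero]
      exact hψ.shift_mem_range hi hj)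
  refine ⟨L, fun p r hp hr => ?_⟩
  rw [← hL p r hp hr]
  simp only [← map_smul, ← map_sum]
  congr 1
  ext x
  rw [jetEval_eq_sum hp, jetEval_eq_sum hr, Finset.sum_mul_sum]
  simp only [Finset.sum_apply, Pi.smul_apply, smul_eq_mul]
  refine Finset.sum_congr rfl fun i _ => Finset.sum_congr rfl fun j _ => ?_
  ring

/-- Cayley-Hamilton. The factor `X` shifts the index so that `q = 0` needs no separate formula. -/
theorem IsFlatOutput.dotProduct_pow_self (hψ : IsFlatOutput Λ b ψ) :
    ψ ⬝ᵥ (Λ ^ q *ᵥ b) = -(X * Λ.charpoly).coeff q := by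
  have hdeg : Λ.charpoly.natDegree = q := by simp
  have h0 := Λ.aeval_self_charpoly
  rw [aeval_eq_sum_range' (n := q + 1) (by omega), Finset.sum_range_succ] at h0
  have h1 : Λ.charpoly.coeff q = 1 := by
    have h := Λ.charpoly_monic.coeff_natDegree
    rwa [hdeg] at h
  rw [h1, one_smul] at h0
  have h2 : Λ ^ q = -∑ i ∈ Finset.range q, Λ.charpoly.coeff i • Λ ^ i :=
    eq_neg_of_add_eq_zero_right h0
  rw [h2, neg_mulVec, dotProduct_neg, sum_mulVec, dotProduct_sum]
  congr 1
  cases q with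
  | zero => simp
  | succ k =>
    rw [coeff_X_mul, Finset.sum_eq_single_of_mem k (by simp)]
    · simp [smul_mulVec, hψ k (by omega)]
    · intro i hi hik
      have := Finset.mem_range.1 hi
      rw [smul_mulVec, dotProduct_smul, hψ i this]
      simp [hik]

theorem aeval_mul_I_comp_neg_X (p : ℝ[X]) (ω : ℝ) :
    aeval (ω * Complex.I : ℂ) (p.comp (-X))
      = (starRingEnd ℂ) (aeval (ω * Complex.I : ℂ) p) := by
  rw [aeval_comp, ← Polynomial.aeval_conj]
  simp

/-- The even polynomial `G` is nonnegative on the imaginary axis, hence a sum of `h(-X) h(X)`.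
Modulo exact derivatives, twice the supply `f · R(d/dt) ξ` is therefore the sum of the squares
`(h(d/dt) ξ)²`; dropping these gives the inequality. -/
theorem IsFlatOutput.exists_storage_deriv (hψ : IsFlatOutput Λ b ψ) {R : ℝ[X]}
    (hR : R.natDegree ≤ q) (hre : ∀ ω : ℝ, 0 ≤
      ((starRingEnd ℂ) (aeval (ω * Complex.I : ℂ) Λ.charpoly) * aeval (ω * Complex.I : ℂ) R).re) :
    ∃ K, ∀ x, exactForm Λ b K x ≤ x.2 * jetEval Λ ψ R x := by
  have hdeg : Λ.charpoly.natDegree = q := by simp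
  set P := Λ.charpoly with hP
  set G : ℝ[X] := P.comp (-X) * R + R.comp (-X) * P with hG
  have hGeven : G.comp (-X) = G := by
    have h2 : ∀ p : ℝ[X], (p.comp (-X)).comp (-X) = p := fun p => comp_neg_X_comp_neg_X p
    simp only [hG, add_comp, mul_comp, h2]
    ring
  have hGdeg : G.natDegree ≤ 2 * q := by
    have hc : ∀ p : ℝ[X], (p.comp (-X)).natDegree = p.natDegree := by
      intro p; simp [natDegree_comp]
    refine (natDegree_add_le _ _).trans (max_le ?_ ?_)
    · refine natDegree_mul_le.trans ?_
      rw [hc]; omega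
    · refine natDegree_mul_le.trans ?_
      rw [hc]; omega
  obtain ⟨H, hH, hHdeg⟩ := exists_comp_neg_X_sq_of_even hGeven
  have hpos : ∀ x, 0 ≤ x → 0 ≤ H.eval x := by
    intro x hx
    have h1 : aeval (√x * Complex.I : ℂ) G = ((H.eval x : ℝ) : ℂ) := by
      rw [hH, aeval_comp]
      have : (aeval (√x * Complex.I : ℂ)) (-X ^ 2 : ℝ[X]) = algebraMap ℝ ℂ x := by
        simp only [map_neg, map_pow, aeval_X, mul_pow, Complex.I_sq]
        rw [← Complex.ofReal_pow, Real.sq_sqrt hx]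
        simp
      rw [this, aeval_algebraMap_apply_eq_algebraMap_eval]
      rfl
    have h2 := hre √x
    rw [hG, map_add, map_mul, map_mul, aeval_mul_I_comp_neg_X, aeval_mul_I_comp_neg_X] at h1
    have h3 := congrArg Complex.re h1
    simp only [Complex.add_re, Complex.mul_re, Complex.conj_re, Complex.conj_im,
      Complex.ofReal_re] at h2 h3
    linarith
  obtain ⟨l, hl, hsum⟩ := (isParaSquareSum_comp_neg_X_sq H hpos).mono (show H.natDegree ≤ q by omega)
  obtain ⟨L, hL⟩ := hψ.exists_linearMap
  set Q := (LinearMap.range (exactForm Λ b)).mkQ with hQ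
  have hsq : Q (fun x => (l.map fun h => jetEval Λ ψ h x * jetEval Λ ψ h x).sum)
      = L ((l.map fun p => p.comp (-X) * p).sum) := by
    clear hsum
    induction l with
    | nil => exact (map_zero Q).trans (map_zero L).symm
    | cons h l ih =>
      simp only [List.map_cons, List.sum_cons, map_add]
      rw [← ih fun p hp => hl p (List.mem_cons_of_mem _ hp), ← hL h h (hl h (by simp)) (hl h (by simp)),
        ← map_add]
      rfl
  have hzero : (fun x => jetEval Λ ψ P x * jetEval Λ ψ R x + jetEval Λ ψ R x * jetEval Λ ψ P x
      - (l.map fun h => jetEval Λ ψ h x * jetEval Λ ψ h x).sum)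
        ∈ LinearMap.range (exactForm Λ b) := by
    rw [← Submodule.Quotient.mk_eq_zero, ← Submodule.mkQ_apply]
    have : L G - L ((l.map fun p => p.comp (-X) * p).sum) = 0 := by rw [hH, hsum, sub_self]
    rw [hG, map_add, ← hL P R hdeg.le hR, ← hL R P hR hdeg.le, ← hsq, ← map_add, ← map_sub] at this
    exact this
  obtain ⟨K, hK⟩ := hzero
  refine ⟨(1 / 2 : ℝ) • K, fun x => ?_⟩
  have hx := congrFun hK x
  have hf : jetEval Λ ψ P x = x.2 := by
    have h1 : P.coeff q = 1 := by
      have h := Λ.charpoly_monic.coeff_natDegree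
      rwa [← hP, hdeg] at h
    rw [jetEval, h1, hP, Λ.aeval_self_charpoly]
    simp
  have hs : 0 ≤ (l.map fun h => jetEval Λ ψ h x * jetEval Λ ψ h x).sum := by
    refine List.sum_nonneg fun y hy => ?_
    obtain ⟨h, _, rfl⟩ := List.mem_map.1 hy
    exact mul_self_nonneg _
  rw [map_smul, Pi.smul_apply, smul_eq_mul, hx, hf]
  linarith

/-- The Kalman-Yakubovich-Popov lemma for the transfer function `D / det (s - Λ)`, in terms of the
filter `w' = Λ w + f b`. -/
theorem IsFlatOutput.exists_storage (hψ : IsFlatOutput Λ b ψ) (hH : IsHurwitzPoly Λ.charpoly)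
    {D : ℝ[X]} (hD : D.Monic) (hDdeg : D.natDegree = q + 1) {δ : ℝ}
    (hre : ∀ ω : ℝ, δ * ‖aeval (ω * Complex.I : ℂ) Λ.charpoly‖ ^ 2 ≤
      ((starRingEnd ℂ) (aeval (ω * Complex.I : ℂ) Λ.charpoly)
        * aeval (ω * Complex.I : ℂ) D).re) :
    ∃ K : Matrix (Fin q) (Fin q) ℝ, (∀ w, 0 ≤ w ⬝ᵥ (K *ᵥ w)) ∧ ∀ (w : Fin q → ℝ) (f : ℝ),
      (Λ *ᵥ w + f • b) ⬝ᵥ (K *ᵥ w) + w ⬝ᵥ (K *ᵥ (Λ *ᵥ w + f • b))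
        ≤ (D.coeff q + ψ ⬝ᵥ (Λ ^ q *ᵥ b) - δ) * f ^ 2 + f * (ψ ⬝ᵥ (aeval Λ D *ᵥ w)) := by
  have hdeg : Λ.charpoly.natDegree = q := by simp
  have hP1 : Λ.charpoly.coeff q = 1 := by
    have h := Λ.charpoly_monic.coeff_natDegree
    rwa [hdeg] at h
  -- Subtracting `X λ` lowers the degree to `q` and changes `Re (λ̄ D)` by nothing on the imaginary
  -- axis; subtracting `δ λ` uses up the positivity margin.
  set R := D - X * Λ.charpoly - C δ * Λ.charpoly with hR
  have hRdeg : R.natDegree ≤ q := by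
    refine (natDegree_sub_le _ _).trans (max_le ?_ ?_)
    · exact natDegree_sub_le_of_monic hD (monic_X.mul Λ.charpoly_monic) hDdeg
        (by rw [monic_X.natDegree_mul Λ.charpoly_monic, hdeg, natDegree_X, add_comm])
    · exact (natDegree_C_mul_le _ _).trans hdeg.le
  obtain ⟨K, hK⟩ := hψ.exists_storage_deriv hRdeg (by
    intro ω
    have h1 := hre ω
    have h2 : (starRingEnd ℂ) (aeval (ω * Complex.I : ℂ) Λ.charpoly)
        * aeval (ω * Complex.I : ℂ) R =
        (starRingEnd ℂ) (aeval (ω * Complex.I : ℂ) Λ.charpoly) * aeval (ω * Complex.I : ℂ) D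
        - (ω * Complex.I + δ) * ((‖aeval (ω * Complex.I : ℂ) Λ.charpoly‖ ^ 2 : ℝ) : ℂ) := by
      rw [← Complex.normSq_eq_norm_sq, ← Complex.mul_conj, hR]
      simp
      ring
    rw [h2, Complex.sub_re, mul_comm (_ + _) _, Complex.re_ofReal_mul]
    simp only [Complex.add_re, Complex.mul_re, Complex.ofReal_re, Complex.I_re, mul_zero,
      Complex.ofReal_im, Complex.I_im, mul_one, sub_zero, zero_add] at h1 ⊢
    linarith)
  have hdiss : ∀ (w : Fin q → ℝ) (f : ℝ),
      (Λ *ᵥ w + f • b) ⬝ᵥ (K *ᵥ w) + w ⬝ᵥ (K *ᵥ (Λ *ᵥ w + f • b))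
        ≤ (D.coeff q + ψ ⬝ᵥ (Λ ^ q *ᵥ b) - δ) * f ^ 2 + f * (ψ ⬝ᵥ (aeval Λ D *ᵥ w)) := by
    intro w f
    refine (hK (w, f)).trans (le_of_eq ?_)
    have h1 : aeval Λ R = aeval Λ D := by simp [hR, Λ.aeval_self_charpoly]
    have h2 : R.coeff q = D.coeff q + ψ ⬝ᵥ (Λ ^ q *ᵥ b) - δ := by
      rw [hψ.dotProduct_pow_self, hR]
      simp only [coeff_sub, coeff_C_mul, hP1]
      ring
    simp only [jetEval, h1, h2]
    ring
  -- With zero input the form does not increase along the filter motion, and it tends to zero with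
  -- the state; hence its initial value is nonnegative.
  refine ⟨K, fun w => ?_, hdiss⟩
  obtain ⟨x, hx0, hx⟩ := exists_hasDerivAt_linear Λ 0 w (continuous_const (y := (0 : ℝ)))
  simp only [smul_zero, add_zero] at hx
  obtain ⟨c, α, hc, hα, hdecay⟩ := exists_exp_decay_of_isHurwitzPoly Λ Λ.charpoly_monic hH
    Λ.aeval_self_charpoly
  have hV : ∀ T, 0 ≤ T → x T ⬝ᵥ (K *ᵥ x T) ≤ w ⬝ᵥ (K *ᵥ w) := by
    intro T hT
    have h1 : HasDerivOff ∅ T x (fun t => Λ *ᵥ x t) := HasDerivOff.of_hasDerivAt hx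
    have h2 := (h1.dotProduct (h1.mulVec K)).antitoneOn Set.finite_empty (by
      intro t _ _
      simpa using hdiss (x t) 0)
    simpa [hx0] using h2 (left_mem_Icc.2 hT) (right_mem_Icc.2 hT) hT
  have hlim : Tendsto x atTop (𝓝 0) := by
    rw [tendsto_zero_iff_norm_tendsto_zero]
    have h1 : Tendsto (fun t => c * Real.exp (-α * t) * ‖w‖) atTop (𝓝 0) := by
      have h2 : Tendsto (fun t : ℝ => Real.exp (-α * t)) atTop (𝓝 0) :=
        Real.tendsto_exp_atBot.comp (tendsto_id.const_mul_atTop_of_neg (by linarith))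
      simpa using (h2.const_mul c).mul_const ‖w‖
    refine tendsto_of_tendsto_of_tendsto_of_le_of_le' tendsto_const_nhds h1
      (Eventually.of_forall fun t => norm_nonneg _) ?_
    filter_upwards [eventually_ge_atTop 0] with t ht
    rw [← hx0]
    exact hdecay ∅ t x Set.finite_empty (HasDerivOff.of_hasDerivAt hx) t (right_mem_Icc.2 ht)
  have hVlim : Tendsto (fun t => x t ⬝ᵥ (K *ᵥ x t)) atTop (𝓝 0) := by
    have hcont : Continuous fun v : Fin q → ℝ => v ⬝ᵥ (K *ᵥ v) :=
      Continuous.dotProduct continuous_id (Continuous.matrix_mulVec continuous_const continuous_id)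
    have h := (hcont.tendsto 0).comp hlim
    rwa [zero_dotProduct] at h
  refine le_of_tendsto hVlim ?_
  filter_upwards [eventually_ge_atTop 0] with t ht using hV t ht

end Storage

/-! ### Transfer function numerators, inverse dynamics and Bezout matrices. -/

/-- The determinant lemma over the fraction field. The application is to `sI - A`, which is not
invertible over `ℝ[X]`. -/
theorem Matrix.det_add_vecMulVec {d : ℕ} {R : Type*} [CommRing R] [IsDomain R]
    (M : Matrix (Fin d) (Fin d) R) (hM : M.det ≠ 0) (u v : Fin d → R) :
    (M + vecMulVec u v).det = M.det + v ⬝ᵥ (M.adjugate *ᵥ u) := by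
  let φ : R →+* FractionRing R := algebraMap R (FractionRing R)
  have hφ : Function.Injective φ := IsFractionRing.injective R (FractionRing R)
  apply hφ
  have hdet : IsUnit (M.map φ).det := by
    have h : (M.map φ).det = φ M.det := by rw [RingHom.map_det]; rfl
    rw [h, isUnit_iff_ne_zero, Ne, map_eq_zero_iff _ hφ]
    exact hM
  have h1 : (M + vecMulVec u v).map φ
      = M.map φ + replicateCol Unit (φ ∘ u) * replicateRow Unit (φ ∘ v) := by
    ext i j
    simp [vecMulVec_apply, Matrix.mul_apply]
  have h2 : φ (M + vecMulVec u v).det = ((M + vecMulVec u v).map φ).det := by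
    rw [RingHom.map_det]; rfl
  have h3 : M.adjugate.map φ = (M.map φ).adjugate := by
    have := RingHom.map_adjugate φ M
    simpa using this
  have h4 : (M.map φ).det = φ M.det := by rw [RingHom.map_det]; rfl
  have h5 : φ (v ⬝ᵥ (M.adjugate *ᵥ u)) = (φ ∘ v) ⬝ᵥ ((M.map φ).adjugate *ᵥ (φ ∘ u)) := by
    rw [← h3, RingHom.map_dotProduct]
    congr 1
    ext i
    simp [RingHom.map_mulVec]
  have h6 : (1 + replicateRow Unit (φ ∘ v) * (M.map φ)⁻¹ * replicateCol Unit (φ ∘ u)).det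
      = 1 + (φ ∘ v) ⬝ᵥ ((M.map φ)⁻¹ *ᵥ (φ ∘ u)) := by
    rw [det_unique, Matrix.add_apply, one_apply_eq, dotProduct_mulVec]
    rfl
  rw [h2, h1, det_add_replicateCol_mul_replicateRow hdet, map_add, h5, ← h4, h6, mul_add, mul_one,
    inv_def, smul_mulVec, dotProduct_smul, smul_eq_mul, ← mul_assoc, Ring.mul_inverse_cancel _ hdet,
    one_mul]

theorem C_comp_vecMul {d : ℕ} (A : Matrix (Fin d) (Fin d) ℝ) (c : Fin d → ℝ) :
    (fun i => C ((c ᵥ* A) i)) = (fun i => C (c i)) ᵥ* A.map (C : ℝ →+* ℝ[X]) := by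
  ext1 i
  simp [vecMul, dotProduct]

theorem C_comp_mulVec {d : ℕ} (A : Matrix (Fin d) (Fin d) ℝ) (v : Fin d → ℝ) :
    (fun i => C ((A *ᵥ v) i)) = A.map (C : ℝ →+* ℝ[X]) *ᵥ (fun i => C (v i)) := by
  ext1 i
  simp [mulVec, dotProduct]

theorem charmatrix_mulVec {d : ℕ} (A : Matrix (Fin d) (Fin d) ℝ) (v : Fin d → ℝ[X]) :
    A.charmatrix *ᵥ v = (X : ℝ[X]) • v - A.map (C : ℝ →+* ℝ[X]) *ᵥ v := by
  rw [charmatrix, sub_mulVec]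
  congr 1
  ext1 i
  simp

theorem vecMul_charmatrix {d : ℕ} (A : Matrix (Fin d) (Fin d) ℝ) (v : Fin d → ℝ[X]) :
    v ᵥ* A.charmatrix = (X : ℝ[X]) • v - v ᵥ* A.map (C : ℝ →+* ℝ[X]) := by
  rw [charmatrix, vecMul_sub]
  congr 1
  ext1 i
  simp [mul_comm]

theorem tfNum_add {d : ℕ} (A : Matrix (Fin d) (Fin d) ℝ) (b c c' : Fin d → ℝ) :
    tfNum A b (c + c') = tfNum A b c + tfNum A b c' := by
  simp only [tfNum, ← add_dotProduct]
  congr 1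
  ext1 i
  simp

/-- From `(sI - A) adj(sI - A) = det(sI - A) I`, which trades `A` for `s`. -/
theorem tfNum_vecMul {d : ℕ} (A : Matrix (Fin d) (Fin d) ℝ) (b c : Fin d → ℝ) :
    tfNum A b (c ᵥ* A) = X * tfNum A b c - C (c ⬝ᵥ b) * A.charpoly := by
  have h1 : (fun i => C ((c ᵥ* A) i)) = (X : ℝ[X]) • (fun i => C (c i))
      - (fun i => C (c i)) ᵥ* A.charmatrix := by
    rw [vecMul_charmatrix, C_comp_vecMul, sub_sub_cancel]
  rw [tfNum, h1, sub_dotProduct, smul_dotProduct, tfNum, ← dotProduct_mulVec, mulVec_mulVec,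
    mul_adjugate, smul_mulVec, one_mulVec, dotProduct_smul]
  simp [charpoly, dotProduct, mul_comm]

theorem charpoly_sub_vecMulVec {d : ℕ} (A : Matrix (Fin d) (Fin d) ℝ) (b g : Fin d → ℝ) :
    (A - vecMulVec b g).charpoly = A.charpoly + tfNum A b g := by
  have h1 : (A - vecMulVec b g).charmatrix
      = A.charmatrix + vecMulVec (fun i => C (b i)) (fun i => C (g i)) := by
    ext1 i j
    simp only [charmatrix_apply, vecMulVec_apply, Matrix.sub_apply, Matrix.add_apply, C_sub, C_mul]
    ring
  rw [charpoly, h1, det_add_vecMulVec _ A.charpoly_monic.ne_zero]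
  rfl

/-- The inverse system of a plant with unit high frequency gain. -/
theorem charpoly_inverse_dynamics {d : ℕ} (A : Matrix (Fin d) (Fin d) ℝ) (b c : Fin d → ℝ)
    (hcb : c ⬝ᵥ b = 1) :
    (A - vecMulVec b (c ᵥ* A + c)).charpoly = (X + C 1) * tfNum A b c := by
  rw [charpoly_sub_vecMulVec, tfNum_add, tfNum_vecMul, hcb]
  simp only [map_one, one_mul]
  ring

/-- `((Q(s) - Q(A)) / (s - A)) v` as a vector of polynomials. -/
noncomputable def divDiff {d : ℕ} (A : Matrix (Fin d) (Fin d) ℝ) (v : Fin d → ℝ) :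
    ℝ[X] →ₗ[ℝ] (Fin d → ℝ[X]) :=
  Polynomial.lsum fun k => LinearMap.toSpanSingleton ℝ (Fin d → ℝ[X])
    (∑ j ∈ Finset.range k, fun i => C ((A ^ (k - 1 - j) *ᵥ v) i) * X ^ j)

/-- The rectangular Bezout matrix `∑ Q_k ∑ Λ^j b c A^(k-1-j)`. -/
noncomputable def bezout {q d : ℕ} (Λ : Matrix (Fin q) (Fin q) ℝ) (b : Fin q → ℝ)
    (A : Matrix (Fin d) (Fin d) ℝ) (c : Fin d → ℝ) : ℝ[X] →ₗ[ℝ] Matrix (Fin q) (Fin d) ℝ :=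
  Polynomial.lsum fun k => LinearMap.toSpanSingleton ℝ (Matrix (Fin q) (Fin d) ℝ)
    (∑ j ∈ Finset.range k, vecMulVec (Λ ^ j *ᵥ b) (c ᵥ* A ^ (k - 1 - j)))

section Bezout

variable {q d : ℕ} (Λ : Matrix (Fin q) (Fin q) ℝ) (b : Fin q → ℝ)
    (A : Matrix (Fin d) (Fin d) ℝ) (c v : Fin d → ℝ)

theorem divDiff_monomial (k : ℕ) (a : ℝ) : divDiff A v (monomial k a)
    = a • ∑ j ∈ Finset.range k, fun i => C ((A ^ (k - 1 - j) *ᵥ v) i) * X ^ j := by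
  simp [divDiff]

theorem bezout_monomial (k : ℕ) (a : ℝ) : bezout Λ b A c (monomial k a)
    = a • ∑ j ∈ Finset.range k, vecMulVec (Λ ^ j *ᵥ b) (c ᵥ* A ^ (k - 1 - j)) := by
  simp [bezout]

/-- On monomials the sum telescopes, as in `s^k - A^k = (s - A) ∑ s^j A^(k-1-j)`. -/
theorem charmatrix_mulVec_divDiff (Q : ℝ[X]) :
    A.charmatrix *ᵥ divDiff A v Q = Q • (fun i => C (v i)) - fun i => C ((aeval A Q *ᵥ v) i) := by
  induction Q using Polynomial.induction_on' with
  | add p r hp hr =>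
    rw [map_add, mulVec_add, hp, hr, add_smul]
    ext1 i
    simp [add_mulVec]
    ring
  | monomial k a =>
    rw [divDiff_monomial]
    have key : A.charmatrix *ᵥ (∑ j ∈ Finset.range k, fun i => C ((A ^ (k - 1 - j) *ᵥ v) i) * X ^ j)
        = (X ^ k : ℝ[X]) • (fun i => C (v i)) - fun i => C ((A ^ k *ᵥ v) i) := by
      rw [charmatrix_mulVec, Finset.smul_sum, mulVec_sum, ← Finset.sum_sub_distrib]
      have hterm : ∀ j ∈ Finset.range k,
          ((X : ℝ[X]) • (fun i => C ((A ^ (k - 1 - j) *ᵥ v) i) * X ^ j)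
            - A.map (C : ℝ →+* ℝ[X]) *ᵥ (fun i => C ((A ^ (k - 1 - j) *ᵥ v) i) * X ^ j))
          = (fun i => C ((A ^ (k - (j + 1)) *ᵥ v) i) * X ^ (j + 1))
            - (fun i => C ((A ^ (k - j) *ᵥ v) i) * X ^ j) := by
        intro j hj
        have hj := Finset.mem_range.1 hj
        congr 1
        · ext1 i
          simp only [Pi.smul_apply, smul_eq_mul, pow_succ, Nat.sub_sub, add_comm 1 j]
          ring
        · have h1 : A ^ (k - j) *ᵥ v = A *ᵥ (A ^ (k - 1 - j) *ᵥ v) := by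
            rw [mulVec_mulVec, ← pow_succ']
            congr 2
            omega
          have h2 : (fun i => C ((A ^ (k - 1 - j) *ᵥ v) i) * X ^ j)
              = (X ^ j : ℝ[X]) • fun i => C ((A ^ (k - 1 - j) *ᵥ v) i) := by
            ext1 i; exact mul_comm _ _
          rw [h2, mulVec_smul, ← C_comp_mulVec, ← h1]
          ext1 i
          exact mul_comm _ _
      rw [Finset.sum_congr rfl hterm, Finset.sum_range_sub (fun j =>
        (fun i => C ((A ^ (k - j) *ᵥ v) i) * X ^ j : Fin d → ℝ[X]))]
      ext1 i
      simp only [Nat.sub_self, pow_zero, one_mulVec, Nat.sub_zero, mul_one, Pi.sub_apply,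
        Pi.smul_apply, smul_eq_mul]
      rw [mul_comm]
    have h3 : ∀ w : Fin d → ℝ[X], a • w = C a • w := by
      intro w; ext1 i; simp [smul_eq_C_mul]
    rw [h3, mulVec_smul, key, ← C_mul_X_pow_eq_monomial]
    ext1 i
    simp [smul_mulVec, mul_sub, mul_assoc, Algebra.algebraMap_eq_smul_one]

/-- For a multiple `Q` of the characteristic polynomial, the numerator is the corresponding
multiple of the transfer function numerator. -/
theorem dotProduct_divDiff_mul_charpoly (κ : ℝ[X]) :
    (fun i => C (c i)) ⬝ᵥ divDiff A v (κ * A.charpoly) = κ * tfNum A v c := by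
  have h1 := charmatrix_mulVec_divDiff A v (κ * A.charpoly)
  have h0 : aeval A (κ * A.charpoly) = 0 := by rw [map_mul, A.aeval_self_charpoly, mul_zero]
  have h2 := congrArg (fun w => A.charmatrix.adjugate *ᵥ w) h1
  simp only [h0, mulVec_mulVec, adjugate_mul, smul_mulVec, one_mulVec, zero_mulVec, Pi.zero_apply,
    map_zero] at h2
  have h3 : A.charpoly • divDiff A v (κ * A.charpoly)
      = A.charpoly • (κ • (A.charmatrix.adjugate *ᵥ fun i => C (v i))) := by
    have h4 : (fun _ : Fin d => (0 : ℝ[X])) = 0 := rfl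
    rw [h4, sub_zero, mulVec_smul, mul_comm, mul_smul] at h2
    rw [mul_comm]
    exact h2
  have h5 := smul_right_injective (Fin d → ℝ[X]) A.charpoly_monic.ne_zero h3
  rw [h5, dotProduct_smul, tfNum, smul_eq_mul]

theorem coeff_dotProduct_divDiff (Q : ℝ[X]) {N : ℕ} (hN : Q.natDegree < N) (j : ℕ) :
    ((fun i => C (c i)) ⬝ᵥ divDiff A v Q).coeff j
      = ∑ k ∈ Finset.range N, if j < k then Q.coeff k * (c ⬝ᵥ (A ^ (k - 1 - j) *ᵥ v)) else 0 := by
  conv_lhs => rw [Q.as_sum_range' N hN]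
  rw [map_sum, dotProduct_sum, finsetSum_coeff]
  refine Finset.sum_congr rfl fun k _ => ?_
  rw [divDiff_monomial, dotProduct_smul, dotProduct_sum, coeff_smul, finsetSum_coeff]
  have h1 : ∀ l, ((fun i => C (c i)) ⬝ᵥ (fun i => C ((A ^ (k - 1 - l) *ᵥ v) i) * X ^ l)).coeff j
      = if l = j then c ⬝ᵥ (A ^ (k - 1 - l) *ᵥ v) else 0 := by
    intro l
    have : ((fun i => C (c i)) ⬝ᵥ (fun i => C ((A ^ (k - 1 - l) *ᵥ v) i) * X ^ l))
        = C (c ⬝ᵥ (A ^ (k - 1 - l) *ᵥ v)) * X ^ l := by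
      simp only [dotProduct, map_sum, Finset.sum_mul, C_mul, mul_assoc]
    rw [this, coeff_C_mul_X_pow]
    simp only [eq_comm]
  simp only [h1, Finset.sum_ite_eq', Finset.mem_range]
  split_ifs <;> simp

theorem natDegree_dotProduct_divDiff_le {Q : ℝ[X]} {k : ℕ} (hQ : Q.natDegree ≤ k + 1) :
    ((fun i => C (c i)) ⬝ᵥ divDiff A v Q).natDegree ≤ k := by
  rw [natDegree_le_iff_coeff_eq_zero]
  intro j hj
  rw [coeff_dotProduct_divDiff A c v Q (Nat.lt_succ_of_le hQ)]
  refine Finset.sum_eq_zero fun l hl => ?_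
  rw [if_neg]
  have := Finset.mem_range.1 hl
  omega

theorem coeff_dotProduct_divDiff_top {Q : ℝ[X]} {k : ℕ} (hQ : Q.Monic) (hk : Q.natDegree = k + 1) :
    ((fun i => C (c i)) ⬝ᵥ divDiff A v Q).coeff k = c ⬝ᵥ v := by
  have h1 : Q.coeff (k + 1) = 1 := by rw [← hk]; exact hQ.coeff_natDegree
  rw [coeff_dotProduct_divDiff A c v Q (N := k + 2) (by omega), Finset.sum_range_succ,
    Finset.sum_eq_zero]
  · simp [h1]
  · intro l hl
    rw [if_neg]
    have := Finset.mem_range.1 hl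
    omega

theorem coeff_dotProduct_divDiff_next {Q : ℝ[X]} {k : ℕ} (hQ : Q.Monic)
    (hk : Q.natDegree = k + 2) :
    ((fun i => C (c i)) ⬝ᵥ divDiff A v Q).coeff k
      = Q.coeff (k + 1) * (c ⬝ᵥ v) + c ⬝ᵥ (A *ᵥ v) := by
  have h1 : Q.coeff (k + 2) = 1 := by rw [← hk]; exact hQ.coeff_natDegree
  rw [coeff_dotProduct_divDiff A c v Q (N := k + 3) (by omega), Finset.sum_range_succ,
    Finset.sum_range_succ, Finset.sum_eq_zero]
  · simp [h1]
  · intro l hl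
    rw [if_neg]
    have := Finset.mem_range.1 hl
    omega

/-- An input vector `v` of the `A`-system becomes `N(Λ) b`, with `N` the numerator from `v` to the
output when `Q` is the characteristic polynomial. -/
theorem bezout_mulVec (Q : ℝ[X]) :
    bezout Λ b A c Q *ᵥ v = aeval Λ ((fun i => C (c i)) ⬝ᵥ divDiff A v Q) *ᵥ b := by
  induction Q using Polynomial.induction_on' with
  | add p r hp hr => rw [map_add, add_mulVec, hp, hr, map_add, dotProduct_add, map_add, add_mulVec]
  | monomial k a =>
    rw [bezout_monomial, divDiff_monomial, smul_mulVec, dotProduct_smul, map_smul, smul_mulVec,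
      dotProduct_sum, sum_mulVec, map_sum, sum_mulVec]
    congr 1
    refine Finset.sum_congr rfl fun j _ => ?_
    have : ((fun i => C (c i)) ⬝ᵥ (fun i => C ((A ^ (k - 1 - j) *ᵥ v) i) * X ^ j))
        = C (c ⬝ᵥ (A ^ (k - 1 - j) *ᵥ v)) * X ^ j := by
      simp only [dotProduct, map_sum, Finset.sum_mul, C_mul, mul_assoc]
    rw [this, vecMulVec_mulVec, ← dotProduct_mulVec]
    simp [Algebra.algebraMap_eq_smul_one, smul_mulVec]

/-- Telescoping again. If `Q(A) = 0`, this Sylvester relation intertwines `A` and `Λ` up to an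
output injection, which the filter of the output compensates. -/
theorem bezout_mul (Q : ℝ[X]) :
    bezout Λ b A c Q * A + vecMulVec (aeval Λ Q *ᵥ b) c
      = Λ * bezout Λ b A c Q + vecMulVec b (c ᵥ* aeval A Q) := by
  induction Q using Polynomial.induction_on' with
  | add p r hp hr =>
    simp only [map_add, Matrix.add_mul, Matrix.mul_add, add_mulVec, vecMul_add, vecMulVec_add,
      add_vecMulVec]
    rw [add_add_add_comm, hp, hr, add_add_add_comm]
  | monomial k a =>
    have key : (∑ j ∈ Finset.range k, vecMulVec (Λ ^ j *ᵥ b) (c ᵥ* A ^ (k - 1 - j))) * A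
        + vecMulVec (Λ ^ k *ᵥ b) c
        = Λ * (∑ j ∈ Finset.range k, vecMulVec (Λ ^ j *ᵥ b) (c ᵥ* A ^ (k - 1 - j)))
        + vecMulVec b (c ᵥ* A ^ k) := by
      rw [Matrix.sum_mul, Matrix.mul_sum]
      have h1 : ∀ j ∈ Finset.range k, vecMulVec (Λ ^ j *ᵥ b) (c ᵥ* A ^ (k - 1 - j)) * A
          = vecMulVec (Λ ^ j *ᵥ b) (c ᵥ* A ^ (k - j)) := by
        intro j hj
        have hj := Finset.mem_range.1 hj
        rw [vecMulVec_mul, vecMul_vecMul, ← pow_succ]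
        congr 3
        omega
      have h2 : ∀ j ∈ Finset.range k, Λ * vecMulVec (Λ ^ j *ᵥ b) (c ᵥ* A ^ (k - 1 - j))
          = vecMulVec (Λ ^ (j + 1) *ᵥ b) (c ᵥ* A ^ (k - (j + 1))) := by
        intro j _
        rw [mul_vecMulVec, mulVec_mulVec, ← pow_succ', Nat.sub_sub, add_comm 1 j]
      rw [Finset.sum_congr rfl h1, Finset.sum_congr rfl h2]
      have h3 := Finset.sum_range_sub
        (fun j => vecMulVec (Λ ^ j *ᵥ b) (c ᵥ* A ^ (k - j))) k
      rw [Finset.sum_sub_distrib] at h3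
      simp only [pow_zero, one_mulVec, Nat.sub_zero, Nat.sub_self, vecMul_one] at h3
      rw [sub_eq_sub_iff_add_eq_add] at h3
      rw [add_comm, ← h3, add_comm]
    rw [bezout_monomial, aeval_monomial, aeval_monomial]
    simp only [Algebra.algebraMap_eq_smul_one, Matrix.smul_mul, one_mul, Matrix.mul_smul, smul_mulVec,
      vecMul_smul, smul_vecMulVec, vecMulVec_smul, ← smul_add, key]

/-- `ψ` kills `Λ ^ i b` for `i < q - 1`, so only the two top coefficients of the numerator survive;
they bring in `cᵀ A v`, the drift of the output derivative. For `q = 0` there is no second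
coefficient and `Q(A) = 0` takes its place. -/
theorem dotProduct_bezout_mulVec {Λ b} {ψ : Fin q → ℝ} (hψ : IsFlatOutput Λ b ψ) {Q : ℝ[X]}
    (hQ : Q.Monic) (hdeg : Q.natDegree = q + 1) (hA : aeval A Q = 0) :
    ψ ⬝ᵥ (bezout Λ b A c Q *ᵥ v)
      = c ⬝ᵥ (A *ᵥ v) + (ψ ⬝ᵥ (Λ ^ q *ᵥ b) + Q.coeff q) * (c ⬝ᵥ v) := by
  rw [bezout_mulVec, aeval_eq_sum_range'
    (Nat.lt_succ_of_le (natDegree_dotProduct_divDiff_le A c v hdeg.le)), Finset.sum_range_succ,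
    add_mulVec, dotProduct_add, coeff_dotProduct_divDiff_top A c v hQ hdeg, smul_mulVec,
    dotProduct_smul, smul_eq_mul, sum_mulVec, dotProduct_sum]
  cases q with
  | zero =>
    have h1 : Q.coeff 1 = 1 := by rw [← hQ.coeff_natDegree, hdeg]
    rw [aeval_eq_sum_range' (n := 2) (by omega)] at hA
    simp only [Finset.sum_range_succ, Finset.range_zero, Finset.sum_empty, zero_add, pow_zero,
      pow_one, h1, one_smul] at hA
    have h2 := congrArg (fun M => c ⬝ᵥ (M *ᵥ v)) hA
    simp only [add_mulVec, dotProduct_add, smul_mulVec, one_mulVec, dotProduct_smul, zero_mulVec,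
      dotProduct_zero, smul_eq_mul] at h2
    simp only [Finset.range_zero, Finset.sum_empty]
    linear_combination -h2
  | succ k =>
    rw [Finset.sum_eq_single_of_mem k (by simp)]
    · rw [smul_mulVec, dotProduct_smul, hψ k (by omega), if_pos rfl,
        coeff_dotProduct_divDiff_next A c v hQ hdeg]
      simp only [smul_eq_mul]
      ring
    · intro i hi hik
      rw [smul_mulVec, dotProduct_smul, hψ i (Finset.mem_range.1 hi), if_neg (by omega)]
      simp

end Bezout

theorem aeval_mul_self_comm {q : ℕ} (Λ : Matrix (Fin q) (Fin q) ℝ) (p : ℝ[X]) :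
    aeval Λ p * Λ = Λ * aeval Λ p := by
  have h : aeval Λ (p * X) = aeval Λ (X * p) := by rw [mul_comm]
  simpa using h

/-- The relation `Q(d/dt) y = N(d/dt) u`, filtered by `1 / λ`: all inputs cancel and only initial
conditions remain, moving freely under `Λ`. -/
theorem HasDerivOff.bezout {q d : ℕ} {Λ : Matrix (Fin q) (Fin q) ℝ} {b : Fin q → ℝ}
    {A : Matrix (Fin d) (Fin d) ℝ} {c : Fin d → ℝ} {Q N : ℝ[X]} {s : Set ℝ} {T : ℝ}
    {x g : ℝ → Fin d → ℝ} {wy wu : ℝ → Fin q → ℝ} {u : ℝ → ℝ} (hQ : aeval A Q = 0)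
    (hx : HasDerivOff s T x (fun t => A *ᵥ x t + g t))
    (hy : HasDerivOff s T wy (fun t => Λ *ᵥ wy t + (c ⬝ᵥ x t) • b))
    (hu : HasDerivOff s T wu (fun t => Λ *ᵥ wu t + u t • b))
    (hg : ∀ t, _root_.bezout Λ b A c Q *ᵥ g t = u t • (aeval Λ N *ᵥ b)) :
    HasDerivOff s T
      (fun t => _root_.bezout Λ b A c Q *ᵥ x t + aeval Λ Q *ᵥ wy t - aeval Λ N *ᵥ wu t)
      (fun t => Λ *ᵥ (_root_.bezout Λ b A c Q *ᵥ x t + aeval Λ Q *ᵥ wy t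
        - aeval Λ N *ᵥ wu t)) := by
  refine (((hx.mulVec (_root_.bezout Λ b A c Q)).add (hy.mulVec (aeval Λ Q))).sub
    (hu.mulVec (aeval Λ N))).congr fun t _ _ => ?_
  have h1 := congrArg (fun M => M *ᵥ x t) (bezout_mul Λ b A c Q)
  simp only [hQ, vecMul_zero, add_mulVec, vecMulVec_mulVec, zero_dotProduct, MulOpposite.op_zero,
    zero_smul, add_zero, ← mulVec_mulVec] at h1
  have h2 : (MulOpposite.op (c ⬝ᵥ x t)) • (aeval Λ Q *ᵥ b) = (c ⬝ᵥ x t) • (aeval Λ Q *ᵥ b) := by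
    simp
  rw [h2] at h1
  simp only [mulVec_add, mulVec_sub, mulVec_smul, hg, mulVec_mulVec, aeval_mul_self_comm]
  simp only [← mulVec_mulVec] at h1 ⊢
  rw [← h1]
  abel

/-! ### The matching gain and the error model. -/

/-- The standing assumptions of the adaptive loop. -/
structure IsAdmissibleLoop {n m : ℕ} (S : LoopData n m) (Z P Zm Pm : ℝ[X]) : Prop where
  Z_monic : Z.Monic
  Z_deg : Z.natDegree + 1 = n
  plant : IsRealization S.Ap S.bp S.cp Z P
  Z_hurwitz : IsHurwitzPoly Z
  kp_ne : S.kp ≠ 0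
  Zm_monic : Zm.Monic
  Zm_deg : Zm.natDegree + 1 = m
  ref : IsRealization S.Am S.bm S.cm Zm Pm
  Pm_hurwitz : IsHurwitzPoly Pm
  Lam_hurwitz : IsHurwitzPoly S.Lam.charpoly
  Lam_ctrb : IsControllablePair S.Lam S.blam
  Zm_dvd : Zm ∣ S.Lam.charpoly
  gam_pos : 0 < S.gam
  spr : IsSPR Zm (Pm + tfNum S.Am S.ell S.cm)

/-- `σ` solves the closed loop on `[0, T]`, with the differential equations required on `(0, T)`
off the set `s`. -/
structure IsPartialSolution {n m : ℕ} (S : LoopData n m) (r : ℝ → ℝ) (s : Set ℝ) (T : ℝ)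
    (σ : Signals n m) : Prop where
  plant : HasDerivOff s T σ.xp (fun t => S.Ap *ᵥ σ.xp t + σ.u S r t • S.bp)
  filter1 : HasDerivOff s T σ.w1 (fun t => S.Lam *ᵥ σ.w1 t + σ.u S r t • S.blam)
  filter2 : HasDerivOff s T σ.w2 (fun t => S.Lam *ᵥ σ.w2 t + σ.y S t • S.blam)
  adapt : HasDerivOff s T σ.th
    (fun t => -(S.gam * Real.sign S.kp * σ.ey S t) • σ.reg S r t)
  refModel : HasDerivOff s T σ.xm
    (fun t => S.Am *ᵥ σ.xm t + (S.km * r t) • S.bm + σ.ey S t • S.ell)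

theorem tfNum_eq_dotProduct_divDiff {d : ℕ} (A : Matrix (Fin d) (Fin d) ℝ) (b c : Fin d → ℝ) :
    tfNum A b c = (fun i => C (c i)) ⬝ᵥ divDiff A b A.charpoly := by
  rw [← one_mul A.charpoly, dotProduct_divDiff_mul_charpoly, one_mul]

theorem coeff_tfNum {d : ℕ} (A : Matrix (Fin (d + 1)) (Fin (d + 1)) ℝ)
    (b c : Fin (d + 1) → ℝ) : (tfNum A b c).coeff d = c ⬝ᵥ b := by
  rw [tfNum_eq_dotProduct_divDiff]
  exact coeff_dotProduct_divDiff_top A c b A.charpoly_monic (by simp)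

theorem monic_add_of_natDegree_le {p r : ℝ[X]} {k : ℕ} (hp : p.Monic) (hk : p.natDegree = k + 1)
    (hr : r.natDegree ≤ k) : (p + r).Monic ∧ (p + r).natDegree = k + 1 := by
  have hlt : r.degree < p.degree := by
    rw [degree_eq_natDegree hp.ne_zero, hk]
    exact degree_le_natDegree.trans_lt (by exact_mod_cast Nat.lt_succ_of_le hr)
  exact ⟨hp.add_of_left hlt, by rw [natDegree_add_eq_left_of_degree_lt hlt, hk]⟩

namespace IsAdmissibleLoop

variable {n m : ℕ} {S : LoopData n m} {Z P Zm Pm : ℝ[X]}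

theorem cp_dotProduct_bp (h : IsAdmissibleLoop S Z P Zm Pm) : S.cp ⬝ᵥ S.bp = 1 := by
  obtain ⟨d, rfl⟩ : ∃ d, n = d + 1 := ⟨_, h.Z_deg.symm⟩
  rw [← coeff_tfNum S.Ap, h.plant.2]
  have h1 := h.Z_deg
  have : d = Z.natDegree := by omega
  rw [this]
  exact h.Z_monic.coeff_natDegree

theorem cm_dotProduct_bm (h : IsAdmissibleLoop S Z P Zm Pm) : S.cm ⬝ᵥ S.bm = 1 := by
  obtain ⟨d, rfl⟩ : ∃ d, m = d + 1 := ⟨_, h.Zm_deg.symm⟩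
  rw [← coeff_tfNum S.Am, h.ref.2]
  have h1 := h.Zm_deg
  have : d = Zm.natDegree := by omega
  rw [this]
  exact h.Zm_monic.coeff_natDegree

/-- The error transfer function in the coordinates of the filter `Λ`. -/
theorem exists_error_polynomial (h : IsAdmissibleLoop S Z P Zm Pm) :
    ∃ κ : ℝ[X], S.Lam.charpoly = κ * Zm ∧ (κ * Pm).Monic ∧ (κ * Pm).natDegree = n - 1 + 1 ∧
      (κ * tfNum S.Am S.ell S.cm).natDegree ≤ n - 1 ∧
      (κ * tfNum S.Am S.ell S.cm).coeff (n - 1) = S.cm ⬝ᵥ S.ell ∧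
      ∃ δ : ℝ, 0 < δ ∧ ∀ ω : ℝ, δ * ‖aeval (ω * Complex.I : ℂ) S.Lam.charpoly‖ ^ 2 ≤
        ((starRingEnd ℂ) (aeval (ω * Complex.I : ℂ) S.Lam.charpoly) *
          aeval (ω * Complex.I : ℂ) (κ * Pm + κ * tfNum S.Am S.ell S.cm)).re := by
  obtain ⟨κ, hκ⟩ := h.Zm_dvd
  have hκm : κ.Monic := h.Zm_monic.of_mul_monic_left (hκ ▸ S.Lam.charpoly_monic)
  have hPm : S.Am.charpoly = Pm := h.ref.1
  have hPm_monic : Pm.Monic := hPm ▸ S.Am.charpoly_monic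
  have hPm_deg : Pm.natDegree = m := by rw [← hPm]; simp
  have hdeg : Zm.natDegree + κ.natDegree = n - 1 := by
    rw [← h.Zm_monic.natDegree_mul hκm, ← hκ]; simp
  have hm := h.Zm_deg
  have hQm : (κ * Pm).Monic := hκm.mul hPm_monic
  have hQd : (κ * Pm).natDegree = n - 1 + 1 := by
    rw [hκm.natDegree_mul hPm_monic]; omega
  have hN : (fun i => C (S.cm i)) ⬝ᵥ divDiff S.Am S.ell (κ * Pm) = κ * tfNum S.Am S.ell S.cm := by
    rw [← hPm, dotProduct_divDiff_mul_charpoly]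
  refine ⟨κ, by rw [hκ, mul_comm], hQm, hQd, ?_, ?_, ?_⟩
  · rw [← hN]; exact natDegree_dotProduct_divDiff_le _ _ _ hQd.le
  · rw [← hN]; exact coeff_dotProduct_divDiff_top _ _ _ hQm hQd
  · have hZmH : IsHurwitzPoly Zm := fun z hz => h.Lam_hurwitz z (by rw [hκ, map_mul, hz, zero_mul])
    have hDe : (Pm + tfNum S.Am S.ell S.cm).Monic ∧
        (Pm + tfNum S.Am S.ell S.cm).natDegree = Zm.natDegree + 1 := by
      refine monic_add_of_natDegree_le hPm_monic (by omega) ?_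
      rw [tfNum_eq_dotProduct_divDiff]
      exact natDegree_dotProduct_divDiff_le _ _ _ (by rw [hPm]; omega)
    obtain ⟨δ, hδ, hre⟩ := h.spr.exists_re_mul_conj_ge h.Zm_monic hDe.1 hDe.2 hZmH
    refine ⟨δ, hδ, fun ω => ?_⟩
    -- The common factor `κ` of `λ` and `D` multiplies both sides by `|κ(iω)|²`.
    have h1 := mul_le_mul_of_nonneg_left (hre ω)
      (sq_nonneg ‖aeval (ω * Complex.I : ℂ) κ‖)
    rw [← Complex.re_ofReal_mul, ← Complex.normSq_eq_norm_sq, ← Complex.mul_conj] at h1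
    rw [hκ]
    convert! h1 using 1
    · rw [map_mul, norm_mul, Complex.normSq_eq_norm_sq]; ring
    · congr 1
      simp only [map_mul, map_add]
      ring

/-- With the ideal gain `θ*`, the model following error obeys a filter driven by the parameter
error and by a free motion of the filter dynamics. -/
theorem exists_error_model (h : IsAdmissibleLoop S Z P Zm Pm) :
    ∃ (ψ : Fin (n - 1) → ℝ) (D : ℝ[X]) (δ : ℝ) (θ : GainIdx n → ℝ) (c : ℝ),
      IsFlatOutput S.Lam S.blam ψ ∧ D.Monic ∧ D.natDegree = n - 1 + 1 ∧ 0 < δ ∧ 0 ≤ c ∧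
      (∀ ω : ℝ, δ * ‖aeval (ω * Complex.I : ℂ) S.Lam.charpoly‖ ^ 2 ≤
        ((starRingEnd ℂ) (aeval (ω * Complex.I : ℂ) S.Lam.charpoly) *
          aeval (ω * Complex.I : ℂ) D).re) ∧
      ∀ (r : ℝ → ℝ) (s : Set ℝ) (T : ℝ) (σ : Signals n m) (we : ℝ → Fin (n - 1) → ℝ),
        IsPartialSolution S r s T σ → we 0 = 0 →
        HasDerivOff s T we (fun t => S.Lam *ᵥ we t + σ.ey S t • S.blam) →
        ∃ η : ℝ → Fin (n - 1) → ℝ, HasDerivOff s T η (fun t => S.Lam *ᵥ η t) ∧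
          ‖η 0‖ ≤ c * (‖σ.xp 0‖ + ‖σ.w1 0‖ + ‖σ.w2 0‖ + ‖σ.xm 0‖) ∧
          HasDerivOff s T (σ.ey S) (fun t => S.kp * ((σ.th t - θ) ⬝ᵥ σ.reg S r t) + ψ ⬝ᵥ η t
            - (D.coeff (n - 1) + ψ ⬝ᵥ (S.Lam ^ (n - 1) *ᵥ S.blam)) * σ.ey S t
            - ψ ⬝ᵥ (aeval S.Lam D *ᵥ we t)) := by
  obtain ⟨ψ, hψ⟩ := h.Lam_ctrb.exists_isFlatOutput
  obtain ⟨κ, hκ, hQm, hQd, hNd, hNc, δ, hδ, hre⟩ := h.exists_error_polynomial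
  set Q := κ * Pm with hQ
  set N := κ * tfNum S.Am S.ell S.cm with hN
  obtain ⟨hDm, hDd⟩ := monic_add_of_natDegree_le hQm hQd hNd
  have hP : S.Ap.charpoly = P := h.plant.1
  have hPm : S.Am.charpoly = Pm := h.ref.1
  have hn := h.Z_deg
  have hP_monic : P.Monic := hP ▸ S.Ap.charpoly_monic
  have hP_deg : P.natDegree = n - 1 + 1 := by rw [← hP]; simp; omega
  have hPA : aeval S.Ap P = 0 := by rw [← hP]; exact S.Ap.aeval_self_charpoly
  have hQA : aeval S.Am Q = 0 := by
    rw [hQ, map_mul, ← hPm, S.Am.aeval_self_charpoly, mul_zero]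
  set Tp := bezout S.Lam S.blam S.Ap S.cp P with hTp
  set Tm := bezout S.Lam S.blam S.Am S.cm Q with hTm
  have hTpb : Tp *ᵥ S.bp = aeval S.Lam Z *ᵥ S.blam := by
    rw [hTp, bezout_mulVec, ← hP, ← tfNum_eq_dotProduct_divDiff, h.plant.2]
  -- The numerator belonging to `b_m` is `κ Z_m = λ`, which annihilates `Λ`. This is where
  -- divisibility of `λ` by `Z_m` removes the reference from the model's filter relation.
  have hTmb : Tm *ᵥ S.bm = 0 := by
    rw [hTm, bezout_mulVec, hQ, ← hPm, dotProduct_divDiff_mul_charpoly, h.ref.2, ← hκ,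
      S.Lam.aeval_self_charpoly, zero_mulVec]
  have hTml : Tm *ᵥ S.ell = aeval S.Lam N *ᵥ S.blam := by
    rw [hTm, bezout_mulVec, hQ, ← hPm, dotProduct_divDiff_mul_charpoly]
  have hkp := h.kp_ne
  -- The ideal gain: the `ω₁` part cancels the plant zeros, the `y` and `ω₂` parts replace `P` by
  -- `Q`, and the `r` part adjusts the gain to `k_m`.
  let θ : GainIdx n → ℝ := Sum.elim (fun _ => S.km / S.kp)
    (Sum.elim (-(ψ ᵥ* aeval S.Lam Z)) (Sum.elim (fun _ => (P.coeff (n - 1) - Q.coeff (n - 1)) / S.kp)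
      (S.kp⁻¹ • (ψ ᵥ* aeval S.Lam P - ψ ᵥ* aeval S.Lam Q))))
  obtain ⟨c1, hc1, hb1⟩ := exists_norm_mulVec_le (S.kp • Tp)
  obtain ⟨c2, hc2, hb2⟩ := exists_norm_mulVec_le (aeval S.Lam P - aeval S.Lam Q)
  obtain ⟨c3, hc3, hb3⟩ := exists_norm_mulVec_le (S.kp • aeval S.Lam Z)
  obtain ⟨c4, hc4, hb4⟩ := exists_norm_mulVec_le Tm
  refine ⟨ψ, Q + N, δ, θ, c1 + c2 + c3 + c4, hψ, hDm, hDd, hδ, by positivity, hre, ?_⟩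
  intro r s T σ we hσ hwe0 hwe
  -- The filtered signals are already available: `ω₂ / k_p` is the filter of `c_pᵀ x_p`, and `ω₂ -
  -- w_e` that of `y_m`.
  have hηp := HasDerivOff.bezout (c := S.cp) (Q := P) (N := Z) (b := S.blam)
    (wy := fun t => S.kp⁻¹ • σ.w2 t) (u := σ.u S r) hPA hσ.plant
    ((hσ.filter2.clm (S.kp⁻¹ • ContinuousLinearMap.id ℝ _)).congr (by
      intro t _ _
      simp [Signals.y, mulVec_smul, smul_smul, hkp]))
    hσ.filter1 (by intro t; rw [mulVec_smul, ← hTp, hTpb])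
  have hηm := HasDerivOff.bezout (c := S.cm) (Q := Q) (N := N) (b := S.blam)
    (wy := fun t => σ.w2 t - we t) (u := σ.ey S) hQA
    (hσ.refModel.congr (g' := fun t => S.Am *ᵥ σ.xm t
      + ((S.km * r t) • S.bm + σ.ey S t • S.ell)) (by intro t _ _; rw [add_assoc]))
    ((hσ.filter2.sub hwe).congr (by
      intro t _ _
      rw [mulVec_sub, add_sub_add_comm, ← sub_smul]
      congr 2
      simp [Signals.ey, Signals.ym]))
    hwe (by
      intro t
      rw [← hTm, mulVec_add, mulVec_smul, mulVec_smul, hTmb, hTml, smul_zero, zero_add])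
  rw [← hTp] at hηp
  rw [← hTm] at hηm
  have hη := (hηp.clm (S.kp • ContinuousLinearMap.id ℝ _)).sub hηm
  refine ⟨_, hη.congr (fun t _ _ => ?_), ?_, ?_⟩
  · simp only [_root_.smul_apply, ContinuousLinearMap.id_apply, mulVec_sub S.Lam,
      mulVec_smul]
  · have h0 : (S.kp • ContinuousLinearMap.id ℝ (Fin (n - 1) → ℝ)) (Tp *ᵥ σ.xp 0
        + aeval S.Lam P *ᵥ (S.kp⁻¹ • σ.w2 0) - aeval S.Lam Z *ᵥ σ.w1 0)
        - (Tm *ᵥ σ.xm 0 + aeval S.Lam Q *ᵥ (σ.w2 0 - we 0) - aeval S.Lam N *ᵥ we 0)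
        = (S.kp • Tp) *ᵥ σ.xp 0 + (aeval S.Lam P - aeval S.Lam Q) *ᵥ σ.w2 0
          - (S.kp • aeval S.Lam Z) *ᵥ σ.w1 0 - Tm *ᵥ σ.xm 0 := by
      simp only [_root_.smul_apply, ContinuousLinearMap.id_apply, hwe0, sub_zero,
        mulVec_zero, smul_sub, smul_add, mulVec_smul, smul_smul, mul_inv_cancel₀ hkp, one_smul,
        smul_mulVec, sub_mulVec]
      abel
    rw [h0]
    have e1 := norm_sub_le ((S.kp • Tp) *ᵥ σ.xp 0 + (aeval S.Lam P - aeval S.Lam Q) *ᵥ σ.w2 0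
          - (S.kp • aeval S.Lam Z) *ᵥ σ.w1 0) (Tm *ᵥ σ.xm 0)
    have e2 := norm_sub_le ((S.kp • Tp) *ᵥ σ.xp 0 + (aeval S.Lam P - aeval S.Lam Q) *ᵥ σ.w2 0)
          ((S.kp • aeval S.Lam Z) *ᵥ σ.w1 0)
    have e3 := norm_add_le ((S.kp • Tp) *ᵥ σ.xp 0) ((aeval S.Lam P - aeval S.Lam Q) *ᵥ σ.w2 0)
    have f1 := hb1 (σ.xp 0)
    have f2 := hb2 (σ.w2 0)
    have f3 := hb3 (σ.w1 0)
    have f4 := hb4 (σ.xm 0)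
    have g1 := norm_nonneg (σ.xp 0)
    have g2 := norm_nonneg (σ.w1 0)
    have g3 := norm_nonneg (σ.w2 0)
    have g4 := norm_nonneg (σ.xm 0)
    nlinarith [mul_nonneg hc1 g2, mul_nonneg hc1 g3, mul_nonneg hc1 g4, mul_nonneg hc2 g1,
      mul_nonneg hc2 g2, mul_nonneg hc2 g4, mul_nonneg hc3 g1, mul_nonneg hc3 g3,
      mul_nonneg hc3 g4, mul_nonneg hc4 g1, mul_nonneg hc4 g2, mul_nonneg hc4 g3]
  · have hy := (hσ.plant.const_dotProduct S.cp).const_mul S.kp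
    have hym := hσ.refModel.const_dotProduct S.cm
    refine (hy.sub hym).congr fun t _ _ => ?_
    have k1 := dotProduct_bezout_mulVec S.Ap S.cp (σ.xp t) hψ hP_monic hP_deg hPA
    have k2 := dotProduct_bezout_mulVec S.Am S.cm (σ.xm t) hψ hQm hQd hQA
    rw [← hTp] at k1
    rw [← hTm] at k2
    have k3 : σ.u S r t = (σ.th t - θ) ⬝ᵥ σ.reg S r t + θ ⬝ᵥ σ.reg S r t := by
      rw [← add_dotProduct, sub_add_cancel]; rfl
    have k4 : S.kp * (θ ⬝ᵥ σ.reg S r t) = S.km * r t - S.kp * (ψ ⬝ᵥ (aeval S.Lam Z *ᵥ σ.w1 t))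
        + (P.coeff (n - 1) - Q.coeff (n - 1)) * σ.y S t
        + (ψ ⬝ᵥ (aeval S.Lam P *ᵥ σ.w2 t) - ψ ⬝ᵥ (aeval S.Lam Q *ᵥ σ.w2 t)) := by
      simp only [θ, Signals.reg, dotProduct, Fintype.sum_sum_type, Sum.elim_inl, Sum.elim_inr,
        Finset.univ_unique, Finset.sum_singleton]
      simp only [← dotProduct.eq_1]
      rw [neg_dotProduct, smul_dotProduct, sub_dotProduct, ← dotProduct_mulVec, ← dotProduct_mulVec,
        ← dotProduct_mulVec]
      simp only [smul_eq_mul]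
      field_simp
      ring
    have k5 : S.cp ⬝ᵥ S.bp = 1 := h.cp_dotProduct_bp
    have k6 : S.cm ⬝ᵥ S.bm = 1 := h.cm_dotProduct_bm
    have k7 : σ.y S t = S.kp * (S.cp ⬝ᵥ σ.xp t) := rfl
    have k8 : σ.ey S t = σ.y S t - S.cm ⬝ᵥ σ.xm t := rfl
    have k9 : (Q + N).coeff (n - 1) = Q.coeff (n - 1) + S.cm ⬝ᵥ S.ell := by rw [coeff_add, hNc]
    rw [k9]
    simp only [_root_.smul_apply, ContinuousLinearMap.id_apply, dotProduct_sub,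
      dotProduct_add, dotProduct_smul, smul_eq_mul, map_add, add_mulVec, mulVec_sub, mulVec_smul,
      k1, k2, k5, k6, mul_one]
    have hinv : S.kp * (S.kp⁻¹ * (ψ ⬝ᵥ (aeval S.Lam P *ᵥ σ.w2 t)))
        = ψ ⬝ᵥ (aeval S.Lam P *ᵥ σ.w2 t) := by field_simp
    rw [k3]
    rw [k7] at k4 k8
    rw [k8]
    linear_combination k4 - hinv
end IsAdmissibleLoop

/-! ### The Lyapunov function. -/

theorem exists_ey_initial_bound {n m : ℕ} (S : LoopData n m) :
    ∃ k : ℝ, 0 ≤ k ∧ ∀ (σ : Signals n m) (R t : ℝ), ‖σ.xp t‖ ≤ R → ‖σ.xm t‖ ≤ R →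
      |σ.ey S t| ≤ k * R := by
  obtain ⟨k1, hk1, h1⟩ := exists_norm_dotProduct_le S.cp
  obtain ⟨k2, hk2, h2⟩ := exists_norm_dotProduct_le S.cm
  refine ⟨|S.kp| * k1 + k2, by positivity, fun σ R t hp hm => ?_⟩
  have e1 := (h1 (σ.xp t)).trans (mul_le_mul_of_nonneg_left hp hk1)
  have e2 := (h2 (σ.xm t)).trans (mul_le_mul_of_nonneg_left hm hk2)
  have e3 : |σ.ey S t| ≤ |S.kp| * |S.cp ⬝ᵥ σ.xp t| + |S.cm ⬝ᵥ σ.xm t| := by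
    rw [← abs_mul]
    exact abs_sub _ _
  nlinarith [mul_le_mul_of_nonneg_left e1 (abs_nonneg S.kp)]

theorem sq_norm_le_dotProduct_self {ι : Type*} [Fintype ι] (v : ι → ℝ) : ‖v‖ ^ 2 ≤ v ⬝ᵥ v := by
  have h0 : 0 ≤ v ⬝ᵥ v := Finset.sum_nonneg fun i _ => mul_self_nonneg _
  have : ‖v‖ ≤ √(v ⬝ᵥ v) := by
    rw [pi_norm_le_iff_of_nonneg (Real.sqrt_nonneg _)]
    intro i
    rw [Real.norm_eq_abs]
    refine Real.abs_le_sqrt ?_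
    rw [pow_two]
    exact Finset.single_le_sum (f := fun i => v i * v i) (fun i _ => mul_self_nonneg _)
      (Finset.mem_univ i)
  calc ‖v‖ ^ 2 ≤ √(v ⬝ᵥ v) ^ 2 := pow_le_pow_left₀ (norm_nonneg _) this 2
    _ = _ := Real.sq_sqrt h0

theorem dotProduct_self_le {ι : Type*} [Fintype ι] (v : ι → ℝ) :
    v ⬝ᵥ v ≤ Fintype.card ι * ‖v‖ ^ 2 := by
  have : ∀ i ∈ Finset.univ, v i * v i ≤ ‖v‖ ^ 2 := by
    intro i _
    rw [← pow_two, ← sq_abs]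
    exact pow_le_pow_left₀ (abs_nonneg _) (norm_le_pi_norm v i) 2
  have h := Finset.sum_le_card_nsmul _ _ _ this
  simpa [dotProduct] using h

theorem abs_dotProduct_le {ι : Type*} [Fintype ι] (v w : ι → ℝ) :
    |v ⬝ᵥ w| ≤ Fintype.card ι * (‖v‖ * ‖w‖) := by
  refine (Finset.abs_sum_le_sum_abs _ _).trans ?_
  have : ∀ i ∈ Finset.univ, |v i * w i| ≤ ‖v‖ * ‖w‖ := by
    intro i _
    rw [abs_mul]
    exact mul_le_mul (norm_le_pi_norm v i) (norm_le_pi_norm w i) (abs_nonneg _) (norm_nonneg _)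
  simpa using Finset.sum_le_card_nsmul _ _ _ this

namespace IsAdmissibleLoop

variable {n m : ℕ} {S : LoopData n m} {Z P Zm Pm : ℝ[X]}

/-- A Lyapunov function `F` of the error, the error filter and the gain, decreasing along all
trajectories whose initial states are bounded by `R`. -/
theorem exists_lyapunov (h : IsAdmissibleLoop S Z P Zm Pm) (R : ℝ) :
    ∃ (F : ℝ → (Fin (n - 1) → ℝ) → (GainIdx n → ℝ) → ℝ → ℝ) (c B₀ B : ℝ), 0 < c ∧
      (∀ e w θ t, 0 ≤ F e w θ t) ∧
      (∀ e w θ t, F e w θ t ≤ B₀ → |e| ≤ B ∧ ‖θ‖ ≤ B) ∧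
      ∀ (r : ℝ → ℝ) (s : Set ℝ) (T : ℝ) (σ : Signals n m) (we : ℝ → Fin (n - 1) → ℝ),
        s.Finite → IsPartialSolution S r s T σ → ‖σ.xp 0‖ ≤ R → ‖σ.w1 0‖ ≤ R → ‖σ.w2 0‖ ≤ R →
        ‖σ.th 0‖ ≤ R → ‖σ.xm 0‖ ≤ R → we 0 = 0 →
        HasDerivOff s T we (fun t => S.Lam *ᵥ we t + σ.ey S t • S.blam) →
        F (σ.ey S 0) (we 0) (σ.th 0) 0 ≤ B₀ ∧
        ∃ W', HasDerivOff s T (fun t => F (σ.ey S t) (we t) (σ.th t) t) W' ∧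
          ∀ t ∈ Ioo 0 T, t ∉ s → W' t ≤ -c * σ.ey S t ^ 2 := by
  obtain ⟨ψ, D, δ, θ, c, hψ, hDm, hDd, hδ, hc, hre, hmodel⟩ := h.exists_error_model
  obtain ⟨K, hK, hdiss⟩ := hψ.exists_storage h.Lam_hurwitz hDm hDd hre
  obtain ⟨Kd, α, hKd, hα, hdecay⟩ := exists_exp_decay_of_isHurwitzPoly S.Lam
    S.Lam.charpoly_monic h.Lam_hurwitz S.Lam.aeval_self_charpoly
  obtain ⟨kψ, hkψ, hkψb⟩ := exists_norm_dotProduct_le ψ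
  obtain ⟨ke, hke, hkeb⟩ := exists_ey_initial_bound S
  have hγ := h.gam_pos
  have hkp := h.kp_ne
  -- This weight makes the adaptation law cancel the term `k_p e_y (θ - θ*)ᵀ ω`.
  set μ := |S.kp| / (2 * S.gam) with hμ
  have hμ0 : 0 < μ := by have := abs_pos.2 hkp; positivity
  -- `A exp (-α t)` dominates the transient `ψ · η`; the factor `4 R` bounds the sum of four initial
  -- norms. `CR` is the weight for which the exponential decreases at the rate `A² exp (-2 α t) / (2
  -- δ)`, the price of the transient after Young's inequality.
  set A := kψ * (Kd * (c * (4 * R))) with hA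
  set CR := A ^ 2 / (4 * α * δ) with hCR
  have hCR0 : 0 ≤ CR := by positivity
  set N : ℝ := (Fintype.card (GainIdx n) : ℝ)
  set B₀ := (ke * R) ^ 2 / 2 + μ * (N * (R + ‖θ‖) ^ 2) + CR with hB₀
  have hB₀0 : 0 ≤ B₀ := by positivity
  refine ⟨fun e w th t => e ^ 2 / 2 + w ⬝ᵥ (K *ᵥ w) + μ * ((th - θ) ⬝ᵥ (th - θ))
    + CR * Real.exp (-(2 * α) * t), δ / 2, B₀, √(2 * B₀) + (√(B₀ / μ) + ‖θ‖), by positivity,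
    ?_, ?_, ?_⟩
  · intro e w th t
    have h1 := hK w
    have h2 : 0 ≤ (th - θ) ⬝ᵥ (th - θ) := (sq_nonneg _).trans (sq_norm_le_dotProduct_self _)
    positivity
  · intro e w th t hF
    have h1 := hK w
    have h2 := sq_norm_le_dotProduct_self (th - θ)
    have h3 : 0 ≤ CR * Real.exp (-(2 * α) * t) := by positivity
    have h4 : 0 ≤ μ * ‖th - θ‖ ^ 2 := by positivity
    have h5 := mul_le_mul_of_nonneg_left h2 hμ0.le
    constructor
    · have : |e| ≤ √(2 * B₀) := Real.abs_le_sqrt (by linarith)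
      linarith [Real.sqrt_nonneg (B₀ / μ), norm_nonneg θ]
    · have h6 : ‖th - θ‖ ≤ √(B₀ / μ) := by
        rw [← abs_of_nonneg (norm_nonneg (th - θ))]
        refine Real.abs_le_sqrt ?_
        rw [le_div_iff₀ hμ0]
        nlinarith [sq_nonneg e]
      have h7 : ‖th‖ ≤ ‖th - θ‖ + ‖θ‖ := by simpa using norm_add_le (th - θ) θ
      linarith [Real.sqrt_nonneg (2 * B₀)]
  · intro r s T σ we hs hσ hp h1 h2 hth hm hwe0 hwe
    obtain ⟨η, hη, hη0, hey⟩ := hmodel r s T σ we hσ hwe0 hwe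
    constructor
    · have e1 := hkeb σ R 0 hp hm
      have e2 : σ.ey S 0 ^ 2 ≤ (ke * R) ^ 2 := by
        rw [← sq_abs]
        exact pow_le_pow_left₀ (abs_nonneg _) e1 2
      have e3 : (σ.th 0 - θ) ⬝ᵥ (σ.th 0 - θ) ≤ N * (R + ‖θ‖) ^ 2 := by
        refine (dotProduct_self_le _).trans ?_
        refine mul_le_mul_of_nonneg_left ?_ (by positivity)
        exact pow_le_pow_left₀ (norm_nonneg _) ((norm_sub_le _ _).trans (by linarith)) 2
      have e4 := mul_le_mul_of_nonneg_left e3 hμ0.le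
      simp only [hwe0, mul_zero, Real.exp_zero, mul_one, zero_dotProduct]
      linarith
    · have d1 := (hey.mul hey).const_mul (1 / 2)
      have d2 := hwe.dotProduct (hwe.mulVec K)
      have hθc : HasDerivOff s T (fun t => σ.th t - θ)
          (fun t => -(S.gam * Real.sign S.kp * σ.ey S t) • σ.reg S r t) :=
        ⟨hσ.adapt.cont.sub continuousOn_const, fun t ht hts => (hσ.adapt.deriv t ht hts).sub_const _⟩
      have d3 := (hθc.dotProduct hθc).const_mul μ
      have d4 : HasDerivOff s T (fun t => CR * Real.exp (-(2 * α) * t))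
          (fun t => CR * (Real.exp (-(2 * α) * t) * (-(2 * α)))) :=
        HasDerivOff.of_hasDerivAt fun t => by
          simpa using (((hasDerivAt_id t).const_mul (-(2 * α))).exp).const_mul CR
      have d5 := ((d1.add d2).add d3).add d4
      have hfun : ∀ t, 1 / 2 * (σ.ey S t * σ.ey S t) = σ.ey S t ^ 2 / 2 := fun t => by ring
      simp only [hfun] at d5
      refine ⟨_, d5, ?_⟩
      · intro t ht hts
        have k1 := hdiss (we t) (σ.ey S t)
        have k2 : μ * (-(S.gam * Real.sign S.kp * σ.ey S t) * (σ.reg S r t ⬝ᵥ (σ.th t - θ))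
            + -(S.gam * Real.sign S.kp * σ.ey S t) * ((σ.th t - θ) ⬝ᵥ σ.reg S r t))
            = -(S.kp * σ.ey S t * ((σ.th t - θ) ⬝ᵥ σ.reg S r t)) := by
          rw [dotProduct_comm (σ.reg S r t)]
          have : |S.kp| * Real.sign S.kp = S.kp := by
            rcases lt_or_gt_of_ne hkp with hneg | hpos
            · rw [abs_of_neg hneg, Real.sign_of_neg hneg]; ring
            · rw [abs_of_pos hpos, Real.sign_of_pos hpos]; ring
          rw [hμ]
          field_simp
          linear_combination (-(2 * σ.ey S t * ((σ.th t - θ) ⬝ᵥ σ.reg S r t))) * this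
        have k3 : |ψ ⬝ᵥ η t| ≤ A * Real.exp (-α * t) := by
          have j1 := hdecay s T η hs hη t (Ioo_subset_Icc_self ht)
          have j2 : ‖η 0‖ ≤ c * (4 * R) := hη0.trans (mul_le_mul_of_nonneg_left (by linarith) hc)
          calc |ψ ⬝ᵥ η t| ≤ kψ * ‖η t‖ := hkψb _
            _ ≤ kψ * (Kd * Real.exp (-α * t) * (c * (4 * R))) :=
                mul_le_mul_of_nonneg_left (j1.trans (mul_le_mul_of_nonneg_left j2 (by positivity)))
                  hkψ
            _ = _ := by rw [hA]; ring
        have k4 : (ψ ⬝ᵥ η t) ^ 2 ≤ A ^ 2 * Real.exp (-(2 * α) * t) := by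
          have j1 := pow_le_pow_left₀ (abs_nonneg _) k3 2
          rw [sq_abs, mul_pow, ← Real.exp_nat_mul] at j1
          convert! j1 using 3
          push_cast; ring
        have k5 : CR * (Real.exp (-(2 * α) * t) * (-(2 * α)))
            = -(A ^ 2 * Real.exp (-(2 * α) * t)) / (2 * δ) := by
          rw [hCR]; field_simp; ring
        have k6 : σ.ey S t * (ψ ⬝ᵥ η t) ≤ δ / 2 * σ.ey S t ^ 2 + (ψ ⬝ᵥ η t) ^ 2 / (2 * δ) := by
          have : δ / 2 * σ.ey S t ^ 2 + (ψ ⬝ᵥ η t) ^ 2 / (2 * δ) - σ.ey S t * (ψ ⬝ᵥ η t)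
            = (δ * σ.ey S t - ψ ⬝ᵥ η t) ^ 2 / (2 * δ) := by field_simp; ring
          have h0 : 0 ≤ (δ * σ.ey S t - ψ ⬝ᵥ η t) ^ 2 / (2 * δ) := by positivity
          linarith
        have k7 : (ψ ⬝ᵥ η t) ^ 2 / (2 * δ) ≤ A ^ 2 * Real.exp (-(2 * α) * t) / (2 * δ) := by
          gcongr
        simp only [smul_dotProduct, dotProduct_smul, smul_eq_mul]
        rw [k2, k5, neg_div]
        -- The storage inequality leaves `-δ e_y²`; the transient consumes half of it, the rest of
        -- its cost being paid by the exponential.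
        nlinarith [k1, k6, k7]

end IsAdmissibleLoop

/-! ### From bounds on the error and the gain to bounds on all signals. -/

namespace Signals

/-- The time derivative of the model following error along the closed loop. -/
def eyDot {n m : ℕ} (σ : Signals n m) (S : LoopData n m) (r : ℝ → ℝ) (t : ℝ) : ℝ :=
  S.kp * (S.cp ⬝ᵥ (S.Ap *ᵥ σ.xp t + σ.u S r t • S.bp))
    - S.cm ⬝ᵥ (S.Am *ᵥ σ.xm t + (S.km * r t) • S.bm + σ.ey S t • S.ell)

end Signals

theorem IsPartialSolution.hasDerivOff_ey {n m : ℕ} {S : LoopData n m} {r : ℝ → ℝ} {s : Set ℝ}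
    {T : ℝ} {σ : Signals n m} (hσ : IsPartialSolution S r s T σ) :
    HasDerivOff s T (σ.ey S) (σ.eyDot S r) :=
  ((hσ.plant.const_dotProduct S.cp).const_mul S.kp).sub (hσ.refModel.const_dotProduct S.cm)

theorem exists_bound_of_isHurwitz_smul {q : ℕ} (A : Matrix (Fin q) (Fin q) ℝ) {p : ℝ[X]}
    (hp : p.Monic) (hH : IsHurwitzPoly p) (hpA : aeval A p = 0) (b b' : Fin q → ℝ) (R B : ℝ) :
    ∃ K : ℝ, ∀ (s : Set ℝ) (T : ℝ) (x : ℝ → Fin q → ℝ) (f g : ℝ → ℝ), s.Finite →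
      HasDerivOff s T x (fun t => A *ᵥ x t + (f t • b + g t • b')) → ‖x 0‖ ≤ R →
      (∀ t ∈ Icc 0 T, |f t| ≤ B) → (∀ t ∈ Icc 0 T, |g t| ≤ B) → ∀ t ∈ Icc 0 T, ‖x t‖ ≤ K := by
  obtain ⟨K, hK, h⟩ := exists_bound_of_isHurwitzPoly A hp hH hpA
  refine ⟨K * (R + (|B| * ‖b‖ + |B| * ‖b'‖)), fun s T x f g hs hx h0 hf hg t ht => ?_⟩
  refine (h s T x _ (|B| * ‖b‖ + |B| * ‖b'‖) hs (by positivity) hx ?_ t ht).trans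
    (mul_le_mul_of_nonneg_left (by linarith) hK)
  intro t ht _
  have h1 := (hf t (Ioo_subset_Icc_self ht)).trans (le_abs_self B)
  have h2 := (hg t (Ioo_subset_Icc_self ht)).trans (le_abs_self B)
  refine (norm_add_le _ _).trans ?_
  rw [norm_smul, norm_smul]
  exact add_le_add (mul_le_mul_of_nonneg_right h1 (norm_nonneg _))
    (mul_le_mul_of_nonneg_right h2 (norm_nonneg _))

namespace IsAdmissibleLoop

variable {n m : ℕ} {S : LoopData n m} {Z P Zm Pm : ℝ[X]}

/-- Since `c_pᵀ b_p = 1`, subtracting `(c_pᵀ x_p) b_p` eliminates `u`. The new vector is orthogonal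
to `c_p`, so the term `b_p c_pᵀ` in the matrix costs nothing; it moves the superfluous eigenvalue
from `0` to `-1`. -/
theorem hasDerivOff_inverse (h : IsAdmissibleLoop S Z P Zm Pm) {r : ℝ → ℝ} {s : Set ℝ} {T : ℝ}
    {σ : Signals n m} (hσ : IsPartialSolution S r s T σ) :
    HasDerivOff s T (fun t => σ.xp t - (S.cp ⬝ᵥ σ.xp t) • S.bp)
      (fun t => (S.Ap - vecMulVec S.bp (S.cp ᵥ* S.Ap + S.cp)) *ᵥ
        (σ.xp t - (S.cp ⬝ᵥ σ.xp t) • S.bp)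
        + ((S.cp ⬝ᵥ σ.xp t) • (S.Ap *ᵥ S.bp - (S.cp ⬝ᵥ (S.Ap *ᵥ S.bp)) • S.bp)
          + (0 : ℝ) • (0 : Fin n → ℝ))) := by
  refine (hσ.plant.sub ((hσ.plant.const_dotProduct S.cp).smul_const S.bp)).congr fun t _ _ => ?_
  have hcb := h.cp_dotProduct_bp
  have hv : ∀ a w : Fin n → ℝ, vecMulVec S.bp a *ᵥ w = (a ⬝ᵥ w) • S.bp := by
    intro a w
    rw [vecMulVec_mulVec]
    simp
  simp only [sub_mulVec, hv, add_dotProduct, mulVec_sub, mulVec_smul,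
    dotProduct_smul, dotProduct_add, hcb, smul_eq_mul, ← dotProduct_mulVec]
  module

/-- The same elimination for the input filter; the equation is driven by `c_pᵀ x_p` and `c_pᵀ A_p
x_p`, so no bound on `u` is needed. -/
theorem hasDerivOff_filter_inverse (h : IsAdmissibleLoop S Z P Zm Pm) {r : ℝ → ℝ} {s : Set ℝ}
    {T : ℝ} {σ : Signals n m} (hσ : IsPartialSolution S r s T σ) :
    HasDerivOff s T (fun t => σ.w1 t - (S.cp ⬝ᵥ σ.xp t) • S.blam)
      (fun t => S.Lam *ᵥ (σ.w1 t - (S.cp ⬝ᵥ σ.xp t) • S.blam)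
        + ((S.cp ⬝ᵥ σ.xp t) • (S.Lam *ᵥ S.blam)
          + (S.cp ⬝ᵥ (S.Ap *ᵥ σ.xp t)) • (-S.blam))) := by
  refine (hσ.filter1.sub ((hσ.plant.const_dotProduct S.cp).smul_const S.blam)).congr
    fun t _ _ => ?_
  simp only [mulVec_sub, mulVec_smul, dotProduct_add, dotProduct_smul, h.cp_dotProduct_bp,
    smul_eq_mul]
  module

/-- Bounds on the error and the gain bound all other signals. -/
theorem exists_bound_of_error_bound (h : IsAdmissibleLoop S Z P Zm Pm) (M R B₁ : ℝ) :
    ∃ B : ℝ, ∀ (r : ℝ → ℝ) (s : Set ℝ) (T : ℝ) (σ : Signals n m), s.Finite →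
      IsPartialSolution S r s T σ → (∀ t ∈ Icc 0 T, |r t| ≤ M) →
      ‖σ.xp 0‖ ≤ R → ‖σ.w1 0‖ ≤ R → ‖σ.w2 0‖ ≤ R → ‖σ.xm 0‖ ≤ R →
      (∀ t ∈ Icc 0 T, |σ.ey S t| ≤ B₁ ∧ ‖σ.th t‖ ≤ B₁) →
      ∀ t ∈ Icc 0 T,
        (‖σ.xp t‖ ≤ B ∧ ‖σ.w1 t‖ ≤ B ∧ ‖σ.w2 t‖ ≤ B ∧ ‖σ.th t‖ ≤ B ∧ ‖σ.xm t‖ ≤ B ∧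
          ‖σ.reg S r t‖ ≤ B ∧ |σ.u S r t| ≤ B ∧
          |σ.y S t| ≤ B ∧ |σ.ym S t| ≤ B ∧ |σ.ey S t| ≤ B) ∧ |σ.eyDot S r t| ≤ B := by
  have hkp := h.kp_ne
  have hPm : S.Am.charpoly = Pm := h.ref.1
  obtain ⟨Bm, hBm⟩ := exists_bound_of_isHurwitz_smul S.Am S.Am.charpoly_monic
    (hPm ▸ h.Pm_hurwitz) S.Am.aeval_self_charpoly S.bm S.ell R (max (|S.km| * M) B₁)
  obtain ⟨kcm, hkcm, hkcmb⟩ := exists_norm_dotProduct_le S.cm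
  set By := B₁ + kcm * Bm with hBy
  -- The maximum with `0` lets the same bound cover the absent second input, taken to be zero.
  obtain ⟨B2, hB2⟩ := exists_bound_of_isHurwitz_smul S.Lam S.Lam.charpoly_monic
    h.Lam_hurwitz S.Lam.aeval_self_charpoly S.blam 0 R (max By 0)
  obtain ⟨kcp, hkcp, hkcpb⟩ := exists_norm_dotProduct_le S.cp
  have hHinv : IsHurwitzPoly (S.Ap - vecMulVec S.bp (S.cp ᵥ* S.Ap + S.cp)).charpoly := by
    rw [charpoly_inverse_dynamics _ _ _ h.cp_dotProduct_bp, h.plant.2]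
    intro z hz
    rw [map_mul, mul_eq_zero] at hz
    rcases hz with hz | hz
    · simp only [map_one, map_add, aeval_X] at hz
      rw [eq_neg_of_add_eq_zero_left hz]
      simp
    · exact h.Z_hurwitz z hz
  obtain ⟨Bw, hBw⟩ := exists_bound_of_isHurwitz_smul
    (S.Ap - vecMulVec S.bp (S.cp ᵥ* S.Ap + S.cp)) (charpoly_monic _) hHinv
    (aeval_self_charpoly _) (S.Ap *ᵥ S.bp - (S.cp ⬝ᵥ (S.Ap *ᵥ S.bp)) • S.bp) 0
    (R + kcp * R * ‖S.bp‖) (max (By / |S.kp|) 0)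
  set Bp := Bw + By / |S.kp| * ‖S.bp‖ with hBp
  obtain ⟨kA, hkA, hkAb⟩ := exists_norm_dotProduct_le (S.cp ᵥ* S.Ap)
  obtain ⟨Bv, hBv⟩ := exists_bound_of_isHurwitz_smul S.Lam S.Lam.charpoly_monic
    h.Lam_hurwitz S.Lam.aeval_self_charpoly (S.Lam *ᵥ S.blam) (-S.blam)
    (R + kcp * R * ‖S.blam‖) (max (By / |S.kp|) (kA * Bp))
  set B1 := Bv + By / |S.kp| * ‖S.blam‖ with hB1
  set Br := max (max M B1) (max By B2) with hBr
  set Bu := (Fintype.card (GainIdx n) : ℝ) * (B₁ * Br) with hBu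
  obtain ⟨kD, hkD, hkDb⟩ := exists_norm_dotProduct_le (S.cm ᵥ* S.Am)
  set Be := |S.kp| * (kA * Bp + Bu) + (kD * Bm + |S.km| * M + B₁ * |S.cm ⬝ᵥ S.ell|) with hBe
  refine ⟨max (max (max (max Bp B1) (max B2 B₁)) (max (max Bm Br) (max Bu By)))
    (max (kcm * Bm) Be), fun r s T σ hs hσ hr hp0 h10 h20 hm0 hB t ht => ?_⟩
  have hM : ∀ t ∈ Icc 0 T, |S.km * r t| ≤ max (|S.km| * M) B₁ := fun t ht => by
    rw [abs_mul]
    exact (mul_le_mul_of_nonneg_left (hr t ht) (abs_nonneg _)).trans (le_max_left _ _)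
  have hxm : ∀ t ∈ Icc 0 T, ‖σ.xm t‖ ≤ Bm :=
    hBm s T σ.xm (fun t => S.km * r t) (σ.ey S) hs
      (hσ.refModel.congr fun t _ _ => by rw [add_assoc]) hm0 hM
      (fun t ht => (hB t ht).1.trans (le_max_right _ _))
  have hym : ∀ t ∈ Icc 0 T, |σ.ym S t| ≤ kcm * Bm := fun t ht =>
    (hkcmb _).trans (mul_le_mul_of_nonneg_left (hxm t ht) hkcm)
  have hy : ∀ t ∈ Icc 0 T, |σ.y S t| ≤ By := fun t ht => by
    have : σ.y S t = σ.ey S t + σ.ym S t := by simp [Signals.ey]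
    rw [this]
    exact (abs_add_le _ _).trans (add_le_add (hB t ht).1 (hym t ht))
  have hw2 : ∀ t ∈ Icc 0 T, ‖σ.w2 t‖ ≤ B2 :=
    hB2 s T σ.w2 (σ.y S) (fun _ => 0) hs (hσ.filter2.congr fun t _ _ => by simp) h20
      (fun t ht => (hy t ht).trans (le_max_left _ _)) (fun t _ => by simp)
  have hcx : ∀ t ∈ Icc 0 T, |S.cp ⬝ᵥ σ.xp t| ≤ By / |S.kp| := fun t ht => by
    rw [le_div_iff₀ (abs_pos.2 hkp), mul_comm, ← abs_mul]
    exact hy t ht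
  have hinit : ∀ {d : ℕ} (x b : Fin d → ℝ), ‖x‖ ≤ R →
      ‖x - (S.cp ⬝ᵥ σ.xp 0) • b‖ ≤ R + kcp * R * ‖b‖ := by
    intro d x b hx
    refine (norm_sub_le _ _).trans (add_le_add hx ?_)
    rw [norm_smul]
    exact mul_le_mul_of_nonneg_right
      ((hkcpb _).trans (mul_le_mul_of_nonneg_left hp0 hkcp)) (norm_nonneg _)
  have hback : ∀ {d : ℕ} (x b : Fin d → ℝ) (K t : ℝ), t ∈ Icc 0 T →
      ‖x - (S.cp ⬝ᵥ σ.xp t) • b‖ ≤ K → ‖x‖ ≤ K + By / |S.kp| * ‖b‖ := by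
    intro d x b K t ht hx
    have e1 : ‖x‖ ≤ ‖x - (S.cp ⬝ᵥ σ.xp t) • b‖ + ‖(S.cp ⬝ᵥ σ.xp t) • b‖ := by
      simpa using norm_add_le (x - (S.cp ⬝ᵥ σ.xp t) • b) ((S.cp ⬝ᵥ σ.xp t) • b)
    refine e1.trans (add_le_add hx ?_)
    rw [norm_smul]
    exact mul_le_mul_of_nonneg_right (hcx t ht) (norm_nonneg _)
  have hxp : ∀ t ∈ Icc 0 T, ‖σ.xp t‖ ≤ Bp := fun t ht =>
    hback _ _ _ t ht (hBw s T _ _ (fun _ => 0) hs (h.hasDerivOff_inverse hσ) (hinit _ _ hp0)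
      (fun t ht => (hcx t ht).trans (le_max_left _ _)) (fun t _ => by simp) t ht)
  have hcA : ∀ t ∈ Icc 0 T, |S.cp ⬝ᵥ (S.Ap *ᵥ σ.xp t)| ≤ kA * Bp := fun t ht => by
    rw [dotProduct_mulVec]
    exact (hkAb _).trans (mul_le_mul_of_nonneg_left (hxp t ht) hkA)
  have hw1 : ∀ t ∈ Icc 0 T, ‖σ.w1 t‖ ≤ B1 := fun t ht =>
    hback _ _ _ t ht (hBv s T _ _ _ hs (h.hasDerivOff_filter_inverse hσ) (hinit _ _ h10)
      (fun t ht => (hcx t ht).trans (le_max_left _ _))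
      (fun t ht => (hcA t ht).trans (le_max_right _ _)) t ht)
  have hreg : ‖σ.reg S r t‖ ≤ Br := by
    have h0 : 0 ≤ Br := (abs_nonneg _).trans
      ((hy t ht).trans ((le_max_left _ _).trans (le_max_right _ _)))
    rw [pi_norm_le_iff_of_nonneg h0]
    rintro (_ | i | _ | i)
    · exact (hr t ht).trans ((le_max_left _ _).trans (le_max_left _ _))
    · exact ((norm_le_pi_norm (σ.w1 t) i).trans (hw1 t ht)).trans
        ((le_max_right _ _).trans (le_max_left _ _))
    · exact (hy t ht).trans ((le_max_left _ _).trans (le_max_right _ _))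
    · exact ((norm_le_pi_norm (σ.w2 t) i).trans (hw2 t ht)).trans
        ((le_max_right _ _).trans (le_max_right _ _))
  have hth := (hB t ht).2
  have hu : |σ.u S r t| ≤ Bu := (abs_dotProduct_le _ _).trans <|
    mul_le_mul_of_nonneg_left (mul_le_mul hth hreg (norm_nonneg _)
      ((norm_nonneg _).trans hth)) (Nat.cast_nonneg _)
  have hdot : |σ.eyDot S r t| ≤ Be := by
    have e1 : σ.eyDot S r t = S.kp * (S.cp ⬝ᵥ (S.Ap *ᵥ σ.xp t) + σ.u S r t)
        - ((S.cm ᵥ* S.Am) ⬝ᵥ σ.xm t + S.km * r t + σ.ey S t * (S.cm ⬝ᵥ S.ell)) := by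
      simp only [Signals.eyDot, dotProduct_add, dotProduct_smul, h.cp_dotProduct_bp,
        h.cm_dotProduct_bm, smul_eq_mul, mul_one, dotProduct_mulVec]
    rw [e1]
    refine (abs_sub _ _).trans (add_le_add ?_ ?_)
    · rw [abs_mul]
      exact mul_le_mul_of_nonneg_left ((abs_add_le _ _).trans (add_le_add (hcA t ht) hu))
        (abs_nonneg _)
    · refine (abs_add_le _ _).trans (add_le_add ((abs_add_le _ _).trans (add_le_add ?_ ?_)) ?_)
      · exact (hkDb _).trans (mul_le_mul_of_nonneg_left (hxm t ht) hkD)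
      · rw [abs_mul]
        exact mul_le_mul_of_nonneg_left (hr t ht) (abs_nonneg _)
      · rw [abs_mul]
        exact mul_le_mul_of_nonneg_right (hB t ht).1 (abs_nonneg _)
  simp only [le_max_iff]
  refine ⟨⟨?_, ?_, ?_, ?_, ?_, ?_, ?_, ?_, ?_, ?_⟩, ?_⟩
  · simp [hxp t ht]
  · simp [hw1 t ht]
  · simp [hw2 t ht]
  · simp [hth]
  · simp [hxm t ht]
  · simp [hreg]
  · simp [hu]
  · simp [hy t ht]
  · simp [hym t ht]
  · simp [(hB t ht).1]
  · simp [hdot]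

end IsAdmissibleLoop

/-! ### Global solutions with clipped state and discontinuous reference. -/

theorem intervalIntegrable_of_norm_le {E : Type*} [NormedAddCommGroup E] {f : ℝ → E} {L : ℝ}
    (hm : MeasureTheory.AEStronglyMeasurable f MeasureTheory.volume) (hL : ∀ t, ‖f t‖ ≤ L)
    (a b : ℝ) : IntervalIntegrable f MeasureTheory.volume a b :=
  (intervalIntegrable_const (c := L)).mono_fun hm.restrict
    (Eventually.of_forall fun t => (hL t).trans (by simpa using le_abs_self L))

/-- Global solution of the integral equation for a bounded, globally Lipschitz vector field that is
only measurable in time. -/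
theorem exists_integral_solution {E : Type*} [NormedAddCommGroup E] [NormedSpace ℝ E]
    [CompleteSpace E] (F : ℝ → E → E) (x₀ : E) {L K : ℝ} (hK0 : 0 ≤ K)
    (hL : ∀ t x, ‖F t x‖ ≤ L) (hK : ∀ t x y, ‖F t x - F t y‖ ≤ K * ‖x - y‖)
    (hm : ∀ x : ℝ → E, Continuous x →
      MeasureTheory.AEStronglyMeasurable (fun s => F s (x s)) MeasureTheory.volume) :
    ∃ x : ℝ → E, Continuous x ∧ ∀ t, 0 ≤ t → x t = x₀ + ∫ s in (0 : ℝ)..t, F s (x s) := by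
  have hL0 : 0 ≤ L := (norm_nonneg _).trans (hL 0 0)
  -- The unknown is `z = exp (-μ t) x`; in this weighted norm the Picard map contracts by `K / μ <
  -- 1` on the whole half line at once.
  set μ := K + 1 with hμ
  have hμ0 : 0 < μ := by linarith
  let X (z : BoundedContinuousFunction ℝ E) (t : ℝ) : E := Real.exp (μ * t) • z t
  have hX : ∀ z, Continuous (X z) := fun z =>
    (by fun_prop : Continuous fun t : ℝ => Real.exp (μ * t)).smul z.continuous
  have hint : ∀ z a b, IntervalIntegrable (fun s => F s (X z s)) MeasureTheory.volume a b :=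
    fun z => intervalIntegrable_of_norm_le (hm _ (hX z)) (fun t => hL _ _)
  let I (z : BoundedContinuousFunction ℝ E) (t : ℝ) : E := x₀ + ∫ s in (0 : ℝ)..t, F s (X z s)
  have hI : ∀ z, Continuous (I z) := fun z =>
    continuous_const.add (intervalIntegral.continuous_primitive (hint z) 0)
  have hbound : ∀ z t, ‖Real.exp (-μ * max t 0) • I z (max t 0)‖ ≤ ‖x₀‖ + L / μ := by
    intro z t
    set τ := max t 0
    have hτ : 0 ≤ τ := le_max_right _ _
    have h1 : ‖I z τ‖ ≤ ‖x₀‖ + L * τ := by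
      refine (norm_add_le _ _).trans (add_le_add le_rfl ?_)
      have := intervalIntegral.norm_integral_le_of_norm_le_const (a := (0 : ℝ)) (b := τ)
        (f := fun s => F s (X z s)) (C := L) (fun s _ => hL _ _)
      simpa [abs_of_nonneg hτ] using this
    have h2 : Real.exp (-μ * τ) ≤ 1 := Real.exp_le_one_iff.2 (by nlinarith)
    have h3 : Real.exp (-μ * τ) * (μ * τ) ≤ 1 := by
      have h4 := Real.add_one_le_exp (μ * τ)
      have h5 : Real.exp (-μ * τ) * Real.exp (μ * τ) = 1 := by rw [← Real.exp_add]; simp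
      nlinarith [Real.exp_pos (-μ * τ)]
    rw [norm_smul, Real.norm_eq_abs, Real.abs_exp]
    calc Real.exp (-μ * τ) * ‖I z τ‖ ≤ Real.exp (-μ * τ) * (‖x₀‖ + L * τ) :=
          mul_le_mul_of_nonneg_left h1 (Real.exp_pos _).le
      _ = Real.exp (-μ * τ) * ‖x₀‖ + (Real.exp (-μ * τ) * (μ * τ)) * (L / μ) := by
          field_simp
      _ ≤ 1 * ‖x₀‖ + 1 * (L / μ) := by gcongr
      _ = _ := by ring
  -- Freezing time at `max t 0` makes the image bounded and continuous on all of `ℝ`; only `t ≥ 0`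
  -- matters.
  let Φ (z : BoundedContinuousFunction ℝ E) : BoundedContinuousFunction ℝ E :=
    BoundedContinuousFunction.ofNormedAddCommGroup
      (fun t => Real.exp (-μ * max t 0) • I z (max t 0))
      ((by fun_prop : Continuous fun t : ℝ => Real.exp (-μ * max t 0)).smul
        ((hI z).comp (by fun_prop))) _ (hbound z)
  have hΦ : ContractingWith (K / μ).toNNReal Φ := by
    refine ⟨?_, LipschitzWith.of_dist_le_mul fun z w => ?_⟩
    · rw [Real.toNNReal_lt_one]
      exact (div_lt_one hμ0).2 (by linarith)
    · rw [Real.coe_toNNReal _ (by positivity)]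
      refine (BoundedContinuousFunction.dist_le (by positivity)).2 fun t => ?_
      set τ := max t 0 with hτd
      have hτ : 0 ≤ τ := le_max_right _ _
      have h1 : Φ z t - Φ w t
          = Real.exp (-μ * τ) • ∫ s in (0 : ℝ)..τ, (F s (X z s) - F s (X w s)) := by
        rw [intervalIntegral.integral_sub (hint z _ _) (hint w _ _)]
        simp only [Φ, I, BoundedContinuousFunction.coe_ofNormedAddCommGroup, ← smul_sub, ← hτd,
          add_sub_add_left_eq_sub]
      have h2 : ‖∫ s in (0 : ℝ)..τ, (F s (X z s) - F s (X w s))‖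
          ≤ ∫ s in (0 : ℝ)..τ, K * dist z w * Real.exp (μ * s) := by
        refine intervalIntegral.norm_integral_le_of_norm_le hτ ?_
          ((by fun_prop : Continuous fun s : ℝ => K * dist z w * Real.exp (μ * s)).intervalIntegrable
            _ _)
        refine Eventually.of_forall fun s _ => (hK _ _ _).trans ?_
        have h3 : ‖X z s - X w s‖ ≤ Real.exp (μ * s) * dist z w := by
          simp only [X, ← smul_sub, norm_smul, Real.norm_eq_abs, Real.abs_exp, ← dist_eq_norm]
          exact mul_le_mul_of_nonneg_left (BoundedContinuousFunction.dist_coe_le_dist s)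
            (Real.exp_pos _).le
        calc K * ‖X z s - X w s‖ ≤ K * (Real.exp (μ * s) * dist z w) :=
              mul_le_mul_of_nonneg_left h3 hK0
          _ = _ := by ring
      have h4 : ∫ s in (0 : ℝ)..τ, K * dist z w * Real.exp (μ * s)
          = K * dist z w * ((Real.exp (μ * τ) - 1) / μ) := by
        have hd : ∀ s ∈ uIcc 0 τ, HasDerivAt (fun s : ℝ => Real.exp (μ * s) / μ)
            (Real.exp (μ * s)) s := by
          intro s _
          have := (((hasDerivAt_id s).const_mul μ).exp).div_const μ
          simpa [hμ0.ne'] using this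
        rw [intervalIntegral.integral_const_mul, intervalIntegral.integral_eq_sub_of_hasDerivAt hd
          ((by fun_prop : Continuous fun s : ℝ => Real.exp (μ * s)).intervalIntegrable _ _)]
        simp only [mul_zero, Real.exp_zero, sub_div]
      rw [dist_eq_norm, h1, norm_smul, Real.norm_eq_abs, Real.abs_exp]
      have h5 : Real.exp (-μ * τ) * Real.exp (μ * τ) = 1 := by rw [← Real.exp_add]; simp
      have h6 : 0 ≤ K / μ * dist z w := by positivity
      calc Real.exp (-μ * τ) * ‖∫ s in (0 : ℝ)..τ, (F s (X z s) - F s (X w s))‖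
          ≤ Real.exp (-μ * τ) * (K * dist z w * ((Real.exp (μ * τ) - 1) / μ)) :=
            mul_le_mul_of_nonneg_left (h4 ▸ h2) (Real.exp_pos _).le
        _ = K / μ * dist z w * (Real.exp (-μ * τ) * Real.exp (μ * τ) - Real.exp (-μ * τ)) := by
            field_simp
        _ ≤ K / μ * dist z w * 1 := by
            refine mul_le_mul_of_nonneg_left ?_ h6
            linarith [Real.exp_pos (-μ * τ)]
        _ = _ := mul_one _
  set z := hΦ.fixedPoint with hz
  have hfix : Φ z = z := hΦ.fixedPoint_isFixedPt
  refine ⟨X z, hX z, fun t ht => ?_⟩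
  have h1 : z t = Real.exp (-μ * t) • I z t := by
    conv_lhs => rw [← hfix]
    simp only [Φ, BoundedContinuousFunction.coe_ofNormedAddCommGroup, max_eq_left ht]
  have h2 : X z t = I z t := by
    show Real.exp (μ * t) • z t = _
    rw [h1, smul_smul, ← Real.exp_add]
    simp
  exact h2

/-- The state of the closed loop. -/
abbrev LoopState (n m : ℕ) : Type :=
  (Fin n → ℝ) × (Fin (n - 1) → ℝ) × (Fin (n - 1) → ℝ) × (GainIdx n → ℝ) × (Fin m → ℝ)

/-- The signals given by a state trajectory. -/
def Signals.ofState {n m : ℕ} (x : ℝ → LoopState n m) : Signals n m :=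
  ⟨fun t => (x t).1, fun t => (x t).2.1, fun t => (x t).2.2.1, fun t => (x t).2.2.2.1,
    fun t => (x t).2.2.2.2⟩

/-- The vector field of the closed loop at the reference value `a`. -/
noncomputable def loopField {n m : ℕ} (S : LoopData n m) (a : ℝ) (x : LoopState n m) :
    LoopState n m :=
  let σ := Signals.ofState fun _ => x
  (S.Ap *ᵥ x.1 + σ.u S (fun _ => a) 0 • S.bp, S.Lam *ᵥ x.2.1 + σ.u S (fun _ => a) 0 • S.blam,
    S.Lam *ᵥ x.2.2.1 + σ.y S 0 • S.blam,
    -(S.gam * Real.sign S.kp * σ.ey S 0) • σ.reg S (fun _ => a) 0,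
    S.Am *ᵥ x.2.2.2.2 + (S.km * a) • S.bm + σ.ey S 0 • S.ell)

section Smooth

variable {V : Type*} [NormedAddCommGroup V] [NormedSpace ℝ V] {ι : Type*} [Fintype ι]

theorem ContDiff.dotProduct {f g : V → ι → ℝ} (hf : ContDiff ℝ 1 f) (hg : ContDiff ℝ 1 g) :
    ContDiff ℝ 1 fun v => f v ⬝ᵥ g v :=
  ContDiff.sum fun i _ => (contDiff_pi.1 hf i).mul (contDiff_pi.1 hg i)

theorem ContDiff.mulVec {κ : Type*} [Fintype κ] (A : Matrix κ ι ℝ) {f : V → ι → ℝ}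
    (hf : ContDiff ℝ 1 f) : ContDiff ℝ 1 fun v => A *ᵥ f v :=
  contDiff_pi.2 fun _ => contDiff_const.dotProduct hf

end Smooth

theorem contDiff_loopField {n m : ℕ} (S : LoopData n m) :
    ContDiff ℝ 1 fun p : ℝ × LoopState n m => loopField S p.1 p.2 := by
  have hp : ContDiff ℝ 1 fun p : ℝ × LoopState n m => p.2.1 := by fun_prop
  have h1 : ContDiff ℝ 1 fun p : ℝ × LoopState n m => p.2.2.1 := by fun_prop
  have h2 : ContDiff ℝ 1 fun p : ℝ × LoopState n m => p.2.2.2.1 := by fun_prop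
  have ht : ContDiff ℝ 1 fun p : ℝ × LoopState n m => p.2.2.2.2.1 := by fun_prop
  have hm : ContDiff ℝ 1 fun p : ℝ × LoopState n m => p.2.2.2.2.2 := by fun_prop
  have hy : ContDiff ℝ 1 fun p : ℝ × LoopState n m =>
      (Signals.ofState fun _ => p.2).y S 0 := contDiff_const.mul (contDiff_const.dotProduct hp)
  have he : ContDiff ℝ 1 fun p : ℝ × LoopState n m =>
      (Signals.ofState fun _ => p.2).ey S 0 := hy.sub (contDiff_const.dotProduct hm)
  have hr : ContDiff ℝ 1 fun p : ℝ × LoopState n m =>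
      (Signals.ofState fun _ => p.2).reg S (fun _ => p.1) 0 := by
    refine contDiff_pi.2 ?_
    rintro (_ | i | _ | i)
    · exact contDiff_fst
    · exact contDiff_pi.1 h1 i
    · exact hy
    · exact contDiff_pi.1 h2 i
  have hu : ContDiff ℝ 1 fun p : ℝ × LoopState n m =>
      (Signals.ofState fun _ => p.2).u S (fun _ => p.1) 0 := ht.dotProduct hr
  exact ((hp.mulVec S.Ap).add (hu.smul contDiff_const)).prodMk <|
    ((h1.mulVec S.Lam).add (hu.smul contDiff_const)).prodMk <|
    ((h2.mulVec S.Lam).add (hy.smul contDiff_const)).prodMk <|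
    ((contDiff_const.mul he).neg.smul hr).prodMk <|
    (((hm.mulVec S.Am).add ((contDiff_const.mul contDiff_fst).smul contDiff_const)).add
      (he.smul contDiff_const))

/-- Coordinatewise projection onto `[-ρ, ρ]`. -/
def clipVec {ι : Type*} (ρ : ℝ) (v : ι → ℝ) : ι → ℝ := fun i => max (-ρ) (min ρ (v i))

theorem lipschitzWith_clipVec {ι : Type*} [Fintype ι] (ρ : ℝ) :
    LipschitzWith 1 (clipVec ρ : (ι → ℝ) → ι → ℝ) := by
  refine LipschitzWith.of_dist_le_mul fun v w => ?_
  rw [NNReal.coe_one, one_mul, dist_pi_le_iff dist_nonneg]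
  intro i
  refine le_trans ?_ (dist_le_pi_dist v w i)
  rw [Real.dist_eq, Real.dist_eq]
  unfold clipVec
  have h1 := abs_max_sub_max_le_max (-ρ) (min ρ (v i)) (-ρ) (min ρ (w i))
  have h2 := abs_min_sub_min_le_max ρ (v i) ρ (w i)
  simp only [sub_self, abs_zero, abs_nonneg, max_eq_right] at h1 h2
  exact h1.trans h2

theorem norm_clipVec_le {ι : Type*} [Fintype ι] {ρ : ℝ} (hρ : 0 ≤ ρ) (v : ι → ℝ) :
    ‖clipVec ρ v‖ ≤ ρ := by
  rw [pi_norm_le_iff_of_nonneg hρ]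
  intro i
  rw [Real.norm_eq_abs, abs_le]
  exact ⟨le_max_left _ _, max_le (by linarith) (min_le_left _ _)⟩

theorem clipVec_eq_self {ι : Type*} [Fintype ι] {ρ : ℝ} {v : ι → ℝ} (hv : ‖v‖ ≤ ρ) :
    clipVec ρ v = v := by
  ext i
  have h := abs_le.1 ((norm_le_pi_norm v i).trans hv)
  rw [clipVec, min_eq_right h.2, max_eq_right h.1]

/-- Coordinatewise projection of the loop state onto `[-ρ, ρ]`. -/
def clipState {n m : ℕ} (ρ : ℝ) (x : LoopState n m) : LoopState n m :=
  (clipVec ρ x.1, clipVec ρ x.2.1, clipVec ρ x.2.2.1, clipVec ρ x.2.2.2.1, clipVec ρ x.2.2.2.2)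

theorem LoopState.norm_le_iff {n m : ℕ} {x : LoopState n m} {ρ : ℝ} : ‖x‖ ≤ ρ ↔
    ‖x.1‖ ≤ ρ ∧ ‖x.2.1‖ ≤ ρ ∧ ‖x.2.2.1‖ ≤ ρ ∧ ‖x.2.2.2.1‖ ≤ ρ ∧ ‖x.2.2.2.2‖ ≤ ρ := by
  simp only [Prod.norm_def, sup_le_iff]

theorem lipschitzWith_clipState {n m : ℕ} (ρ : ℝ) :
    LipschitzWith 1 (clipState ρ : LoopState n m → LoopState n m) := by
  refine LipschitzWith.of_dist_le_mul fun x y => ?_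
  have h : ∀ {ι : Type} [Fintype ι] (v w : ι → ℝ), ‖clipVec ρ v - clipVec ρ w‖ ≤ ‖v - w‖ :=
    fun v w => by simpa [dist_eq_norm] using (lipschitzWith_clipVec ρ).dist_le_mul v w
  have hxy := LoopState.norm_le_iff.1 (le_refl ‖x - y‖)
  rw [NNReal.coe_one, one_mul, dist_eq_norm, dist_eq_norm]
  exact LoopState.norm_le_iff.2 ⟨(h _ _).trans hxy.1, (h _ _).trans hxy.2.1,
    (h _ _).trans hxy.2.2.1, (h _ _).trans hxy.2.2.2.1, (h _ _).trans hxy.2.2.2.2⟩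

theorem norm_clipState_le {n m : ℕ} {ρ : ℝ} (hρ : 0 ≤ ρ) (x : LoopState n m) :
    ‖clipState ρ x‖ ≤ ρ :=
  LoopState.norm_le_iff.2 ⟨norm_clipVec_le hρ _, norm_clipVec_le hρ _, norm_clipVec_le hρ _,
    norm_clipVec_le hρ _, norm_clipVec_le hρ _⟩

theorem clipState_eq_self {n m : ℕ} {ρ : ℝ} {x : LoopState n m} (hx : ‖x‖ ≤ ρ) :
    clipState ρ x = x := by
  obtain ⟨h1, h2, h3, h4, h5⟩ := LoopState.norm_le_iff.1 hx
  simp only [clipState, clipVec_eq_self h1, clipVec_eq_self h2, clipVec_eq_self h3,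
    clipVec_eq_self h4, clipVec_eq_self h5]

/-- The discontinuities in `(0, ∞)` are countable, hence null. -/
theorem IsPiecewiseContinuous.aestronglyMeasurable {r : ℝ → ℝ} (hr : IsPiecewiseContinuous r) :
    MeasureTheory.AEStronglyMeasurable ((Ici 0).indicator r) MeasureTheory.volume := by
  have hD : {t : ℝ | 0 < t ∧ ¬ ContinuousAt r t}.Countable := by
    have : {t : ℝ | 0 < t ∧ ¬ ContinuousAt r t}
        = ⋃ k : ℕ, {t : ℝ | 0 < t ∧ t ≤ k ∧ ¬ ContinuousAt r t} := by
      ext t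
      simp only [mem_ofPred_eq, mem_iUnion]
      refine ⟨fun h => ?_, fun ⟨k, h⟩ => ⟨h.1, h.2.2⟩⟩
      obtain ⟨k, hk⟩ := exists_nat_ge t
      exact ⟨k, h.1, hk, h.2⟩
    rw [this]
    exact countable_iUnion fun k => (hr.1 k).countable
  rw [aestronglyMeasurable_indicator_iff measurableSet_Ici]
  have hae : (Ici (0 : ℝ)) =ᵐ[MeasureTheory.volume]
      (Ioi (0 : ℝ) \ {t : ℝ | 0 < t ∧ ¬ ContinuousAt r t} : Set ℝ) := by
    refine MeasureTheory.Ioi_ae_eq_Ici.symm.trans ?_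
    exact (MeasureTheory.sdiff_null_ae_eq_self (hD.measure_zero _)).symm
  rw [MeasureTheory.Measure.restrict_congr_set hae]
  refine ContinuousOn.aestronglyMeasurable ?_ (measurableSet_Ioi.diff hD.measurableSet)
  intro t ht
  have : ContinuousAt r t := by
    by_contra hcon
    exact ht.2 ⟨ht.1, hcon⟩
  exact this.continuousWithinAt

/-- Existence of a global trajectory of a vector field with clipped state, driven by a bounded
piecewise continuous signal. -/
theorem exists_clipped_solution {E : Type*} [NormedAddCommGroup E] [NormedSpace ℝ E]
    [FiniteDimensional ℝ E] {G : ℝ × E → E} (hsm : ContDiff ℝ 1 G) {c : E → E}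
    (hc : LipschitzWith 1 c) {ρ : ℝ} (hcρ : ∀ x, ‖c x‖ ≤ ρ) {r : ℝ → ℝ}
    (hr : IsPiecewiseContinuous r) {M : ℝ} (hM : ∀ t, 0 ≤ t → |r t| ≤ M) (x₀ : E) :
    ∃ x : ℝ → E, Continuous x ∧ x 0 = x₀ ∧ ∀ t, 0 < t → ContinuousAt r t →
      HasDerivAt x (G (r t, c (x t))) t := by
  have : CompleteSpace E := FiniteDimensional.complete ℝ E
  have : ProperSpace E := FiniteDimensional.proper ℝ E
  have hM0 : 0 ≤ M := (abs_nonneg _).trans (hM 0 le_rfl)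
  -- Nothing is known of `r` at negative times, so it is replaced by zero there.
  set r₀ := (Ici (0 : ℝ)).indicator r with hr₀
  have hr₀M : ∀ t, |r₀ t| ≤ M := by
    intro t
    by_cases ht : 0 ≤ t
    · rw [hr₀, indicator_of_mem (mem_Ici.2 ht)]; exact hM t ht
    · rw [hr₀, indicator_of_notMem (by simpa using ht)]; simpa using hM0
  -- Bounded reference values and clipped states stay in this compact ball, on which the smooth
  -- field is bounded and Lipschitz.
  set C := Metric.closedBall (0 : ℝ × E) (max M ρ)
  have hC : IsCompact C := isCompact_closedBall _ _
  have hmem : ∀ t x, (r₀ t, c x) ∈ C := by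
    intro t x
    rw [mem_closedBall_zero_iff, Prod.norm_def]
    exact max_le_max (hr₀M t) (hcρ x)
  obtain ⟨K, hK⟩ := (hsm.locallyLipschitz.locallyLipschitzOn (s := C)).exists_lipschitzOnWith_of_compact hC
  obtain ⟨L, hL⟩ := hC.exists_bound_of_continuousOn hsm.continuous.continuousOn
  obtain ⟨x, hx, hxi⟩ := exists_integral_solution
    (fun t x => G (r₀ t, c x)) x₀ K.2
    (fun t x => hL _ (hmem t x))
    (fun t x y => by
      have h1 := hK.dist_le_mul _ (hmem t x) _ (hmem t y)
      rw [dist_eq_norm] at h1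
      refine h1.trans (mul_le_mul_of_nonneg_left ?_ K.2)
      have h2 := hc.dist_le_mul x y
      rw [NNReal.coe_one, one_mul, dist_eq_norm x] at h2
      rw [Prod.dist_eq]
      simpa using h2)
    (fun x hx => hsm.continuous.comp_aestronglyMeasurable
      (hr.aestronglyMeasurable.prodMk
        (hc.continuous.comp hx).aestronglyMeasurable))
  refine ⟨x, hx, by simpa using hxi 0 le_rfl, fun t ht hrt => ?_⟩
  have hev : r₀ =ᶠ[𝓝 t] r := by
    filter_upwards [Ioi_mem_nhds ht] with s hs
    exact indicator_of_mem (mem_Ici.2 (le_of_lt hs)) r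
  have hcont : ContinuousAt (fun s => G (r₀ s, c (x s))) t := by
    have h1 : ContinuousAt (fun s => (r₀ s, c (x s))) t :=
      (hrt.congr hev.symm).prodMk (hc.continuous.comp hx).continuousAt
    exact hsm.continuous.continuousAt.tendsto.comp h1
  have hmeas : MeasureTheory.AEStronglyMeasurable
      (fun s => G (r₀ s, c (x s))) MeasureTheory.volume :=
    hsm.continuous.comp_aestronglyMeasurable (hr.aestronglyMeasurable.prodMk
      (hc.continuous.comp hx).aestronglyMeasurable)
  have hder := (intervalIntegral.integral_hasDerivAt_right
    (intervalIntegrable_of_norm_le hmeas (fun s => hL _ (hmem s (x s))) 0 t)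
    (hmeas.stronglyMeasurableAtFilter) hcont).const_add x₀
  rw [hev.eq_of_nhds] at hder
  refine hder.congr_of_eventuallyEq ?_
  filter_upwards [Ioi_mem_nhds ht] with s hs
  exact hxi s (le_of_lt hs)

/-! ### Convergence of a dissipated signal. -/

theorem exists_tendsto_of_antitoneOn_Ici {f : ℝ → ℝ} {m : ℝ} (hf : AntitoneOn f (Ici 0))
    (hm : ∀ t, 0 ≤ t → m ≤ f t) : ∃ L, Tendsto f atTop (𝓝 L) := by
  have hg : Antitone fun t => f (max t 0) := fun a b hab =>
    hf (le_max_right a 0) (le_max_right b 0) (max_le_max_right 0 hab)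
  refine ⟨_, (tendsto_atTop_ciInf hg ⟨m, ?_⟩).congr' ?_⟩
  · rintro _ ⟨t, rfl⟩
    exact hm _ (le_max_right t 0)
  · filter_upwards [eventually_ge_atTop 0] with t ht
    rw [max_eq_left ht]

theorem antitoneOn_Ici_of_antitoneOn_Icc {f : ℝ → ℝ} (hf : ∀ T, AntitoneOn f (Icc 0 T)) :
    AntitoneOn f (Ici 0) :=
  fun _ ha b hb hab => hf b ⟨ha, hab⟩ ⟨hb, le_rfl⟩ hab

/-- A bounded signal with bounded derivative tends to zero when its square is dominated by the
decrease of a nonnegative storage function. -/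
theorem tendsto_zero_of_dissipation {e W : ℝ → ℝ} {c B : ℝ} (hc : 0 < c)
    (hW : ∀ t, 0 ≤ t → 0 ≤ W t) (he : ∀ t, 0 ≤ t → |e t| ≤ B)
    (h : ∀ T : ℝ, ∃ (s : Set ℝ) (e' W' : ℝ → ℝ), s.Finite ∧ HasDerivOff s T e e' ∧
      HasDerivOff s T W W' ∧ ∀ t ∈ Ioo 0 T, t ∉ s → |e' t| ≤ B ∧ W' t ≤ -c * e t ^ 2) :
    Tendsto e atTop (𝓝 0) := by
  have hB : 0 ≤ B := (abs_nonneg _).trans (he 0 le_rfl)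
  -- With this weight `a W` decreases at least as fast as `±e³` can grow, since `|(e³)'| ≤ 3 B e²`.
  -- Hence `e³ + a W` and `-e³ + a W` are monotone and bounded below, both converge, and so does
  -- `e³`.
  set a := 3 * B / c with ha
  have hac : a * c = 3 * B := by rw [ha]; field_simp
  have ha0 : 0 ≤ a := by positivity
  have hlim : ∀ ς : ℝ, |ς| ≤ 1 → ∃ L, Tendsto (fun t => ς * (e t * (e t * e t)) + a * W t)
      atTop (𝓝 L) := by
    intro ς hς
    refine exists_tendsto_of_antitoneOn_Ici (m := -(B * (B * B)))
      (antitoneOn_Ici_of_antitoneOn_Icc fun T => ?_) fun t ht => ?_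
    · obtain ⟨s, e', W', hs, h1, h2, h3⟩ := h T
      refine (((h1.mul (h1.mul h1)).const_mul ς).add (h2.const_mul a)).antitoneOn hs ?_
      intro t ht hts
      obtain ⟨h4, h5⟩ := h3 t ht hts
      have h6 : ς * e' t ≤ B := by
        calc ς * e' t ≤ |ς * e' t| := le_abs_self _
          _ = |ς| * |e' t| := abs_mul _ _
          _ ≤ 1 * B := mul_le_mul hς h4 (abs_nonneg _) zero_le_one
          _ = B := one_mul _
      have h7 := mul_le_mul_of_nonneg_left h5 ha0
      have h8 := mul_le_mul_of_nonneg_right h6 (sq_nonneg (e t))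
      have h9 : a * (-c * e t ^ 2) = -(3 * B * e t ^ 2) := by rw [← hac]; ring
      linarith
    · have h1 : |ς * (e t * (e t * e t))| ≤ 1 * (B * (B * B)) := by
        have := he t ht
        rw [abs_mul, abs_mul, abs_mul]
        gcongr
      have h2 := (abs_le.1 h1).1
      have h3 := mul_nonneg ha0 (hW t ht)
      linarith
  obtain ⟨L₁, h1⟩ := hlim 1 (by simp)
  obtain ⟨L₂, h2⟩ := hlim (-1) (by simp)
  obtain ⟨L, hL⟩ : ∃ L, Tendsto (fun t => e t ^ 3) atTop (𝓝 L) :=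
    ⟨(L₁ - L₂) / 2, ((h1.sub h2).div_const 2).congr fun t => by ring⟩
  -- A nonzero limit would keep `e²` away from zero, and `W` would decrease linearly below zero.
  have hL0 : L = 0 := by
    by_contra hne
    have hLp : 0 < |L| := abs_pos.2 hne
    obtain ⟨t₀, ht₀⟩ := eventually_atTop.1
      (hL.abs.eventually (lt_mem_nhds (half_lt_self hLp)))
    set τ := max t₀ 0
    have hτ : 0 ≤ τ := le_max_right _ _
    have hκ : ∀ t, τ ≤ t → |L| / 2 < B * e t ^ 2 := by
      intro t ht
      refine (ht₀ t ((le_max_left _ _).trans ht)).trans_le ?_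
      rw [pow_succ' (e t) 2, abs_mul, abs_of_nonneg (sq_nonneg (e t))]
      exact mul_le_mul_of_nonneg_right (he t (hτ.trans ht)) (sq_nonneg _)
    have hBp : 0 < B := by
      by_contra hcon
      have h3 := hκ τ le_rfl
      rw [le_antisymm (not_lt.1 hcon) hB, zero_mul] at h3
      linarith
    set k := c * (|L| / 2 / B) with hk
    have hkp : 0 < k := by positivity
    have hdec : ∀ t, τ ≤ t → W t + k * t ≤ W τ + k * τ := by
      intro t ht
      obtain ⟨s, e', W', hs, -, h3, h4⟩ := h t
      refine le_of_hasDerivAt_nonpos_off_finite hs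
        (f := fun t => W t + k * t) (f' := fun t => W' t + k * 1) ht ?_ ?_ ?_
      · exact (h3.cont.mono (Icc_subset_Icc_left hτ)).add (by fun_prop)
      · intro q hq hqs
        exact (h3.deriv q ⟨hτ.trans_lt hq.1, hq.2⟩ hqs).add ((hasDerivAt_id q).const_mul k)
      · intro q hq hqs
        have h5 := (h4 q ⟨hτ.trans_lt hq.1, hq.2⟩ hqs).2
        have h6 : |L| / 2 / B ≤ e q ^ 2 := by
          rw [div_le_iff₀ hBp, mul_comm]
          exact (hκ q hq.1.le).le
        have h7 := mul_le_mul_of_nonneg_left h6 hc.le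
        linarith
    have h3 := hdec (τ + (W τ + 1) / k) (by
      have := hW τ hτ
      have : 0 ≤ (W τ + 1) / k := by positivity
      linarith)
    have h4 := hW (τ + (W τ + 1) / k) (by
      have := hW τ hτ
      positivity)
    have h5 : k * (τ + (W τ + 1) / k) = k * τ + (W τ + 1) := by field_simp
    linarith
  rw [hL0] at hL
  rw [Metric.tendsto_atTop]
  intro ε hε
  obtain ⟨N, hN⟩ := Metric.tendsto_atTop.1 hL (ε ^ 3) (by positivity)
  refine ⟨N, fun t ht => ?_⟩
  have h3 := hN t ht
  rw [Real.dist_eq, sub_zero] at h3 ⊢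
  rw [abs_pow] at h3
  exact lt_of_pow_lt_pow_left₀ 3 hε.le h3

/-! ### Uniform bounds, global existence and convergence for the loop. -/

/-- Supplies the filter of `e_y`, which the Lyapunov function needs and the loop does not contain.
-/
theorem exists_filter_state {q : ℕ} (A : Matrix (Fin q) (Fin q) ℝ) (b : Fin q → ℝ) {f : ℝ → ℝ}
    {T : ℝ} (hT : 0 ≤ T) (hf : ContinuousOn f (Icc 0 T)) (s : Set ℝ) :
    ∃ x : ℝ → Fin q → ℝ, x 0 = 0 ∧ HasDerivOff s T x (fun t => A *ᵥ x t + f t • b) := by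
  obtain ⟨x, hx0, hx⟩ := exists_hasDerivAt_linear A b 0
    (f := IccExtend hT ((Icc 0 T).domRestrict f)) (hf.domRestrict.Icc_extend')
  refine ⟨x, hx0, (HasDerivOff.of_hasDerivAt hx).congr fun t ht _ => ?_⟩
  rw [IccExtend_of_mem hT _ (Ioo_subset_Icc_self ht), domRestrict_apply]

theorem exists_filter_state_Ici {q : ℕ} (A : Matrix (Fin q) (Fin q) ℝ) (b : Fin q → ℝ)
    {f : ℝ → ℝ} (hf : ContinuousOn f (Ici 0)) :
    ∃ x : ℝ → Fin q → ℝ, x 0 = 0 ∧ ∀ s T, HasDerivOff s T x (fun t => A *ᵥ x t + f t • b) := by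
  obtain ⟨x, hx0, hx⟩ := exists_hasDerivAt_linear A b 0 (f := fun t => f (max t 0))
    (hf.comp_continuous (by fun_prop) fun t => le_max_right t 0)
  refine ⟨x, hx0, fun s T => (HasDerivOff.of_hasDerivAt hx).congr fun t ht _ => ?_⟩
  rw [max_eq_left ht.1.le]

section Loop

variable {n m : ℕ} {S : LoopData n m} {Z P Zm Pm : ℝ[X]}

namespace IsAdmissibleLoop

/-- All signals of a solution on `[0, T]`, and the derivative of the model following error, are
bounded independently of `T`. -/
theorem exists_bound (h : IsAdmissibleLoop S Z P Zm Pm) (M R : ℝ) :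
    ∃ B : ℝ, ∀ (r : ℝ → ℝ) (s : Set ℝ) (T : ℝ) (σ : Signals n m), s.Finite →
      IsPartialSolution S r s T σ → (∀ t ∈ Icc 0 T, |r t| ≤ M) →
      ‖σ.xp 0‖ ≤ R → ‖σ.w1 0‖ ≤ R → ‖σ.w2 0‖ ≤ R → ‖σ.th 0‖ ≤ R → ‖σ.xm 0‖ ≤ R →
      ∀ t ∈ Icc 0 T,
        (‖σ.xp t‖ ≤ B ∧ ‖σ.w1 t‖ ≤ B ∧ ‖σ.w2 t‖ ≤ B ∧ ‖σ.th t‖ ≤ B ∧ ‖σ.xm t‖ ≤ B ∧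
          ‖σ.reg S r t‖ ≤ B ∧ |σ.u S r t| ≤ B ∧
          |σ.y S t| ≤ B ∧ |σ.ym S t| ≤ B ∧ |σ.ey S t| ≤ B) ∧ |σ.eyDot S r t| ≤ B := by
  obtain ⟨F, c, B₀, B₁, hc, -, hF, hmain⟩ := h.exists_lyapunov R
  obtain ⟨B, hB⟩ := h.exists_bound_of_error_bound M R B₁
  refine ⟨B, fun r s T σ hs hσ hr h1 h2 h3 h4 h5 => hB r s T σ hs hσ hr h1 h2 h3 h5 ?_⟩
  intro t ht
  have hT : 0 ≤ T := ht.1.trans ht.2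
  obtain ⟨we, hwe0, hwe⟩ := exists_filter_state S.Lam S.blam hT hσ.hasDerivOff_ey.cont s
  obtain ⟨h6, W', h7, h8⟩ := hmain r s T σ we hs hσ h1 h2 h3 h4 h5 hwe0 hwe
  have hanti := h7.antitoneOn hs fun q hq hqs =>
    (h8 q hq hqs).trans (by nlinarith [sq_nonneg (σ.ey S q)])
  exact hF _ _ _ _ ((hanti ⟨le_rfl, hT⟩ ht ht.1).trans h6)

end IsAdmissibleLoop

theorem IsLoopSolution.isPartialSolution {r : ℝ → ℝ} {σ : Signals n m}
    (hσ : IsLoopSolution S r σ) (T : ℝ) :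
    IsPartialSolution S r {t | 0 < t ∧ t ≤ T ∧ ¬ ContinuousAt r t} T σ := by
  have hc : ∀ t ∈ Ioo 0 T, t ∉ {t | 0 < t ∧ t ≤ T ∧ ¬ ContinuousAt r t} → ContinuousAt r t :=
    fun t ht hts => by
      by_contra hcon
      exact hts ⟨ht.1, ht.2.le, hcon⟩
  exact
    { plant := ⟨hσ.cont_xp.mono Icc_subset_Ici_self, fun t ht hts =>
        hσ.plant t ht.1 (hc t ht hts)⟩
      filter1 := ⟨hσ.cont_w1.mono Icc_subset_Ici_self, fun t ht hts =>
        hσ.filter1 t ht.1 (hc t ht hts)⟩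
      filter2 := ⟨hσ.cont_w2.mono Icc_subset_Ici_self, fun t ht hts =>
        hσ.filter2 t ht.1 (hc t ht hts)⟩
      adapt := ⟨hσ.cont_th.mono Icc_subset_Ici_self, fun t ht hts =>
        hσ.adapt t ht.1 (hc t ht hts)⟩
      refModel := ⟨hσ.cont_xm.mono Icc_subset_Ici_self, fun t ht hts =>
        hσ.refModel t ht.1 (hc t ht hts)⟩ }

theorem IsPartialSolution.of_state {r : ℝ → ℝ} {T : ℝ} {x : ℝ → LoopState n m}
    (hx : Continuous x)
    (hd : ∀ t ∈ Ioo 0 T, ContinuousAt r t → HasDerivAt x (loopField S (r t) (x t)) t) :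
    IsPartialSolution S r {t | 0 < t ∧ t ≤ T ∧ ¬ ContinuousAt r t} T (Signals.ofState x) := by
  have hd' : ∀ t ∈ Ioo 0 T, t ∉ {t | 0 < t ∧ t ≤ T ∧ ¬ ContinuousAt r t} →
      HasDerivAt x (loopField S (r t) (x t)) t := fun t ht hts => hd t ht <| by
    by_contra hcon
    exact hts ⟨ht.1, ht.2.le, hcon⟩
  exact
    { plant := ⟨hx.fst.continuousOn, fun t ht hts => (hd' t ht hts).fst⟩
      filter1 := ⟨hx.snd.fst.continuousOn, fun t ht hts => (hd' t ht hts).snd.fst⟩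
      filter2 := ⟨hx.snd.snd.fst.continuousOn, fun t ht hts => (hd' t ht hts).snd.snd.fst⟩
      adapt := ⟨hx.snd.snd.snd.fst.continuousOn, fun t ht hts =>
        (hd' t ht hts).snd.snd.snd.fst⟩
      refModel := ⟨hx.snd.snd.snd.snd.continuousOn, fun t ht hts =>
        (hd' t ht hts).snd.snd.snd.snd⟩ }

theorem IsLoopSolution.of_state {r : ℝ → ℝ} {x : ℝ → LoopState n m} (hx : Continuous x)
    (hd : ∀ t, 0 < t → ContinuousAt r t → HasDerivAt x (loopField S (r t) (x t)) t) :
    IsLoopSolution S r (Signals.ofState x) where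
  cont_xp := hx.fst.continuousOn
  cont_w1 := hx.snd.fst.continuousOn
  cont_w2 := hx.snd.snd.fst.continuousOn
  cont_th := hx.snd.snd.snd.fst.continuousOn
  cont_xm := hx.snd.snd.snd.snd.continuousOn
  plant t ht hr := (hd t ht hr).fst
  filter1 t ht hr := (hd t ht hr).snd.fst
  filter2 t ht hr := (hd t ht hr).snd.snd.fst
  adapt t ht hr := (hd t ht hr).snd.snd.snd.fst
  refModel t ht hr := (hd t ht hr).snd.snd.snd.snd

namespace IsAdmissibleLoop

theorem exists_isLoopSolution (h : IsAdmissibleLoop S Z P Zm Pm) {r : ℝ → ℝ}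
    (hr : IsPiecewiseContinuous r) {M : ℝ} (hM : ∀ t, 0 ≤ t → |r t| ≤ M)
    (x₀ : LoopState n m) :
    ∃ x : ℝ → LoopState n m, x 0 = x₀ ∧ IsLoopSolution S r (Signals.ofState x) := by
  obtain ⟨B, hB⟩ := h.exists_bound M ‖x₀‖
  -- The clipping level lies strictly above the a priori bound, so that the first time it is reached
  -- yields a contradiction.
  set ρ := max B ‖x₀‖ + 1 with hρ
  have hρB : B < ρ := (le_max_left B ‖x₀‖).trans_lt (lt_add_one _)
  have hρ₀ : ‖x₀‖ < ρ := (le_max_right B ‖x₀‖).trans_lt (lt_add_one _)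
  obtain ⟨x, hx, hx0, hd⟩ := exists_clipped_solution (contDiff_loopField S)
    (lipschitzWith_clipState ρ) (norm_clipState_le ((norm_nonneg x₀).trans hρ₀.le)) hr hM x₀
  have hlt : ∀ t, 0 ≤ t → ‖x t‖ < ρ := by
    by_contra! hcon
    set E := {t | 0 ≤ t ∧ ρ ≤ ‖x t‖}
    have hE : IsClosed E := isClosed_Ici.inter (isClosed_le continuous_const hx.norm)
    have hbdd : BddBelow E := ⟨0, fun t ht => ht.1⟩
    -- Before this first time clipping is inactive and the trajectory solves the true loop, so the
    -- uniform bound holds up to and including it.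
    have hT : sInf E ∈ E := hE.csInf_mem hcon hbdd
    have hbefore : ∀ t ∈ Ioo 0 (sInf E), ‖x t‖ ≤ ρ := fun t ht => by
      by_contra! hgt
      exact (csInf_le hbdd ⟨ht.1.le, hgt.le⟩).not_gt ht.2
    have hσ : IsPartialSolution S r _ (sInf E) (Signals.ofState x) :=
      IsPartialSolution.of_state hx fun t ht hrt => by
        simpa only [clipState_eq_self (hbefore t ht)] using hd t ht.1 hrt
    have h0 : ‖x 0‖ ≤ ‖x₀‖ := by rw [hx0]
    obtain ⟨g1, g2, g3, g4, g5⟩ := LoopState.norm_le_iff.1 h0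
    have hb := (hB r _ _ _ (hr.1 _) hσ (fun t ht => hM t ht.1) g1 g2 g3 g4 g5 (sInf E)
      ⟨hT.1, le_rfl⟩).1
    have : ‖x (sInf E)‖ ≤ B :=
      LoopState.norm_le_iff.2 ⟨hb.1, hb.2.1, hb.2.2.1, hb.2.2.2.1, hb.2.2.2.2.1⟩
    exact (hρB.trans_le hT.2).not_ge this
  refine ⟨x, hx0, IsLoopSolution.of_state hx fun t ht hrt => ?_⟩
  simpa only [clipState_eq_self (hlt t ht.le).le] using hd t ht hrt

theorem tendsto_ey (h : IsAdmissibleLoop S Z P Zm Pm) {r : ℝ → ℝ}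
    (hr : IsPiecewiseContinuous r) {M : ℝ} (hM : ∀ t, 0 ≤ t → |r t| ≤ M) {σ : Signals n m}
    (hσ : IsLoopSolution S r σ) : Tendsto (σ.ey S) atTop (𝓝 0) := by
  obtain ⟨R, g1, g2, g3, g4, g5⟩ : ∃ R, ‖σ.xp 0‖ ≤ R ∧ ‖σ.w1 0‖ ≤ R ∧ ‖σ.w2 0‖ ≤ R ∧
      ‖σ.th 0‖ ≤ R ∧ ‖σ.xm 0‖ ≤ R :=
    ⟨_, LoopState.norm_le_iff.1
      (le_refl ‖((σ.xp 0, σ.w1 0, σ.w2 0, σ.th 0, σ.xm 0) : LoopState n m)‖)⟩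
  obtain ⟨B, hB⟩ := h.exists_bound M R
  obtain ⟨F, c, B₀, B₁, hc, hF0, -, hmain⟩ := h.exists_lyapunov R
  have hbound := fun T => hB r _ T σ (hr.1 T) (hσ.isPartialSolution T) (fun t ht => hM t ht.1)
    g1 g2 g3 g4 g5
  have hcont : ContinuousOn (σ.ey S) (Ici 0) := by
    intro t ht
    have h1 := (hσ.isPartialSolution (t + 1)).hasDerivOff_ey.cont t ⟨ht, by linarith⟩
    refine h1.mono_of_mem_nhdsWithin ?_
    rw [← Ici_inter_Iic]
    exact inter_mem self_mem_nhdsWithin (mem_nhdsWithin_of_mem_nhds (Iic_mem_nhds (lt_add_one t)))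
  obtain ⟨we, hwe0, hwe⟩ := exists_filter_state_Ici S.Lam S.blam hcont
  refine tendsto_zero_of_dissipation (W := fun t => F (σ.ey S t) (we t) (σ.th t) t) (B := B) hc
    (fun t _ => hF0 _ _ _ _)
    (fun t ht => (hbound t t ⟨ht, le_rfl⟩).1.2.2.2.2.2.2.2.2.2) fun T => ?_
  obtain ⟨-, W', h1, h2⟩ := hmain r _ T σ we (hr.1 T) (hσ.isPartialSolution T) g1 g2 g3 g4 g5
    hwe0 (hwe _ T)
  exact ⟨_, σ.eyDot S r, W', hr.1 T, (hσ.isPartialSolution T).hasDerivOff_ey, h1,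
    fun t ht hts => ⟨(hbound T t (Ioo_subset_Icc_self ht)).2, h2 t ht hts⟩⟩

end IsAdmissibleLoop

end Loop

theorem theorem3 {n m : ℕ} (S : LoopData n m) (Z P Zm Pm : ℝ[X])
    -- plant `k_p Z / P`: order `n`, relative degree one, minimum phase, nonzero gain
    (hZ_monic : Z.Monic) (hZ_deg : Z.natDegree + 1 = n)
    (hplant : IsRealization S.Ap S.bp S.cp Z P)
    (hZ_hurwitz : IsHurwitzPoly Z) (hkp : S.kp ≠ 0)
    -- reference model `k_m Z_m / P_m`: order `m`, relative degree one, stable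
    (hZm_monic : Zm.Monic) (hZm_deg : Zm.natDegree + 1 = m)
    (href : IsRealization S.Am S.bm S.cm Zm Pm)
    (hPm_hurwitz : IsHurwitzPoly Pm)
    -- filters: Hurwitz, controllable, and `Z_m` divides `det (s I - Λ)`
    (hLam_hurwitz : IsHurwitzPoly S.Lam.charpoly)
    (hLam_ctrb : IsControllablePair S.Lam S.blam)
    (hZm_dvd : Zm ∣ S.Lam.charpoly)
    (hgam : 0 < S.gam)
    -- the Luenberger gain makes the error transfer function strictly positive real
    (hspr : IsSPR Zm (Pm + tfNum S.Am S.ell S.cm)) :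
    -- solutions exist for all time, from every initial state
    (∀ r : ℝ → ℝ, IsPiecewiseContinuous r → (∃ M : ℝ, ∀ t, 0 ≤ t → |r t| ≤ M) →
      ∀ (xp₀ : Fin n → ℝ) (w1₀ w2₀ : Fin (n - 1) → ℝ) (th₀ : GainIdx n → ℝ) (xm₀ : Fin m → ℝ),
        ∃ σ : Signals n m, IsLoopSolution S r σ ∧
          σ.xp 0 = xp₀ ∧ σ.w1 0 = w1₀ ∧ σ.w2 0 = w2₀ ∧ σ.th 0 = th₀ ∧ σ.xm 0 = xm₀) ∧
    -- all signals are bounded, uniformly over bounded sets of references and initial states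
    (∀ M R : ℝ, ∃ B : ℝ, ∀ r : ℝ → ℝ, IsPiecewiseContinuous r → (∀ t, 0 ≤ t → |r t| ≤ M) →
      ∀ σ : Signals n m, IsLoopSolution S r σ →
        ‖σ.xp 0‖ ≤ R → ‖σ.w1 0‖ ≤ R → ‖σ.w2 0‖ ≤ R → ‖σ.th 0‖ ≤ R → ‖σ.xm 0‖ ≤ R →
        ∀ t, 0 ≤ t →
          ‖σ.xp t‖ ≤ B ∧ ‖σ.w1 t‖ ≤ B ∧ ‖σ.w2 t‖ ≤ B ∧ ‖σ.th t‖ ≤ B ∧ ‖σ.xm t‖ ≤ B ∧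
          ‖σ.reg S r t‖ ≤ B ∧ |σ.u S r t| ≤ B ∧
          |σ.y S t| ≤ B ∧ |σ.ym S t| ≤ B ∧ |σ.ey S t| ≤ B) ∧
    -- the model following error converges to zero
    (∀ r : ℝ → ℝ, IsPiecewiseContinuous r → (∃ M : ℝ, ∀ t, 0 ≤ t → |r t| ≤ M) →
      ∀ σ : Signals n m, IsLoopSolution S r σ → Tendsto (σ.ey S) atTop (𝓝 0)) := by
  have h : IsAdmissibleLoop S Z P Zm Pm := ⟨hZ_monic, hZ_deg, hplant, hZ_hurwitz, hkp, hZm_monic,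
    hZm_deg, href, hPm_hurwitz, hLam_hurwitz, hLam_ctrb, hZm_dvd, hgam, hspr⟩
  refine ⟨?_, ?_, ?_⟩
  · rintro r hr ⟨M, hM⟩ xp₀ w1₀ w2₀ th₀ xm₀
    obtain ⟨x, hx0, hx⟩ := h.exists_isLoopSolution hr hM (xp₀, w1₀, w2₀, th₀, xm₀)
    refine ⟨_, hx, ?_⟩
    simp only [Signals.ofState, hx0, and_self]
  · intro M R
    obtain ⟨B, hB⟩ := h.exists_bound M R
    exact ⟨B, fun r hr hM σ hσ g1 g2 g3 g4 g5 t ht => (hB r _ t σ (hr.1 t)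
      (hσ.isPartialSolution t) (fun q hq => hM q hq.1) g1 g2 g3 g4 g5 t ⟨ht, le_rfl⟩).1⟩
  · rintro r hr ⟨M, hM⟩ σ hσ
    exact h.tendsto_ey hr hM hσ
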